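/- **Conventions.** Let $R$ be a commutative ring with unit. Graded modules are $\mathbb Z$-graded $R$-modules $M=\bigoplus_i M_i$, with lower indices. A dg algebra $(A,d,\mu)$ is a graded module with a differential $d$ of degree $-1$, $d^2=0$, and an associative (not necessarily unital) product $\mu$ of degree $0$ with $d(ab)=(da)b+(-1)^{|a|}a\,(db)$; its homology $H(A)$ is a graded algebra with the induced product $\mu^*$. For a multilinear map $f_n$ of $n$ arguments on a graded module put, on homogeneous elements, $$f^s_n(a_1,\dots,a_n)=(-1)^{\sum_{i}(n-i)|a_i|}f_n(a_1,\dots,a_n),$$ and $\epsilon_k=\sum_{i\le k}(|a_i|+1)$. * An *$A_\infty$-algebra* $(M,\{m_n\}_{n\ge1})$ is a graded module with multilinear maps $m_n:M^{\otimes n}\to M$ of degree $n-2$ such that for all $n\ge 1$ $$\sum_{k=0}^{n-1}\sum_{j=1}^{n-k}(-1)^{\epsilon_k}\,m^s_{n-j+1}(a_1,\dots,a_k,m^s_j(a_{k+1},\dots,a_{k+j}),a_{k+j+1},\dots,a_n)=0 .$$ It is *minimal* if $m_1=0$. A dg algebra is the $A_\infty$-algebra with $m_1=d$, $m_2=\mu$,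 $m_n=0$ for $n\ge3$. * A *morphism* $\{f_n\}:(M,\{m_n\})\to(M',\{m'_n\})$ consists of multilinear maps $f_n:M^{\otimes n}\to M'$ of degree $n-1$ such that for all $n\ge 1$ $$\sum_{k,j}(-1)^{\epsilon_k}f^s_{n-j+1}(a_1,\dots,a_k,m^s_j(a_{k+1},\dots,a_{k+j}),\dots,a_n)=\sum_{t}\sum_{k_1+\dots+k_t=n}m'^s_t\big(f^s_{k_1}(a_1,\dots),\dots,f^s_{k_t}(\dots,a_n)\big),$$ with all $k_i\ge1$. The composition is given by $(g\circ f)^s_n=\sum_{k_1+\dots+k_t=n}g^s_t(f^s_{k_1},\dots,f^s_{k_t})$, the identity is $\{\mathrm{id},0,0,\dots\}$, and an *isomorphism* is an invertible morphism. A dga map $g$ is the morphism $\{g,0,0,\dots\}$. * Two morphisms $f,g:(M,\{m_n\})\to(M',\{m'_n\})$ are *homotopic* if there are multilinear maps $h_n:M^{\otimes n}\to M'$ of degree $n$ such that for all $n\ge 1$ $$f^s_n-g^s_n=\sum_{k,j}(-1)^{\epsilon_k}h^s_{n-j+1}(a_1,\dots,a_k,m^s_j(\dots),\dots,a_n)+\sum_{k_1+\dots+k_t=n}\sum_{i=1}^t(-1)^{\epsilon_{k_1+\dots+k_{i-1}}}m'^s_t(f^s_{k_1},\dots,f^s_{k_{i-1}},h^s_{k_i},g^s_{k_{i+1}},\dots,g^s_{k_t}).$$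 * The *bar construction* $B(M,\{m_n\})$ is the tensor coalgebra of the suspension of $M$ with the coderivation differential whose components are the $m_n$; a morphism $f$ induces a dg coalgebra map $B(f)$. For a dg algebra $A$, a *homology structure* on $H(A)$ is a pair $(\{m_n\},\{f_n\})$ in which $(H(A),\{m_n\})$ is an $A_\infty$-algebra with $m_1=0$ and $m_2=\mu^*$, and $\{f_n\}:(H(A),\{m_n\})\to A$ is a morphism of $A_\infty$-algebras such that $f_1$ is a homology isomorphism with $f_1^*=\mathrm{id}_{H(A)}$, i.e. $f_1(x)$ is a cycle in the class $x$ for every $x\in H(A)$. **Theorem (Minimality Theorem).** Let $A$ be a dg algebra over $R$ whose homology modules $H_i(A)$, $i\in\mathbb Z$, are all free. (a) There is a homology structure $(\{m_n\},\{f_n\})$ on $H(A)$. Moreover, if the submodule $Z(A)=\ker d\subset A$ is pure, that is, $N\otimes_R Z(A)\to N\otimes_R A$ is injective for every $R$-module $N$ (for instance if $R$ is a field, or a principal ideal domain with $A$ torsion-free), then for every homology structure the map $B(\{f_n\}):B(H(A),\{m_n\})\to B(A)$ is a homology isomorphism. (b) Let $A'$ be another dg algebra, $g:A\to A'$ a dga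 map, $(\{m_n\},\{f_n\})$ a homology structure on $H(A)$ and $(\{m'_n\},\{f'_n\})$ a homology structure on $H(A')$. Then there is a morphism of $A_\infty$-algebras $\{g_n\}:(H(A),\{m_n\})\to(H(A'),\{m'_n\})$ with $g_1=g^*$ such that the morphisms $\{f'_n\}\circ\{g_n\}$ and $g\circ\{f_n\}$ from $(H(A),\{m_n\})$ to $A'$ are homotopic. (c) If $(\{m_n\},\{f_n\})$ and $(\{m'_n\},\{f'_n\})$ are two homology structures on $H(A)$, then there is an isomorphism of $A_\infty$-algebras $\{g_n\}:(H(A),\{m_n\})\to(H(A),\{m'_n\})$ with $g_1=\mathrm{id}_{H(A)}$. -/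

import Mathlib

open scoped DirectSum

namespace AInf

universe u v w x

/-! ### Graded modules -/

/-- A `ℤ`-graded structure on the `R`-module `M`: `deg i` is the submodule of homogeneous elements
of degree `i` and `M` is the direct sum of these submodules. -/
structure Grading (R : Type u) [CommRing R] (M : Type v) [AddCommGroup M] [Module R M] where
  deg : ℤ → Submodule R M
  isInternal : DirectSum.IsInternal deg

namespace Grading

variable {R : Type u} [CommRing R] {M : Type v} [AddCommGroup M] [Module R M]

/-- `M` as the direct sum of its homogeneous parts. -/
noncomputable def equiv (G : Grading R M) : (⨁ i, G.deg i) ≃ₗ[R] M :=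
  LinearEquiv.ofBijective (DirectSum.coeLinearMap G.deg) G.isInternal

/-- The projection onto the homogeneous part of degree `i`. -/
noncomputable def proj (G : Grading R M) (i : ℤ) : M →ₗ[R] M :=
  (G.deg i).subtype ∘ₗ DirectSum.component R ℤ (fun i => G.deg i) i ∘ₗ
    (G.equiv.symm : M →ₗ[R] ⨁ i, G.deg i)

/-- The linear map `x ↦ (-1) ^ |x| x`. -/
noncomputable def parity (G : Grading R M) : M →ₗ[R] M :=
  DirectSum.toModule R ℤ M (fun i => (i.negOnePow : ℤ) • (G.deg i).subtype) ∘ₗ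
    (G.equiv.symm : M →ₗ[R] ⨁ i, G.deg i)

theorem equiv_lof (G : Grading R M) {i : ℤ} {a : M} (ha : a ∈ G.deg i) :
    G.equiv (DirectSum.lof R ℤ (fun i => G.deg i) i ⟨a, ha⟩) = a := by
  exact DirectSum.coeLinearMap_lof G.deg i ⟨a, ha⟩

theorem equiv_symm_of_mem (G : Grading R M) {i : ℤ} {a : M} (ha : a ∈ G.deg i) :
    G.equiv.symm a = DirectSum.lof R ℤ (fun i => G.deg i) i ⟨a, ha⟩ := by
  rw [LinearEquiv.symm_apply_eq, equiv_lof]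

theorem parity_of_mem (G : Grading R M) {i : ℤ} {a : M} (ha : a ∈ G.deg i) :
    G.parity a = (i.negOnePow : ℤ) • a := by
  simp [parity, G.equiv_symm_of_mem ha]

theorem proj_of_mem (G : Grading R M) {i : ℤ} {a : M} (ha : a ∈ G.deg i) :
    G.proj i a = a := by
  simp [proj, G.equiv_symm_of_mem ha, DirectSum.component.lof_self]

theorem proj_of_mem_ne (G : Grading R M) {i j : ℤ} (hij : i ≠ j) {a : M} (ha : a ∈ G.deg i) :
    G.proj j a = 0 := by
  simp [proj, G.equiv_symm_of_mem ha, DirectSum.component.of, hij]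

theorem proj_mem (G : Grading R M) (i : ℤ) (a : M) : G.proj i a ∈ G.deg i := by
  simp [proj]

/-- Linear maps that agree on homogeneous elements are equal. -/
theorem hom_ext (G : Grading R M) {N : Type w} [AddCommGroup N] [Module R N] {f g : M →ₗ[R] N}
    (h : ∀ i, ∀ a ∈ G.deg i, f a = g a) : f = g := by
  have : f ∘ₗ G.equiv.toLinearMap = g ∘ₗ G.equiv.toLinearMap := by
    apply DirectSum.linearMap_ext
    intro i
    ext ⟨a, ha⟩
    simpa [G.equiv_lof ha] using h i a ha
  ext a
  simpa using LinearMap.congr_fun this (G.equiv.symm a)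

theorem parity_parity (G : Grading R M) (a : M) : G.parity (G.parity a) = a := by
  have : G.parity ∘ₗ G.parity = LinearMap.id := by
    apply G.hom_ext
    intro i a ha
    simp only [LinearMap.comp_apply, G.parity_of_mem ha, map_zsmul, LinearMap.id_apply, smul_smul]
    rcases Int.even_or_odd i with h | h
    · simp [Int.negOnePow_even i h]
    · simp [Int.negOnePow_odd i h]
  exact LinearMap.congr_fun this a

end Grading

/-! ### Differential graded algebras -/

/-- A (not necessarily unital) differential graded algebra on the `R`-module `A`, with a
differential of degree `-1`. -/
structure DGAlgebra (R : Type u) [CommRing R] (A : Type v) [AddCommGroup A] [Module R A]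
    extends Grading R A where
  d : A →ₗ[R] A
  mul : A →ₗ[R] A →ₗ[R] A
  d_mem : ∀ i, ∀ a ∈ deg i, d a ∈ deg (i - 1)
  d_d : ∀ a, d (d a) = 0
  mul_mem : ∀ i j, ∀ a ∈ deg i, ∀ b ∈ deg j, mul a b ∈ deg (i + j)
  mul_assoc : ∀ a b c, mul (mul a b) c = mul a (mul b c)
  leibniz : ∀ i, ∀ a ∈ deg i, ∀ b, d (mul a b) = mul (d a) b + (i.negOnePow : ℤ) • mul a (d b)

namespace DGAlgebra

variable {R : Type u} [CommRing R] {A : Type v} [AddCommGroup A] [Module R A]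

/-- The cycles. -/
def cycles (D : DGAlgebra R A) : Submodule R A := LinearMap.ker D.d

/-- The boundaries, as a submodule of the cycles. -/
def boundaries (D : DGAlgebra R A) : Submodule R D.cycles :=
  (LinearMap.range D.d).submoduleOf D.cycles

/-- The homology `H(A)`. -/
abbrev Homology (D : DGAlgebra R A) : Type v := D.cycles ⧸ D.boundaries

/-- The homology class of a cycle. -/
def cls (D : DGAlgebra R A) : D.cycles →ₗ[R] D.Homology := D.boundaries.mkQ

/-- `H_i(A)`: the classes of the cycles of degree `i`. -/
def homologyDeg (D : DGAlgebra R A) (i : ℤ) : Submodule R D.Homology :=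
  ((D.deg i).submoduleOf D.cycles).map D.cls

theorem mem_cycles (D : DGAlgebra R A) {a : A} : a ∈ D.cycles ↔ D.d a = 0 := LinearMap.mem_ker

theorem mem_boundaries (D : DGAlgebra R A) {z : D.cycles} :
    z ∈ D.boundaries ↔ ∃ y, D.d y = z := by
  simp [boundaries, Submodule.submoduleOf]

theorem cls_eq_zero (D : DGAlgebra R A) {z : D.cycles} : D.cls z = 0 ↔ ∃ y, D.d y = z := by
  rw [cls, Submodule.mkQ_apply, Submodule.Quotient.mk_eq_zero, mem_boundaries]

theorem cls_surjective (D : DGAlgebra R A) : Function.Surjective D.cls :=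
  Submodule.mkQ_surjective _

theorem parity_d (D : DGAlgebra R A) (a : A) : D.parity (D.d a) = - D.d (D.parity a) := by
  have : D.parity ∘ₗ D.d = - (D.d ∘ₗ D.parity) := by
    apply D.hom_ext
    intro i a ha
    simp [D.parity_of_mem ha, D.parity_of_mem (D.d_mem i a ha), Int.negOnePow_sub]
  simpa using LinearMap.congr_fun this a

theorem parity_mul (D : DGAlgebra R A) (a b : A) :
    D.parity (D.mul a b) = D.mul (D.parity a) (D.parity b) := by
  have : D.mul.compr₂ D.parity = D.mul.compl₁₂ D.parity D.parity := by
    apply D.hom_ext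
    intro i a ha
    apply D.hom_ext
    intro j b hb
    simp only [LinearMap.compr₂_apply, LinearMap.compl₁₂_apply, D.parity_of_mem ha,
      D.parity_of_mem hb, D.parity_of_mem (D.mul_mem i j a ha b hb), map_zsmul,
      LinearMap.smul_apply, smul_smul, Int.negOnePow_add, Units.val_mul]
    rw [mul_comm]
  simpa using LinearMap.congr_fun (LinearMap.congr_fun this a) b

theorem d_mul (D : DGAlgebra R A) (a b : A) :
    D.d (D.mul a b) = D.mul (D.d a) b + D.mul (D.parity a) (D.d b) := by
  have : D.mul.compr₂ D.d = D.mul ∘ₗ D.d + D.mul.compl₁₂ D.parity D.d := by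
    apply D.hom_ext
    intro i a ha
    ext b
    simp only [LinearMap.compr₂_apply, LinearMap.add_apply, LinearMap.comp_apply,
      LinearMap.compl₁₂_apply, D.parity_of_mem ha, map_zsmul, LinearMap.smul_apply,
      D.leibniz i a ha]
  simpa using LinearMap.congr_fun (LinearMap.congr_fun this a) b

theorem d_proj (D : DGAlgebra R A) (i : ℤ) (a : A) : D.d (D.proj i a) = D.proj (i - 1) (D.d a) := by
  have : D.d ∘ₗ D.proj i = D.proj (i - 1) ∘ₗ D.d := by
    apply D.hom_ext
    intro j a ha
    by_cases h : j = i
    · subst h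
      simp [D.proj_of_mem ha, D.proj_of_mem (D.d_mem j a ha)]
    · have h' : j - 1 ≠ i - 1 := fun e => h (by lia)
      simp [D.proj_of_mem_ne h ha, D.proj_of_mem_ne h' (D.d_mem j a ha)]
  exact LinearMap.congr_fun this a

/-- The projection of `H(A)` onto `H_i(A)`. -/
noncomputable def homologyProj (D : DGAlgebra R A) (i : ℤ) : D.Homology →ₗ[R] D.Homology :=
  Submodule.mapQ _ _ ((D.proj i).restrict (p := D.cycles) (q := D.cycles) (fun a ha => by
    rw [mem_cycles] at ha ⊢; rw [d_proj, ha, map_zero])) (by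
    intro z hz
    rw [Submodule.mem_comap, mem_boundaries]
    obtain ⟨y, hy⟩ := D.mem_boundaries.1 hz
    exact ⟨D.proj (i + 1) y, by rw [d_proj, hy]; simp⟩)

theorem homologyProj_cls (D : DGAlgebra R A) (i : ℤ) (z : D.cycles) :
    ∃ h, D.homologyProj i (D.cls z) = D.cls ⟨D.proj i z, h⟩ := by
  have h : D.proj i z ∈ D.cycles := by
    have := z.2
    rw [mem_cycles] at this ⊢; rw [d_proj, this, map_zero]
  exact ⟨h, rfl⟩

theorem homologyProj_of_mem (D : DGAlgebra R A) {i : ℤ} {a : D.Homology}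
    (ha : a ∈ D.homologyDeg i) : D.homologyProj i a = a := by
  obtain ⟨z, hz, rfl⟩ := ha
  obtain ⟨h, e⟩ := D.homologyProj_cls i z
  rw [e]
  congr 1
  exact Subtype.ext (D.proj_of_mem hz)

theorem homologyProj_of_mem_ne (D : DGAlgebra R A) {i j : ℤ} (hij : i ≠ j) {a : D.Homology}
    (ha : a ∈ D.homologyDeg i) : D.homologyProj j a = 0 := by
  obtain ⟨z, hz, rfl⟩ := ha
  obtain ⟨h, e⟩ := D.homologyProj_cls j z
  rw [e, D.cls_eq_zero]
  exact ⟨0, by rw [map_zero]; exact (D.proj_of_mem_ne hij hz).symm⟩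

theorem homology_isInternal (D : DGAlgebra R A) : DirectSum.IsInternal D.homologyDeg := by
  classical
  constructor
  · rw [injective_iff_map_eq_zero]
    intro y hy
    ext i
    have key : D.homologyProj i ∘ₗ DirectSum.coeLinearMap D.homologyDeg =
        (D.homologyDeg i).subtype ∘ₗ DirectSum.component R ℤ (fun i => D.homologyDeg i) i := by
      apply DirectSum.linearMap_ext
      intro j
      ext ⟨a, ha⟩
      by_cases h : j = i
      · subst h
        simp [D.homologyProj_of_mem ha, DirectSum.component.lof_self]
      · simp [D.homologyProj_of_mem_ne h ha, DirectSum.component.of, h]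
    have hy' : DirectSum.coeLinearMap D.homologyDeg y = 0 := hy
    have := LinearMap.congr_fun key y
    simp only [LinearMap.comp_apply, hy', map_zero] at this
    exact this.symm
  · suffices h : LinearMap.range (DirectSum.coeLinearMap D.homologyDeg) = ⊤ from
      LinearMap.range_eq_top.1 h
    rw [DirectSum.range_coeLinearMap, eq_top_iff]
    intro a _
    obtain ⟨z, rfl⟩ := D.cls_surjective a
    have hz : D.d z = 0 := D.mem_cycles.1 z.2
    have hsum : (z : A) = ∑ i ∈ DFinsupp.support (D.equiv.symm z), D.proj i z := by
      conv_lhs => rw [← D.equiv.apply_symm_apply (z : A)]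
      change DirectSum.coeLinearMap D.deg _ = _
      rw [DirectSum.coeLinearMap_eq_dfinsuppSum]
      rfl
    have hc : ∀ i, D.proj i z ∈ D.cycles := fun i => by
      rw [mem_cycles, d_proj, hz, map_zero]
    have : z = ∑ i ∈ DFinsupp.support (D.equiv.symm (z : A)), (⟨D.proj i z, hc i⟩ : D.cycles) := by
      apply Subtype.ext
      rw [AddSubmonoidClass.coe_finsetSum]
      exact hsum
    rw [this, map_sum]
    refine Submodule.sum_mem _ fun i _ => ?_
    exact Submodule.mem_iSup_of_mem i ⟨_, D.proj_mem i z, rfl⟩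

/-- The grading of `H(A)` by the `H_i(A)`. -/
def homologyGrading (D : DGAlgebra R A) : Grading R D.Homology where
  deg := D.homologyDeg
  isInternal := D.homology_isInternal

theorem mul_cycles (D : DGAlgebra R A) (z w : D.cycles) : D.mul z w ∈ D.cycles := by
  have hz := D.mem_cycles.1 z.2
  have hw := D.mem_cycles.1 w.2
  simp [mem_cycles, d_mul, hz, hw]

/-- The class of the product of two cycles. -/
def mulCls (D : DGAlgebra R A) : D.cycles →ₗ[R] D.cycles →ₗ[R] D.Homology :=
  LinearMap.mk₂ R (fun z w => D.cls ⟨D.mul z w, D.mul_cycles z w⟩)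
    (fun _ _ _ => by rw [← map_add]; congr 1; ext; simp)
    (fun _ _ _ => by rw [← map_smul]; congr 1; ext; simp)
    (fun _ _ _ => by rw [← map_add]; congr 1; ext; simp)
    (fun _ _ _ => by rw [← map_smul]; congr 1; ext; simp)

/-- The product on `H(A)`: the product of the classes of `z` and `w` is the class of `z w`. -/
def homologyMul (D : DGAlgebra R A) : D.Homology →ₗ[R] D.Homology →ₗ[R] D.Homology :=
  Submodule.liftQ D.boundaries
    (LinearMap.flip (Submodule.liftQ D.boundaries D.mulCls.flip (by
      intro w hw
      obtain ⟨y, hy⟩ := D.mem_boundaries.1 hw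
      rw [LinearMap.mem_ker]
      ext z
      have hz := D.mem_cycles.1 z.2
      refine D.cls_eq_zero.2 ⟨D.mul (D.parity z) y, ?_⟩
      have h0 : D.d (D.parity z) = 0 := by
        have := D.parity_d z
        rw [hz, map_zero] at this
        simpa using this.symm
      simp [d_mul, hy, h0, D.parity_parity]))) (by
      intro z hz
      obtain ⟨y, hy⟩ := D.mem_boundaries.1 hz
      rw [LinearMap.mem_ker]
      ext w
      have hw := D.mem_cycles.1 w.2
      refine D.cls_eq_zero.2 ⟨D.mul y w, ?_⟩
      simp [d_mul, hy, hw])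

theorem homologyMul_cls (D : DGAlgebra R A) (z w : D.cycles) :
    D.homologyMul (D.cls z) (D.cls w) = D.cls ⟨D.mul z w, D.mul_cycles z w⟩ := rfl

end DGAlgebra

/-- A map of differential graded algebras. -/
structure DGHom {R : Type u} [CommRing R] {A : Type v} [AddCommGroup A] [Module R A]
    {A' : Type w} [AddCommGroup A'] [Module R A'] (D : DGAlgebra R A) (D' : DGAlgebra R A') where
  toLinearMap : A →ₗ[R] A'
  map_mem : ∀ i, ∀ a ∈ D.deg i, toLinearMap a ∈ D'.deg i
  map_d : ∀ a, toLinearMap (D.d a) = D'.d (toLinearMap a)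
  map_mul : ∀ a b, toLinearMap (D.mul a b) = D'.mul (toLinearMap a) (toLinearMap b)

/-- The map induced in homology by a map of differential graded algebras. -/
def DGHom.homologyMap {R : Type u} [CommRing R] {A : Type v} [AddCommGroup A] [Module R A]
    {A' : Type w} [AddCommGroup A'] [Module R A'] {D : DGAlgebra R A} {D' : DGAlgebra R A'}
    (g : DGHom D D') : D.Homology →ₗ[R] D'.Homology :=
  Submodule.mapQ _ _ (g.toLinearMap.restrict (p := D.cycles) (q := D'.cycles) (fun a ha => by
    rw [DGAlgebra.mem_cycles] at ha ⊢; rw [← g.map_d, ha, map_zero])) (by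
    intro z hz
    rw [Submodule.mem_comap, DGAlgebra.mem_boundaries]
    obtain ⟨y, hy⟩ := D.mem_boundaries.1 hz
    exact ⟨g.toLinearMap y, by rw [← g.map_d, hy]; rfl⟩)

/-! ### Collections of multilinear maps -/

/-- A collection `{f_n : M ⊗ ⋯ ⊗ M → N}` of multilinear maps, one for each number `n` of arguments.
The value of `f_n` at `a_1 ⊗ ⋯ ⊗ a_n` is written `f [a_1, …, a_n]`. -/
structure Ops (R : Type u) [CommRing R] (M : Type v) [AddCommGroup M] [Module R M]
    (N : Type w) [AddCommGroup N] [Module R N] where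
  toFun : List M → N
  linear : ∀ l r : List M, IsLinearMap R fun a => toFun (l ++ a :: r)

namespace Ops

variable {R : Type u} [CommRing R] {M : Type v} [AddCommGroup M] [Module R M]
  {N : Type w} [AddCommGroup N] [Module R N] {V : Type x} [AddCommGroup V] [Module R V]

instance : CoeFun (Ops R M N) (fun _ => List M → N) := ⟨Ops.toFun⟩

@[ext]
theorem ext {f g : Ops R M N} (h : ∀ a, f a = g a) : f = g := by
  cases f; cases g; congr 1; exact funext h

theorem isLinearMap_sum {ι : Type*} (s : Finset ι) (F : ι → M → N)
    (h : ∀ i ∈ s, IsLinearMap R (F i)) : IsLinearMap R (fun a => ∑ i ∈ s, F i a) where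
  map_add a b := by
    rw [← Finset.sum_add_distrib]
    exact Finset.sum_congr rfl fun i hi => (h i hi).map_add a b
  map_smul c a := by
    rw [Finset.smul_sum]
    exact Finset.sum_congr rfl fun i hi => (h i hi).map_smul c a

theorem linear_comp (φ : Ops R N V) (l r : List N) {g : M → N} (hg : IsLinearMap R g) :
    IsLinearMap R (fun a => φ (l ++ g a :: r)) where
  map_add a b := by rw [hg.map_add, (φ.linear l r).map_add]
  map_smul c a := by rw [hg.map_smul, (φ.linear l r).map_smul]

/-- The collection with the only component `f_1`. -/
def ofLinear (f : M →ₗ[R] N) : Ops R M N where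
  toFun
    | [a] => f a
    | _ => 0
  linear l r := by
    rcases l with _ | ⟨b, _ | ⟨c, l⟩⟩ <;> rcases r with _ | ⟨e, r⟩
    · exact f.isLinear
    all_goals exact (0 : M →ₗ[R] N).isLinear

/-- `(a_1, …, a_n) ↦ ((-1) ^ ((n-1)|a_1|) a_1, (-1) ^ ((n-2)|a_2|) a_2, …, a_n)`: the Koszul sign
that appears when `n` suspension operators are moved to their arguments. -/
noncomputable def twist (G : Grading R M) : List M → List M
  | [] => []
  | a :: l => (G.parity ^ l.length) a :: twist G l

theorem length_twist (G : Grading R M) (a : List M) : (twist G a).length = a.length := by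
  induction a with
  | nil => rfl
  | cons a l ih => simp [twist, ih]

theorem twist_twist (G : Grading R M) (a : List M) : twist G (twist G a) = a := by
  induction a with
  | nil => rfl
  | cons a l ih =>
    have h : ∀ n : ℕ, (G.parity ^ n) ((G.parity ^ n) a) = a := by
      intro n
      have h2 : G.parity * G.parity = 1 := LinearMap.ext G.parity_parity
      rw [← Module.End.mul_apply, ← (Commute.refl G.parity).mul_pow, h2, one_pow]
      rfl
    simp [twist, ih, length_twist, h]

/-- A collection `{f_n}` on `M`, read on the suspension `sM`: up to suspensions,
`f^s_n = f_n ∘ (s^{-1} ⊗ ⋯ ⊗ s^{-1})`, that is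
`f^s [a_1, …, a_n] = (-1) ^ ((n-1)|a_1| + (n-2)|a_2| + ⋯ + |a_{n-1}|) f [a_1, …, a_n]`. -/
noncomputable def susp (G : Grading R M) (f : Ops R M N) : Ops R M N where
  toFun a := f (twist G a)
  linear l r := by
    suffices h : ∀ p : List M, IsLinearMap R (fun a => f (p ++ twist G (l ++ a :: r))) from h []
    induction l with
    | nil =>
      intro p
      exact f.linear_comp p (twist G r) (G.parity ^ r.length).isLinear
    | cons b l ih =>
      intro p
      have := ih (p ++ [(G.parity ^ (l.length + (r.length + 1))) b])
      simpa [twist] using this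

theorem susp_susp (G : Grading R M) (f : Ops R M N) : (f.susp G).susp G = f := by
  ext a
  exact congrArg f.toFun (twist_twist G a)

/-- The letters before an inserted operation of odd degree on the suspension acquire the sign
`(-1) ^ |s a| = (-1) ^ (|a| + 1)`. -/
noncomputable def sgn (G : Grading R M) (a : List M) : List M := a.map (fun b => -G.parity b)

/-- For `b` of degree `-1` on the suspension of `M`:
`[a_1, …, a_n] ↦ ∑_{k, j} ± φ [a_1, …, a_k, b [a_{k+1}, …, a_{k+j}], a_{k+j+1}, …, a_n]`, with
`0 ≤ k < n`, `1 ≤ j ≤ n - k` and the sign `(-1) ^ (|s a_1| + ⋯ + |s a_k|)`. -/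
noncomputable def insert (G : Grading R M) (φ : Ops R M V) (b : Ops R M M) : Ops R M V where
  toFun a := ∑ k ∈ Finset.range a.length, ∑ j ∈ Finset.Icc 1 (a.length - k),
    φ (sgn G (a.take k) ++ b ((a.drop k).take j) :: a.drop (k + j))
  linear l r := by
    simp only [List.length_append, List.length_cons]
    refine isLinearMap_sum _ _ fun k hk => isLinearMap_sum _ _ fun j hj => ?_
    rw [Finset.mem_range] at hk
    rw [Finset.mem_Icc] at hj
    rcases lt_or_ge l.length k with h1 | h1
    · obtain ⟨k', rfl⟩ : ∃ k', k = l.length + 1 + k' := ⟨k - (l.length + 1), by lia⟩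
      have e1 : ∀ a, (l ++ a :: r).take (l.length + 1 + k') = l ++ a :: r.take k' := fun a => by
        rw [List.take_append, List.take_of_length_le (by lia),
          show l.length + 1 + k' - l.length = k' + 1 by lia, List.take_succ_cons]
      have e2 : ∀ m a, (l ++ a :: r).drop (l.length + 1 + m) = r.drop m := fun m a => by
        rw [List.drop_append, List.drop_of_length_le (by lia),
          show l.length + 1 + m - l.length = m + 1 by lia, List.drop_succ_cons, List.nil_append]
      have e3 : ∀ a, (l ++ a :: r).drop (l.length + 1 + k' + j) = r.drop (k' + j) := fun a => by
        rw [show l.length + 1 + k' + j = l.length + 1 + (k' + j) by lia, e2]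
      simp only [e1, e2, e3, sgn, List.map_append, List.map_cons, List.append_assoc,
        List.cons_append]
      exact φ.linear_comp _ _ (-G.parity).isLinear
    · have e1 : ∀ a, (l ++ a :: r).take k = l.take k := fun a => by
        rw [List.take_append, show k - l.length = 0 by lia]; simp
      have e2 : ∀ a, (l ++ a :: r).drop k = l.drop k ++ a :: r := fun a => by
        rw [List.drop_append, show k - l.length = 0 by lia]; simp
      rcases lt_or_ge l.length (k + j) with h2 | h2
      · obtain ⟨j', hj'⟩ : ∃ j', k + j = l.length + 1 + j' := ⟨k + j - (l.length + 1), by lia⟩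
        have e3 : ∀ a, (l.drop k ++ a :: r).take j = l.drop k ++ a :: r.take j' := fun a => by
          rw [List.take_append, List.take_of_length_le (by rw [List.length_drop]; lia),
            List.length_drop, show j - (l.length - k) = j' + 1 by lia, List.take_succ_cons]
        have e4 : ∀ a, (l ++ a :: r).drop (k + j) = r.drop j' := fun a => by
          rw [hj', List.drop_append, List.drop_of_length_le (by lia),
            show l.length + 1 + j' - l.length = j' + 1 by lia, List.drop_succ_cons, List.nil_append]
        simp only [e1, e2, e3, e4]
        exact φ.linear_comp _ _ (b.linear _ _)
      · have e3 : ∀ a, (l.drop k ++ a :: r).take j = (l.drop k).take j := fun a => by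
          rw [List.take_append, List.length_drop, show j - (l.length - k) = 0 by lia]; simp
        have e4 : ∀ a, (l ++ a :: r).drop (k + j) = l.drop (k + j) ++ a :: r := fun a => by
          rw [List.drop_append, show k + j - l.length = 0 by lia]; simp
        simp only [e1, e2, e3, e4]
        have := φ.linear (sgn G (l.take k) ++ b ((l.drop k).take j) :: l.drop (k + j)) r
        simpa using this

theorem linear_splitAux (φ : Ops R N V) (F : Ops R M N) (ns : List ℕ) (l r : List M) (p : List N)
    (h : ns.sum = l.length + 1 + r.length) :
    IsLinearMap R (fun a => φ (p ++ ((l ++ a :: r).splitWrtCompositionAux ns).map F)) := by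
  induction ns generalizing l p with
  | nil => simp at h; lia
  | cons n ns ih =>
    rw [List.sum_cons] at h
    rcases lt_or_ge l.length n with h1 | h1
    · obtain ⟨n', rfl⟩ : ∃ n', n = l.length + 1 + n' := ⟨n - (l.length + 1), by lia⟩
      have e1 : ∀ a, (l ++ a :: r).take (l.length + 1 + n') = l ++ a :: r.take n' := fun a => by
        rw [List.take_append, List.take_of_length_le (by lia),
          show l.length + 1 + n' - l.length = n' + 1 by lia, List.take_succ_cons]
      have e2 : ∀ a, (l ++ a :: r).drop (l.length + 1 + n') = r.drop n' := fun a => by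
        rw [List.drop_append, List.drop_of_length_le (by lia),
          show l.length + 1 + n' - l.length = n' + 1 by lia, List.drop_succ_cons, List.nil_append]
      simp only [List.splitWrtCompositionAux_cons, e1, e2, List.map_cons]
      exact φ.linear_comp _ _ (F.linear _ _)
    · have e1 : ∀ a, (l ++ a :: r).take n = l.take n := fun a => by
        rw [List.take_append, show n - l.length = 0 by lia]; simp
      have e2 : ∀ a, (l ++ a :: r).drop n = l.drop n ++ a :: r := fun a => by
        rw [List.drop_append, show n - l.length = 0 by lia]; simp
      have := ih (l.drop n) (p ++ [F (l.take n)]) (by rw [List.length_drop]; lia)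
      simpa only [List.splitWrtCompositionAux_cons, e1, e2, List.map_cons, List.append_assoc,
        List.cons_append, List.nil_append] using this

/-- `[a_1, …, a_n] ↦ ∑ φ [F [a_1, …, a_{k_1}], …, F [a_{n-k_t+1}, …, a_n]]`, the sum over all
compositions `k_1 + ⋯ + k_t = n` with all `k_i ≥ 1`. -/
def substitute (φ : Ops R N V) (F : Ops R M N) : Ops R M V where
  toFun a := ∑ c : Composition a.length, φ ((a.splitWrtComposition c).map F)
  linear l r := by
    have key : ∀ (n : ℕ) (a : List M), a.length = n →
        ∑ c : Composition a.length, φ ((a.splitWrtComposition c).map F) =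
        ∑ c : Composition n, φ ((a.splitWrtCompositionAux c.blocks).map F) := by
      rintro n a rfl; rfl
    have e : (fun a => ∑ c : Composition (l ++ a :: r).length,
        φ (((l ++ a :: r).splitWrtComposition c).map F)) = fun a =>
        ∑ c : Composition (l.length + 1 + r.length),
          φ (((l ++ a :: r).splitWrtCompositionAux c.blocks).map F) := by
      funext a
      exact key _ _ (by simp; lia)
    rw [e]
    exact isLinearMap_sum _ _ fun c _ => linear_splitAux φ F c.blocks l r [] c.blocks_sum

/-- `∑ ± φ [F(…), …, F(…), h(…), g(…), …, g(…)]`, the sum over all decompositions of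
`[a_1, …, a_n]` into consecutive nonempty blocks and all choices of the block at which the
operation `h` is applied; `h` has degree `1` and `F` has degree `0` on the suspension, so that the
sign is `(-1) ^ (∑ |s a_i|)` over the letters in the blocks before this one. -/
noncomputable def mixed (G : Grading R M) (φ : Ops R N V) (F h g : Ops R M N) (a : List M) : V :=
  ∑ c : Composition a.length, ∑ i ∈ Finset.range c.length,
    φ ((((a.splitWrtComposition c).take i).map fun l => F (sgn G l)) ++
      h ((a.splitWrtComposition c).getD i []) ::
        (((a.splitWrtComposition c).drop (i + 1)).map fun l => g l))

theorem ofFn_update {n : ℕ} [DecidableEq (Fin n)] (a : Fin n → M) (i : Fin n) (z : M) :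
    List.ofFn (Function.update a i z) =
      (List.ofFn a).take i ++ z :: (List.ofFn a).drop (i + 1) := by
  have h : List.ofFn (Function.update a i z) = (List.ofFn a).set i z := by
    apply List.ext_getElem
    · simp
    · intro k h1 h2
      simp only [List.getElem_ofFn, List.getElem_set, Function.update_apply, Fin.ext_iff]
      split_ifs <;> first | rfl | lia
  rw [h, List.set_eq_take_append_cons_drop, if_pos (by simp)]

/-- The component with `n` arguments, as a multilinear map. -/
def toMultilinear (f : Ops R M N) (n : ℕ) : MultilinearMap R (fun _ : Fin n => M) N where
  toFun a := f (List.ofFn a)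
  map_update_add' {dec} a i x y := by
    simp only [ofFn_update]
    exact (f.linear _ _).map_add x y
  map_update_smul' {dec} a i c x := by
    simp only [ofFn_update]
    exact (f.linear _ _).map_smul c x

/-- The linear map on the tensor algebra `⨁ n, M ⊗ ⋯ ⊗ M` with the given components. -/
noncomputable def toLinear (f : Ops R M N) : TensorAlgebra R M →ₗ[R] N :=
  DirectSum.toModule R ℕ N (fun n => PiTensorProduct.lift (f.toMultilinear n)) ∘ₗ
    (TensorAlgebra.equivDirectSum (R := R) (M := M)).toLinearMap

/-- The collection of the canonical maps `[a_1, …, a_n] ↦ a_1 ⊗ ⋯ ⊗ a_n`. -/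
def word (R : Type u) [CommRing R] (M : Type v) [AddCommGroup M] [Module R M] :
    Ops R M (TensorAlgebra R M) where
  toFun a := (a.map (TensorAlgebra.ι R)).prod
  linear l r := by
    constructor
    · intro a b; simp [mul_add, add_mul]
    · intro c a; simp

theorem toLinear_word (f : Ops R M N) (a : List M) : f.toLinear (word R M a) = f a := by
  have h : word R M a = TensorAlgebra.tprod R M a.length a.get := by
    rw [TensorAlgebra.tprod_apply]
    change (a.map (TensorAlgebra.ι R)).prod = _
    rw [List.ofFn_comp' a.get (TensorAlgebra.ι R), List.ofFn_get]
  have h2 : List.ofFn a.get = a := List.ofFn_get a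
  rw [h, toLinear, LinearMap.comp_apply]
  change DirectSum.toModule R ℕ N _ (TensorAlgebra.toDirectSum _) = _
  rw [TensorAlgebra.toDirectSum_tensorPower_tprod, ← DirectSum.lof_eq_of R,
    DirectSum.toModule_lof, PiTensorProduct.lift.tprod]
  exact congrArg f.toFun h2

/-- The component `f_1`, as a linear map. -/
def first (f : Ops R M N) : M →ₗ[R] N := (f.linear [] []).mk' _

end Ops

/-! ### `A_∞`-algebras

Gradings are written with lower indices, so that operations of degree `2 - n`, `1 - n`, `-n` with
respect to upper indices `M^k = M_{-k}` are here of degree `n - 2`, `n - 1`, `n`. -/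

section AInfinity

variable {R : Type u} [CommRing R] {M : Type v} [AddCommGroup M] [Module R M]
  {M' : Type w} [AddCommGroup M'] [Module R M'] {M'' : Type x} [AddCommGroup M''] [Module R M'']

/-- The collection `{f_n}` raises the degree by `n + s`: if `|a_i| = e_i` then
`|f [a_1, …, a_n]| = e_1 + ⋯ + e_n + n + s`. -/
def Ops.HasDegree (G : Grading R M) (G' : Grading R M') (f : Ops R M M') (s : ℤ) : Prop :=
  ∀ (a : List M) (e : List ℤ), List.Forall₂ (fun x i => x ∈ G.deg i) a e →
    f a ∈ G'.deg (e.sum + a.length + s)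

/-- `(M, {m_n})` is an `A_∞`-algebra: `m_n` has degree `n - 2` and
`∑_{k, j} ± m_{n-j+1} (a_1 ⊗ ⋯ ⊗ a_k ⊗ m_j (a_{k+1} ⊗ ⋯ ⊗ a_{k+j}) ⊗ ⋯ ⊗ a_n) = 0`.
There is no operation without arguments. -/
structure IsAInfAlgebra (G : Grading R M) (m : Ops R M M) : Prop where
  nil : m [] = 0
  degree : m.HasDegree G G (-2)
  stasheff : ∀ a, (m.susp G).insert G (m.susp G) a = 0

/-- `{f_n} : (M, {m_n}) → (M', {m'_n})` is a morphism of `A_∞`-algebras: `f_n` has degree `n - 1` and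
`∑_{k, j} ± f_{n-j+1} (a_1 ⊗ ⋯ ⊗ a_k ⊗ m_j (a_{k+1} ⊗ ⋯ ⊗ a_{k+j}) ⊗ ⋯ ⊗ a_n) =
∑_{k_1 + ⋯ + k_t = n} ± m'_t (f_{k_1} (a_1 ⊗ ⋯ ⊗ a_{k_1}) ⊗ ⋯ ⊗ f_{k_t} (a_{n-k_t+1} ⊗ ⋯ ⊗ a_n))`. -/
structure IsAInfHom (G : Grading R M) (m : Ops R M M) (G' : Grading R M') (m' : Ops R M' M')
    (f : Ops R M M') : Prop where
  nil : f [] = 0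
  degree : f.HasDegree G G' (-1)
  rel : ∀ a, (f.susp G).insert G (m.susp G) a = (m'.susp G').substitute (f.susp G) a

/-- The composition `{g_n} ∘ {f_n}`, with components
`∑_{k_1 + ⋯ + k_t = n} ± g_t (f_{k_1} (a_1 ⊗ ⋯ ⊗ a_{k_1}) ⊗ ⋯ ⊗ f_{k_t} (a_{n-k_t+1} ⊗ ⋯ ⊗ a_n))`;
passing to the suspension twice gives back the original collection. -/
noncomputable def Ops.comp (G : Grading R M) (G' : Grading R M') (g : Ops R M' M'')
    (f : Ops R M M') : Ops R M M'' :=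
  ((g.susp G').substitute (f.susp G)).susp G

/-- `{f_n}` is an isomorphism of `A_∞`-algebras: an invertible morphism. -/
def IsAInfIso (G : Grading R M) (m : Ops R M M) (G' : Grading R M') (m' : Ops R M' M')
    (f : Ops R M M') : Prop :=
  IsAInfHom G m G' m' f ∧ ∃ g : Ops R M' M, IsAInfHom G' m' G m g ∧
    Ops.comp G G' g f = Ops.ofLinear LinearMap.id ∧ Ops.comp G' G f g = Ops.ofLinear LinearMap.id

/-- Two morphisms of `A_∞`-algebras are homotopic: there are `h_n` of degree `n` such that
`f_n (a_1 ⊗ ⋯ ⊗ a_n) - g_n (a_1 ⊗ ⋯ ⊗ a_n) =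
∑ ± h_{n-j+1} (a_1 ⊗ ⋯ ⊗ a_k ⊗ m_j (a_{k+1} ⊗ ⋯ ⊗ a_{k+j}) ⊗ ⋯ ⊗ a_n) +
∑ ± m'_t (f_{k_1} (…) ⊗ ⋯ ⊗ f_{k_{i-1}} (…) ⊗ h_{k_i} (…) ⊗ g_{k_{i+1}} (…) ⊗ ⋯ ⊗ g_{k_t} (…))`. -/
def AInfHomotopic (G : Grading R M) (m : Ops R M M) (G' : Grading R M') (m' : Ops R M' M')
    (f g : Ops R M M') : Prop :=
  ∃ h : Ops R M M', h [] = 0 ∧ h.HasDegree G G' 0 ∧ ∀ a,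
    f.susp G a - g.susp G a = (h.susp G).insert G (m.susp G) a +
      Ops.mixed G (m'.susp G') (f.susp G) (h.susp G) (g.susp G) a

/-! ### Weak equivalences -/

/-- `F : (M, d) → (M', d')` is a chain map and induces an isomorphism
`ker d / im d → ker d' / im d'`. -/
structure IsHomologyIso (d : M →ₗ[R] M) (d' : M' →ₗ[R] M') (F : M →ₗ[R] M') : Prop where
  comm : ∀ y, F (d y) = d' (F y)
  injective : ∀ y, d y = 0 → (∃ z', F y = d' z') → ∃ z, y = d z
  surjective : ∀ y', d' y' = 0 → ∃ y z', d y = 0 ∧ y' = F y + d' z'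

/-- The differential of the bar construction: the coderivation of the tensor coalgebra of the
suspension of `M` with components `{m_n}`. -/
noncomputable def barD (G : Grading R M) (m : Ops R M M) :
    TensorAlgebra R M →ₗ[R] TensorAlgebra R M :=
  ((Ops.word R M).insert G (m.susp G)).toLinear

/-- The map of bar constructions induced by a morphism of `A_∞`-algebras: the coalgebra map with
components `{f_n}`. -/
noncomputable def barMap (G : Grading R M) (f : Ops R M M') :
    TensorAlgebra R M →ₗ[R] TensorAlgebra R M' :=
  ((Ops.word R M').substitute (f.susp G)).toLinear

/-- `f_1 : (M, m_1) → (M', m'_1)` is a homology isomorphism. -/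
def IsQuasiIso (m : Ops R M M) (m' : Ops R M' M') (f : Ops R M M') : Prop :=
  IsHomologyIso m.first m'.first f.first

/-- The map of bar constructions induced by `{f_n}` is a homology isomorphism. -/
def IsBarQuasiIso (G : Grading R M) (m : Ops R M M) (G' : Grading R M') (m' : Ops R M' M')
    (f : Ops R M M') : Prop :=
  IsHomologyIso (barD G m) (barD G' m') (barMap G f)

end AInfinity

/-! ### The homology of a differential graded algebra -/

namespace DGAlgebra

variable {R : Type u} [CommRing R] {A : Type v} [AddCommGroup A] [Module R A]

/-- `A` as an `A_∞`-algebra: `m_1 = d`, `m_2` is the product and `m_n = 0` for `n ≥ 3`. -/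
def ops (D : DGAlgebra R A) : Ops R A A where
  toFun
    | [a] => D.d a
    | [a, b] => D.mul a b
    | _ => 0
  linear l r := by
    rcases l with _ | ⟨b, _ | ⟨c, _ | ⟨c', l⟩⟩⟩ <;> rcases r with _ | ⟨e, _ | ⟨f, r⟩⟩
    · exact D.d.isLinear
    · exact (D.mul.flip e).isLinear
    · exact (0 : A →ₗ[R] A).isLinear
    · exact (D.mul b).isLinear
    all_goals exact (0 : A →ₗ[R] A).isLinear

theorem ops_eq_zero (D : DGAlgebra R A) {a : List A} (h : 3 ≤ a.length) : D.ops a = 0 := by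
  rcases a with _ | ⟨b, _ | ⟨c, _ | ⟨e, a⟩⟩⟩
  · simp at h
  · simp at h
  · simp at h
  · rfl

theorem isAInfAlgebra_ops (D : DGAlgebra R A) : IsAInfAlgebra D.toGrading D.ops where
  nil := rfl
  degree a e h := by
    rcases h with _ | ⟨h1, _ | ⟨h2, _ | ⟨h3, h⟩⟩⟩
    · exact zero_mem _
    · have := D.d_mem _ _ h1
      simpa [ops, add_assoc, sub_eq_add_neg] using this
    · have := D.mul_mem _ _ _ h1 _ h2
      simpa [ops, add_assoc] using this
    · exact zero_mem _
  stasheff a := by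
    rcases a with _ | ⟨a, _ | ⟨b, _ | ⟨c, _ | ⟨e, r⟩⟩⟩⟩
    · rfl
    · simp [Ops.insert, Ops.susp, Ops.twist, Ops.sgn, ops, D.d_d]
    · have h0 := D.d_mul (D.parity a) b
      have h1 := D.parity_d a
      rw [D.parity_parity] at h0
      simp [Ops.insert, Ops.susp, Ops.twist, Ops.sgn, ops, Finset.sum_range_succ,
        show Finset.Icc 1 2 = {1, 2} from rfl, h0, h1, D.parity_parity]
    · simp [Ops.insert, Ops.susp, Ops.twist, Ops.sgn, ops, Finset.sum_range_succ,
        show Finset.Icc 1 2 = {1, 2} from rfl, show Finset.Icc 1 3 = {1, 2, 3} from rfl,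
        D.parity_parity, D.parity_mul, D.mul_assoc]
    · obtain ⟨l, hl⟩ : ∃ l, l = a :: b :: c :: e :: r := ⟨_, rfl⟩
      have hlen : 4 ≤ l.length := by simp [hl]
      rw [← hl]
      change ∑ k ∈ Finset.range l.length, ∑ j ∈ Finset.Icc 1 (l.length - k),
        (D.ops.susp D.toGrading) (Ops.sgn D.toGrading (l.take k) ++
          (D.ops.susp D.toGrading) ((l.drop k).take j) :: l.drop (k + j)) = 0
      refine Finset.sum_eq_zero fun k hk => Finset.sum_eq_zero fun j hj => ?_
      rw [Finset.mem_range] at hk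
      rw [Finset.mem_Icc] at hj
      rcases le_or_gt 3 j with h3 | h3
      · have : (D.ops.susp D.toGrading) ((l.drop k).take j) = 0 :=
          D.ops_eq_zero (by rw [Ops.length_twist, List.length_take, List.length_drop]; lia)
        rw [this]
        exact ((D.ops.susp D.toGrading).linear _ _).map_zero
      · exact D.ops_eq_zero (by
          rw [Ops.length_twist, List.length_append, List.length_cons, Ops.sgn, List.length_map,
            List.length_take, List.length_drop]; lia)

/-- `{m_n}` is a minimal `A_∞`-algebra structure on `H(A)` with `m_1 = 0` and `m_2` the product of
`H(A)`, and `{f_n}` is a morphism of `A_∞`-algebras `(H(A), {m_n}) → A` such that `f_1` is a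
homology isomorphism which induces the identity of `H(A)`: `f_1 x` is a cycle in the class `x`. -/
structure IsHomologyStructure (D : DGAlgebra R A) (m : Ops R D.Homology D.Homology)
    (f : Ops R D.Homology A) : Prop where
  isAInfAlgebra : IsAInfAlgebra D.homologyGrading m
  minimal : ∀ x, m [x] = 0
  product : ∀ x y, m [x, y] = D.homologyMul x y
  isAInfHom : IsAInfHom D.homologyGrading m D.toGrading D.ops f
  isQuasiIso : IsQuasiIso m D.ops f
  induces_id : ∀ x, ∃ h : f [x] ∈ D.cycles, D.cls ⟨f [x], h⟩ = x

/-- The submodule of cycles is pure in `A`: its inclusion remains injective after tensoring with an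
arbitrary module. -/
def HasPureCycles (D : DGAlgebra R A) : Prop :=
  ∀ (N : Type (max u v)) [AddCommGroup N] [Module R N],
    Function.Injective (LinearMap.lTensor N D.cycles.subtype)

end DGAlgebra

end AInf

namespace AInf

universe u v w x

/-! ### Sums over the splittings of a list -/

section SplitSum

variable {M : Type*} {M' : Type*} {N : Type*} {V : Type*}

/-! On the suspension, a collection of operations `β` is the same as a coderivation `D_β` of the
coalgebra of words, and a morphism to a dg algebra is a twisting function: `φ ∘ D_β = d φ + φ ∪ φ`,
with `∪` the convolution product (`sub_ops`). All of (a) to (c) is obstruction theory on the number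
of letters for such equations.

Existence. Freeness of the homology gives a linear choice `ι` of cycles. Put `β = 0`, `φ = ι` on one
letter and let `Q = φ ∘ D_β - d φ - φ ∪ φ`. A Bianchi identity (`d_twistDefect`) shows that if `Q`
vanishes on shorter words, then `d (Q a) = ι (E a)`, where `E` is the Stasheff expression of `β`. A
cycle `ι x` bounds only for `x = 0`, so `E a = 0`: the relations of `β` come for free and `Q a` is a
cycle. Adding `u` to `β` and `v` to `φ` on words of this length adds `ι u - d v` to `Q`, and
freeness lets one choose `u` and `v` multilinearly so that `Q` is cancelled
(`exists_class_and_primitive`). The limit of the stages is `exists_twisting`.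

Functoriality. For `X = g ∘ f`, a twisting function with values in `A'`, one looks for `γ` and a
homotopy `η` from `φ' ∘ γ` to `X`. By `d_homotopyDefect` and `twistDefect_sub`, the differential of
the homotopy defect is, up to sign, `ι'` of the failure of `γ` to be a morphism. So that failure
again vanishes by itself, and the remaining cycle is cancelled by changing `γ` and `η`
(`exists_factorization`). Only the homology of the source has to be free. Part (c) is the case of
the identity map, together with the invertibility of morphisms with identity linear part
(`IsAInfHom.isAInfIso`).

Bar construction. Filter by word length. Modulo shorter words the differential of `B(H(A))` is zero,
that of `B(A)` is the differential of the tensor powers of `A`, and `B(f)` is the tensor power of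
`f_1`. Purity of the cycles gives a Künneth theorem for these (`IsFormalModel.tensor`), and
`isHomologyIso_of_filtration` passes from the graded pieces to the whole. -/

/-- The sum of `Ψ p s` over all `p ++ s = a`. -/
def splitSum [AddCommMonoid N] : (List M → List M → N) → List M → N
  | Ψ, [] => Ψ [] []
  | Ψ, x :: l => Ψ [] (x :: l) + splitSum (fun p s => Ψ (x :: p) s) l

section Monoid

variable [AddCommMonoid N] [AddCommMonoid V]

theorem splitSum_nil (Ψ : List M → List M → N) : splitSum Ψ [] = Ψ [] [] := rfl

theorem splitSum_cons (Ψ : List M → List M → N) (x : M) (l : List M) :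
    splitSum Ψ (x :: l) = Ψ [] (x :: l) + splitSum (fun p s => Ψ (x :: p) s) l := rfl

theorem splitSum_congr {Ψ Ψ' : List M → List M → N} {l : List M}
    (h : ∀ p s, p ++ s = l → Ψ p s = Ψ' p s) : splitSum Ψ l = splitSum Ψ' l := by
  induction l generalizing Ψ Ψ' with
  | nil => exact h [] [] rfl
  | cons x l ih =>
    rw [splitSum_cons, splitSum_cons, h [] _ rfl,
      ih fun p s e => h (x :: p) s (by rw [List.cons_append, e])]

theorem splitSum_add (Ψ Ψ' : List M → List M → N) (l : List M) :
    splitSum (fun p s => Ψ p s + Ψ' p s) l = splitSum Ψ l + splitSum Ψ' l := by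
  induction l generalizing Ψ Ψ' with
  | nil => rfl
  | cons x l ih => rw [splitSum_cons, splitSum_cons, splitSum_cons, ih]; abel

theorem splitSum_zero (l : List M) : splitSum (fun _ _ => (0 : N)) l = 0 := by
  induction l with
  | nil => rfl
  | cons x l ih => rw [splitSum_cons, ih, add_zero]

theorem splitSum_eq_zero {Ψ : List M → List M → N} {l : List M}
    (h : ∀ p s, p ++ s = l → Ψ p s = 0) : splitSum Ψ l = 0 := by
  rw [splitSum_congr h, splitSum_zero]

theorem map_splitSum {F : Type*} [FunLike F N V] [AddMonoidHomClass F N V] (f : F)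
    (Ψ : List M → List M → N) (l : List M) :
    f (splitSum Ψ l) = splitSum (fun p s => f (Ψ p s)) l := by
  induction l generalizing Ψ with
  | nil => rfl
  | cons x l ih => rw [splitSum_cons, splitSum_cons, map_add, ih]

theorem splitSum_map (f : M → M') (Ψ : List M' → List M' → N) (l : List M) :
    splitSum Ψ (l.map f) = splitSum (fun p s => Ψ (p.map f) (s.map f)) l := by
  induction l generalizing Ψ with
  | nil => rfl
  | cons x l ih => simp only [List.map_cons, splitSum_cons, ih, List.map_nil]

/-- Coassociativity of deconcatenation: both sides run over the splittings of `l` into three pieces.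
-/
theorem splitSum_assoc (Ψ : List M → List M → List M → N) (l : List M) :
    splitSum (fun p s => splitSum (fun q r => Ψ q r s) p) l =
      splitSum (fun q t => splitSum (fun r s => Ψ q r s) t) l := by
  induction l generalizing Ψ with
  | nil => rfl
  | cons x l ih =>
    simp only [splitSum_cons, splitSum_nil, splitSum_add]
    rw [ih fun q r s => Ψ (x :: q) r s]
    abel

theorem splitSum_eq_last {Ψ : List M → List M → N} {l : List M}
    (h : ∀ p s, p ++ s = l → s ≠ [] → Ψ p s = 0) : splitSum Ψ l = Ψ l [] := by
  induction l generalizing Ψ with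
  | nil => rfl
  | cons x l ih =>
    rw [splitSum_cons, h [] _ rfl (by simp), zero_add,
      ih fun p s e hs => h (x :: p) s (by rw [List.cons_append, e]) hs]

theorem splitSum_eq_first {Ψ : List M → List M → N} {l : List M}
    (h : ∀ p s, p ++ s = l → p ≠ [] → Ψ p s = 0) : splitSum Ψ l = Ψ [] l := by
  cases l with
  | nil => rfl
  | cons x l =>
    rw [splitSum_cons, splitSum_eq_zero, add_zero]
    exact fun p s e => h (x :: p) s (by rw [List.cons_append, e]) (by simp)

theorem splitSum_eq_sum (Ψ : List M → List M → N) (l : List M) :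
    splitSum Ψ l = ∑ k ∈ Finset.range (l.length + 1), Ψ (l.take k) (l.drop k) := by
  induction l generalizing Ψ with
  | nil => simp [splitSum]
  | cons x l ih =>
    rw [splitSum_cons, ih, List.length_cons, Finset.sum_range_succ' _ (l.length + 1), add_comm]
    rfl

end Monoid

variable [AddCommGroup N] [AddCommGroup V]

theorem splitSum_neg (Ψ : List M → List M → N) (l : List M) :
    splitSum (fun p s => - Ψ p s) l = - splitSum Ψ l :=
  (map_splitSum (negAddMonoidHom : N →+ N) Ψ l).symm

theorem splitSum_sub (Ψ Ψ' : List M → List M → N) (l : List M) :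
    splitSum (fun p s => Ψ p s - Ψ' p s) l = splitSum Ψ l - splitSum Ψ' l := by
  simp only [sub_eq_add_neg, splitSum_add, splitSum_neg]

end SplitSum

/-! ### Insertion of an operation -/

section Ins

variable {M : Type*} {V : Type*} {W : Type*}

/-- The sum of `φ (σ p ++ β q :: r)` over all `p ++ q ++ r = a` with `q` nonempty. -/
def ins [AddCommMonoid V] (σ : M → M) : (List M → V) → (List M → M) → List M → V
  | _, _, [] => 0
  | φ, β, x :: l => splitSum (fun p s => φ (β (x :: p) :: s)) l + ins σ (fun p => φ (σ x :: p)) β l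

theorem ins_nil [AddCommMonoid V] (σ : M → M) (φ : List M → V) (β : List M → M) :
    ins σ φ β [] = 0 := rfl

theorem ins_cons [AddCommMonoid V] (σ : M → M) (φ : List M → V) (β : List M → M) (x : M)
    (l : List M) : ins σ φ β (x :: l) =
      splitSum (fun p s => φ (β (x :: p) :: s)) l + ins σ (fun p => φ (σ x :: p)) β l := rfl

section Monoid

variable [AddCommMonoid V] [AddCommMonoid W] (σ : M → M)

theorem ins_add (φ ψ : List M → V) (β : List M → M) (l : List M) :
    ins σ (fun a => φ a + ψ a) β l = ins σ φ β l + ins σ ψ β l := by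
  induction l generalizing φ ψ with
  | nil => simp [ins_nil]
  | cons x l ih => simp only [ins_cons, splitSum_add, ih]; abel

theorem ins_zero (β : List M → M) (l : List M) : ins σ (fun _ => (0 : V)) β l = 0 := by
  induction l with
  | nil => rfl
  | cons x l ih => rw [ins_cons, splitSum_zero, ih, add_zero]

theorem map_ins {F : Type*} [FunLike F V W] [AddMonoidHomClass F V W] (f : F) (φ : List M → V)
    (β : List M → M) (l : List M) : f (ins σ φ β l) = ins σ (fun a => f (φ a)) β l := by
  induction l generalizing φ with
  | nil => simp [ins_nil]
  | cons x l ih => simp only [ins_cons, map_add, map_splitSum, ih]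

/-- The insertion of an operation is a coderivation. -/
theorem ins_splitSum (Ψ : List M → List M → V) (β : List M → M) (l : List M) :
    ins σ (splitSum Ψ) β l =
      splitSum (fun p s => ins σ (fun p' => Ψ p' s) β p + ins σ (Ψ (p.map σ)) β s) l := by
  induction l generalizing Ψ with
  | nil => simp [splitSum_nil, ins_nil]
  | cons x l ih =>
    have e : (fun p => splitSum Ψ (σ x :: p)) =
        fun p => Ψ [] (σ x :: p) + splitSum (fun q r => Ψ (σ x :: q) r) p := rfl
    rw [ins_cons, e, ins_add, ih]
    simp only [splitSum_cons, splitSum_add, ins_cons, ins_nil, List.map_cons, List.map_nil,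
      zero_add]
    rw [splitSum_assoc fun q r s => Ψ (β (x :: q) :: r) s]
    abel

/-- The insertion only uses `φ` on shorter words, up to the contribution of the operation with one
argument. -/
theorem ins_eq_zero {φ : List M → V} {β : List M → M} {a : List M}
    (h : ∀ p q r, p ++ q ++ r = a → q ≠ [] → φ (p.map σ ++ β q :: r) = 0) : ins σ φ β a = 0 := by
  induction a generalizing φ with
  | nil => rfl
  | cons x l ih =>
    rw [ins_cons, splitSum_eq_zero, ih, add_zero]
    · intro p q r e hq
      exact h (x :: p) q r (by rw [← e]; rfl) hq
    · intro p s e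
      exact h [] (x :: p) s (by rw [← e]; rfl) (by simp)

end Monoid

variable [AddCommGroup V]

theorem ins_neg (σ : M → M) (φ : List M → V) (β : List M → M) (l : List M) :
    ins σ (fun a => - φ a) β l = - ins σ φ β l :=
  (map_ins σ (negAddMonoidHom : V →+ V) φ β l).symm

theorem ins_congr {σ : M → M} {φ ψ : List M → V} {β β' : List M → M} {a : List M}
    (h : ∀ p q r, p ++ q ++ r = a → q ≠ [] → φ (p.map σ ++ β q :: r) = ψ (p.map σ ++ β' q :: r)) :
    ins σ φ β a = ins σ ψ β' a := by
  induction a generalizing φ ψ with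
  | nil => rfl
  | cons x l ih =>
    rw [ins_cons, ins_cons]
    congr 1
    · exact splitSum_congr fun p s e => h [] (x :: p) s (by rw [← e]; rfl) (by simp)
    · exact ih fun p q r e hq => h (x :: p) q r (by rw [← e]; rfl) hq

end Ins

/-! ### Substitution -/

/-- Sorting by the first block turns sums over compositions into a recursion on the word, which is
how all identities for `sub` are proved. -/
theorem sum_composition_succ {V : Type*} [AddCommMonoid V] (n : ℕ) (f : List ℕ → V) :
    ∑ c : Composition (n + 1), f c.blocks =
      ∑ k ∈ Finset.range (n + 1), ∑ c : Composition (n - k), f ((k + 1) :: c.blocks) := by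
  rw [Finset.sum_sigma']
  symm
  refine Finset.sum_bij' (M := V)
    (i := fun kc h => ⟨(kc.1 + 1) :: kc.2.blocks, fun {i} hi => ?_, ?_⟩)
    (j := fun c _ => ⟨c.blocks.head (by
        intro h0; have := c.blocks_sum; simp [h0] at this) - 1,
      ⟨c.blocks.tail, fun {i} hi => c.blocks_pos (List.mem_of_mem_tail hi), ?_⟩⟩)
    ?_ ?_ ?_ ?_ ?_
  · rcases List.mem_cons.1 hi with rfl | hi
    · exact Nat.succ_pos _
    · exact kc.2.blocks_pos hi
  · have := (Finset.mem_range.1 (Finset.mem_sigma.1 h).1)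
    rw [List.sum_cons, kc.2.blocks_sum]; lia
  · obtain ⟨b, hb, hs⟩ := c
    rcases b with _ | ⟨m, b⟩
    · simp at hs
    · have := hb (i := m) (by simp)
      simp at hs ⊢
      lia
  · exact fun _ _ => Finset.mem_univ _
  · rintro ⟨b, hb, hs⟩ -
    rcases b with _ | ⟨m, b⟩
    · simp at hs
    · have := hb (i := m) (by simp)
      simp at hs ⊢
      lia
  · rintro ⟨k, c⟩ -
    rfl
  · rintro ⟨b, hb, hs⟩ -
    rcases b with _ | ⟨m, b⟩
    · simp at hs
    · have := hb (i := m) (by simp)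
      ext1
      simp
      lia
  · intro _ _
    rfl

/-- The sum of `Φ` over all decompositions of a list into nonempty consecutive blocks. -/
def compSum {M V : Type*} [AddCommMonoid V] (Φ : List (List M) → V) (a : List M) : V :=
  ∑ c : Composition a.length, Φ (a.splitWrtComposition c)

theorem compSum_nil {M V : Type*} [AddCommMonoid V] (Φ : List (List M) → V) :
    compSum Φ [] = Φ [] := by
  have h : ∀ c : Composition ([] : List M).length, List.splitWrtComposition ([] : List M) c = [] := by
    intro c
    apply List.eq_nil_of_length_eq_zero
    rw [List.length_splitWrtComposition]
    exact Nat.le_zero.1 c.length_le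
  have : Fintype.card (Composition ([] : List M).length) = 1 := by simp [composition_card]
  simp only [compSum, h, Finset.sum_const, Finset.card_univ, this, one_smul]

theorem compSum_cons {M V : Type*} [AddCommMonoid V] (Φ : List (List M) → V) (x : M)
    (l : List M) : compSum Φ (x :: l) =
      splitSum (fun p s => compSum (fun t => Φ ((x :: p) :: t)) s) l := by
  have h := sum_composition_succ l.length
    fun b => Φ ((x :: l).splitWrtCompositionAux b)
  rw [splitSum_eq_sum]
  refine h.trans (Finset.sum_congr rfl fun k hk => ?_)
  have key : ∀ (n : ℕ) (a : List M), a.length = n →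
      ∑ c : Composition n, Φ ((x :: l.take k) :: a.splitWrtCompositionAux c.blocks) =
      compSum (fun t => Φ ((x :: l.take k) :: t)) a := by
    rintro n a rfl; rfl
  rw [← key (l.length - k) (l.drop k) (by simp)]
  simp [List.splitWrtCompositionAux_cons]

section Sub

variable {M : Type*} {N : Type*} {V : Type*} {W : Type*}

/-- The sum of `φ [γ b₁, …, γ bₜ]` over all decompositions into nonempty consecutive blocks. -/
def sub [AddCommMonoid V] (φ : List N → V) (γ : List M → N) : List M → V :=
  compSum fun b => φ (b.map γ)

section Monoid

variable [AddCommMonoid V] [AddCommMonoid W]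

theorem sub_nil (φ : List N → V) (γ : List M → N) : sub φ γ [] = φ [] := compSum_nil _

theorem sub_cons (φ : List N → V) (γ : List M → N) (x : M) (l : List M) : sub φ γ (x :: l) =
    splitSum (fun p s => sub (fun r => φ (γ (x :: p) :: r)) γ s) l := compSum_cons _ _ _

theorem sub_add_fun (φ ψ : List N → V) (γ : List M → N) (a : List M) :
    sub (fun r => φ r + ψ r) γ a = sub φ γ a + sub ψ γ a := by
  unfold sub compSum; exact Finset.sum_add_distrib

theorem sub_zero_fun (γ : List M → N) (a : List M) : sub (fun _ => (0 : V)) γ a = 0 := by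
  unfold sub compSum; exact Finset.sum_const_zero

theorem map_sub' {F : Type*} [FunLike F V W] [AddMonoidHomClass F V W] (f : F) (φ : List N → V)
    (γ : List M → N) (a : List M) : f (sub φ γ a) = sub (fun r => f (φ r)) γ a := by
  unfold sub compSum; exact map_sum f _ _

/-- Substitution is compatible with deconcatenation. -/
theorem sub_splitSum (Ψ : List N → List N → V) (γ : List M → N) (l : List M) :
    sub (splitSum Ψ) γ l =
      splitSum (fun p s => sub (fun p' => sub (Ψ p') γ s) γ p) l := by
  -- Splitting off the first block may shorten the word by any number of letters.
  induction hn : l.length using Nat.strong_induction_on generalizing l Ψ with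
  | _ n ih =>
  cases l with
  | nil => simp [sub_nil, splitSum_nil]
  | cons x l =>
    simp only [sub_cons, sub_add_fun, splitSum_cons, sub_nil, splitSum_add]
    rw [splitSum_assoc fun q r s => sub (fun p' => sub (Ψ (γ (x :: q) :: p')) γ s) γ r]
    congr 1
    refine splitSum_congr fun p s e => ih s.length ?_ _ _ rfl
    rw [← hn, ← e]; simp

theorem sub_congr {φ ψ : List N → V} {γ δ : List M → N} {a : List M}
    (h : ∀ b : List (List M), b.flatten = a → (∀ q ∈ b, q ≠ []) → φ (b.map γ) = ψ (b.map δ)) :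
    sub φ γ a = sub ψ δ a := by
  unfold sub compSum
  refine Finset.sum_congr rfl fun c _ => h _ (List.flatten_splitWrtComposition _ _) ?_
  intro q hq
  exact List.ne_nil_of_length_pos (List.length_pos_of_mem_splitWrtComposition hq)

end Monoid

end Sub

/-! ### Composition identities for coderivations and coalgebra maps. -/

section MultilinearIdentities

variable {R : Type*} [CommRing R] {M : Type*} [AddCommGroup M] [Module R M]
  {N : Type*} [AddCommGroup N] [Module R N] {V : Type*} [AddCommGroup V] [Module R V]
  {W : Type*} [AddCommGroup W] [Module R W]

namespace Ops

/-- Fix the first argument. -/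
def cons (φ : Ops R M V) (x : M) : Ops R M V where
  toFun l := φ (x :: l)
  linear l r := φ.linear (x :: l) r

/-- A collection of multilinear maps as a linear function of the first argument. -/
def head (φ : Ops R M V) (r : List M) : M →ₗ[R] V := (φ.linear [] r).mk' _

theorem head_apply (φ : Ops R M V) (x : M) (r : List M) : φ (x :: r) = φ.head r x := rfl

theorem map_zero_at (φ : Ops R M V) (l r : List M) : φ (l ++ 0 :: r) = 0 :=
  (φ.linear l r).map_zero

/-- The substitution as a linear function of an additional first argument. -/
def subHead {P : Type*} (φ : Ops R N V) (γ : List P → N) (s : List P) : N →ₗ[R] V where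
  toFun y := sub (fun r => φ (y :: r)) γ s
  map_add' y z := by
    simp only [φ.head_apply, map_add, sub_add_fun]
  map_smul' c y := by
    simp only [φ.head_apply, map_smul, RingHom.id_apply]
    exact (map_sub' (LinearMap.lsmul R V c) _ _ _).symm

theorem subHead_apply {P : Type*} (φ : Ops R N V) (γ : List P → N) (s : List P) (y : N) :
    sub (fun r => φ (y :: r)) γ s = φ.subHead γ s y := rfl

/-- Postcomposition with a linear map. -/
def postcomp (f : V →ₗ[R] W) (φ : Ops R M V) : Ops R M W where
  toFun l := f (φ l)
  linear l r := (f ∘ₗ (φ.linear l r).mk' _).isLinear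

instance : Add (Ops R M V) := ⟨fun φ ψ =>
  ⟨fun l => φ l + ψ l, fun l r => ((φ.linear l r).mk' _ + (ψ.linear l r).mk' _).isLinear⟩⟩

instance : Sub (Ops R M V) := ⟨fun φ ψ =>
  ⟨fun l => φ l - ψ l, fun l r => ((φ.linear l r).mk' _ - (ψ.linear l r).mk' _).isLinear⟩⟩

theorem add_apply (φ ψ : Ops R M V) (l : List M) : (φ + ψ) l = φ l + ψ l := rfl

theorem sub_apply (φ ψ : Ops R M V) (l : List M) : (φ - ψ) l = φ l - ψ l := rfl

theorem substitute_apply (φ : Ops R N V) (γ : Ops R M N) (a : List M) :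
    φ.substitute γ a = sub φ γ a := rfl

theorem insert_apply (G : Grading R M) (φ : Ops R M V) (β : Ops R M M) (a : List M) :
    φ.insert G β a = ins (fun b => - G.parity b) φ β a := by
  suffices h : ∀ φ : List M → V, ∑ k ∈ Finset.range a.length, ∑ j ∈ Finset.Icc 1 (a.length - k),
      φ (sgn G (a.take k) ++ β ((a.drop k).take j) :: a.drop (k + j)) =
      ins (fun b => - G.parity b) φ β a from h φ
  induction a with
  | nil => intro φ; rfl
  | cons x l ih =>
    intro φ
    rw [List.length_cons, Finset.sum_range_succ', ins_cons, ← ih, splitSum_eq_sum, add_comm]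
    congr 1
    -- Terms with `k = 0`: the operation takes `x` and `j - 1` further letters, so the range of `j`
    -- is shifted by one.
    · rw [Finset.range_eq_Ico, Nat.sub_zero,
        show Finset.Icc 1 (l.length + 1) = Finset.Ico (0 + 1) (l.length + 1 + 1) from rfl,
        ← Finset.sum_Ico_add']
      refine Finset.sum_congr rfl fun k _ => ?_
      rw [Nat.zero_add]
      rfl
    · refine Finset.sum_congr rfl fun k _ => ?_
      rw [Nat.add_sub_add_right]
      refine Finset.sum_congr rfl fun j _ => ?_
      rw [show k + 1 + j = (k + j) + 1 by lia]
      rfl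

end Ops

/-- Two successive insertions of an odd operation amount to one insertion of its square. -/
theorem ins_ins (σ : M → M) (hσ : ∀ x, σ (σ x) = x) (φ : Ops R M V) (β : Ops R M M)
    (hβ : ∀ a, σ (β a) = - β (a.map σ)) (a : List M) :
    ins σ (ins σ φ β) β a = ins id φ (ins σ β β) a := by
  induction a generalizing φ with
  | nil => rfl
  | cons x l ih =>
    have h4 : ins σ (fun p => ins σ (fun q => φ (σ (σ x) :: q)) β p) β l =
        ins id (fun p => φ (id x :: p)) (ins σ β β) l := by
      simp only [hσ]; exact ih (φ.cons x)
    -- Insertions at two disjoint places occur in both orders. In one of them the right operation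
    -- passes the left one, which costs a sign, so they cancel.
    have h3 : ∀ p s, ins σ (fun s' => φ (β ((σ x) :: p.map σ) :: s')) β s =
        - ins σ (fun q => φ (σ (β (x :: p)) :: q)) β s := by
      intro p s
      rw [← ins_neg, hβ]
      simp only [φ.head_apply, map_neg, neg_neg, List.map_cons]
    have h1 : ∀ p s, φ (ins σ β β (x :: p) :: s) =
        splitSum (fun q r => φ (β (β (x :: q) :: r) :: s)) p +
          ins σ (fun q => φ (β (σ x :: q) :: s)) β p := by
      intro p s
      simp only [φ.head_apply _ s, ins_cons, map_add, map_splitSum, map_ins]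
    rw [ins_cons σ (ins σ φ β), ins_cons id]
    simp only [ins_cons σ φ, ins_add, splitSum_add, h1]
    rw [ins_splitSum]
    simp only [splitSum_add, h3, splitSum_neg, h4]
    rw [splitSum_assoc fun q r s => φ (β (β (x :: q) :: r) :: s)]
    abel

/-- The sign automorphism passes through every letter, and only the one letter produced by the odd
`β` contributes a minus sign. -/
theorem ins_comp_map (σ : M → M) (φ : Ops R M V) (β : List M → M)
    (hβ : ∀ a, σ (β a) = - β (a.map σ)) (a : List M) :
    ins σ (fun b => φ (b.map σ)) β a = - ins σ φ β (a.map σ) := by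
  induction a generalizing φ with
  | nil => simp [ins_nil]
  | cons x l ih =>
    have h := ih (φ.cons (σ (σ x)))
    simp only [Ops.cons] at h
    simp only [ins_cons, List.map_cons, h, hβ, splitSum_map, neg_add]
    simp only [φ.head_apply _ (List.map σ _), map_neg, splitSum_neg]

/-- Both sides run over decompositions into blocks of blocks; this is the associativity of the
composition of morphisms. -/
theorem sub_sub_fun {P : Type*} (φ : Ops R N V) (γ : Ops R M N) (δ : List P → M) (a : List P) :
    sub (sub φ γ) δ a = sub φ (sub γ δ) a := by
  induction hn : a.length using Nat.strong_induction_on generalizing a φ with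
  | _ n ih =>
  cases a with
  | nil => simp [sub_nil]
  | cons x l =>
    have e : ∀ p, (fun r => sub φ γ (δ (x :: p) :: r)) =
        splitSum (fun r₁ r₂ => sub (fun r => φ (γ (δ (x :: p) :: r₁) :: r)) γ r₂) := by
      intro p; funext r; exact sub_cons _ _ _ _
    rw [sub_cons, sub_cons]
    simp only [e, sub_splitSum, sub_cons γ δ, φ.subHead_apply, map_splitSum, map_sub']
    rw [splitSum_assoc fun q r s => sub (fun r => φ.subHead (sub γ δ) s (γ (δ (x :: q) :: r))) δ r]
    refine splitSum_congr fun p s hps => splitSum_congr fun q r hqr => ?_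
    congr 1
    funext y
    exact ih r.length (by rw [← hn, ← hps, ← hqr]; simp; lia) (φ.cons (γ (δ (x :: p) :: y))) r rfl

/-- If the defect `γ ∘ β - β' ∘ γ` vanishes on shorter words, then it determines the difference
of `φ ∘ γ ∘ β` and `φ ∘ β' ∘ γ`. -/
theorem ins_sub_sub_sub_ins (σ : M → M) (σ' : N → N) (φ : Ops R N V) (γ : Ops R M N)
    (β : List M → M) (β' : Ops R N N) (hγ : ∀ a, σ' (γ a) = γ (a.map σ)) (hβ' : β' [] = 0)
    (a : List M) (h : ∀ b, b.length < a.length → ins σ γ β b = sub β' γ b) :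
    ins σ (sub φ γ) β a - sub (ins σ' φ β') γ a = φ [ins σ γ β a - sub β' γ a] := by
  induction hn : a.length using Nat.strong_induction_on generalizing a φ with
  | _ n ih =>
  cases a with
  | nil =>
    rw [ins_nil, sub_nil, ins_nil, ins_nil, sub_nil, hβ', sub_zero, sub_zero]
    exact (φ.map_zero_at [] []).symm
  | cons x l =>
    -- The insertions are sorted by whether they take place in the first block or behind it.
    have e1 : ins σ (sub φ γ) β (x :: l) =
        splitSum (fun p s => φ.subHead γ s (ins σ γ β (x :: p))) l +
        splitSum (fun p s => ins σ (sub (fun r => φ (σ' (γ (x :: p)) :: r)) γ) β s) l := by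
      have e : (fun r => sub φ γ (σ x :: r)) =
          splitSum (fun p s => sub (fun r => φ (γ (σ x :: p) :: r)) γ s) := by
        funext r; exact sub_cons _ _ _ _
      rw [ins_cons, e, ins_splitSum]
      simp only [sub_cons, splitSum_add, φ.subHead_apply, ins_cons, map_add, map_splitSum, map_ins]
      rw [splitSum_assoc fun q r s => φ.subHead γ s (γ (β (x :: q) :: r)), ← add_assoc]
      congr 1
      refine splitSum_congr fun p s _ => ?_
      rw [hγ]
      rfl
    have e2 : sub (ins σ' φ β') γ (x :: l) =
        splitSum (fun p s => φ.subHead γ s (sub β' γ (x :: p))) l +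
        splitSum (fun p s => sub (ins σ' (fun r => φ (σ' (γ (x :: p)) :: r)) β') γ s) l := by
      simp only [sub_cons, ins_cons, sub_add_fun, splitSum_add, map_splitSum]
      congr 1
      rw [splitSum_assoc fun q r s => φ.subHead γ s (sub (fun t => β' (γ (x :: q) :: t)) γ r)]
      refine splitSum_congr fun p s _ => ?_
      rw [sub_splitSum]
      refine splitSum_congr fun q r _ => ?_
      rw [map_sub']
      rfl
    -- Behind the first block the induction applies to the remaining word `s`, whose own defect
    -- vanishes because it is shorter.
    have e3 : splitSum (fun p s => ins σ (sub (fun r => φ (σ' (γ (x :: p)) :: r)) γ) β s -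
        sub (ins σ' (fun r => φ (σ' (γ (x :: p)) :: r)) β') γ s) l = 0 := by
      refine splitSum_eq_zero fun p s hps => ?_
      have hlt : s.length < n := by rw [← hn, ← hps]; simp
      have := ih s.length hlt (φ.cons (σ' (γ (x :: p)))) s
        (fun b hb => h b (by rw [hn]; lia)) rfl
      refine this.trans ?_
      rw [h s (by rw [hn]; exact hlt), sub_self]
      exact Ops.map_zero_at _ [] []
    rw [e1, e2, add_sub_add_comm, ← splitSum_sub, ← splitSum_sub, e3, add_zero]
    -- In the first block the defect can be nonzero only if this block is the whole word.
    rw [splitSum_eq_last]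
    · rw [← map_sub, ← Ops.subHead_apply, sub_nil]
    · intro p s hps hs
      rw [h (x :: p), sub_self]
      rw [← hps]
      have := List.length_pos_of_ne_nil hs
      simp; lia

end MultilinearIdentities

/-! ### Degrees and signs on the suspension. -/

section Degrees

variable {R : Type*} [CommRing R] {M : Type*} [AddCommGroup M] [Module R M]
  {N : Type*} [AddCommGroup N] [Module R N] {V : Type*} [AddCommGroup V] [Module R V]

/-- The entries of the list `a` are homogeneous of the degrees listed in `e`. -/
abbrev HasDegrees (G : Grading R M) (a : List M) (e : List ℤ) : Prop :=
  List.Forall₂ (fun x i => x ∈ G.deg i) a e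

/-- The function `φ` on lists raises degrees by the number of arguments plus `s`. -/
def IsHomogeneous (G : Grading R M) (G' : Grading R V) (φ : List M → V) (s : ℤ) : Prop :=
  ∀ (a : List M) (e : List ℤ), HasDegrees G a e → φ a ∈ G'.deg (e.sum + a.length + s)

theorem HasDegrees.append_inv {G : Grading R M} {p s : List M} {e : List ℤ}
    (h : HasDegrees G (p ++ s) e) :
    ∃ e₁ e₂, e = e₁ ++ e₂ ∧ HasDegrees G p e₁ ∧ HasDegrees G s e₂ :=
  ⟨e.take p.length, e.drop p.length, (List.take_append_drop _ _).symm,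
    by simpa using List.forall₂_take p.length h, by simpa using List.forall₂_drop p.length h⟩

theorem splitSum_mem {P : Type*} (S : Submodule R V) {Ψ : List P → List P → V} {l : List P}
    (h : ∀ p s, p ++ s = l → Ψ p s ∈ S) : splitSum Ψ l ∈ S := by
  rw [splitSum_eq_sum]
  exact S.sum_mem fun k _ => h _ _ (List.take_append_drop _ _)

namespace Grading

theorem neg_parity_mem (G : Grading R M) {i : ℤ} {x : M} (h : x ∈ G.deg i) :
    -G.parity x ∈ G.deg i := by
  rw [G.parity_of_mem h]
  exact neg_mem (zsmul_mem h _)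

theorem neg_parity_of_mem (G : Grading R M) {i : ℤ} {x : M} (h : x ∈ G.deg i) :
    -G.parity x = ((i + 1).negOnePow : ℤ) • x := by
  rw [G.parity_of_mem h, Int.negOnePow_succ]
  simp

theorem neg_parity_neg_parity (G : Grading R M) (x : M) : -G.parity (-G.parity x) = x := by
  simp [G.parity_parity]

end Grading

namespace IsHomogeneous

variable {G : Grading R M} {G' : Grading R V} {G'' : Grading R N}

/-- The fixed letter contributes its degree `i + 1` in the suspension. In general a shift `s` means
degree `s + 1` on the suspension: `-2`, `-1`, `0` belong to coderivations, morphisms and homotopies.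
-/
theorem cons {φ : List M → V} {s : ℤ} (h : IsHomogeneous G G' φ s) {x : M} {i : ℤ}
    (hx : x ∈ G.deg i) : IsHomogeneous G G' (fun l => φ (x :: l)) (s + i + 1) := by
  intro a e hae
  have := h (x :: a) (i :: e) (.cons hx hae)
  convert this using 2
  simp; ring

theorem add {φ ψ : List M → V} {s : ℤ} (h : IsHomogeneous G G' φ s)
    (h' : IsHomogeneous G G' ψ s) : IsHomogeneous G G' (fun a => φ a + ψ a) s :=
  fun a e hae => add_mem (h a e hae) (h' a e hae)

theorem sub {φ ψ : List M → V} {s : ℤ} (h : IsHomogeneous G G' φ s)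
    (h' : IsHomogeneous G G' ψ s) : IsHomogeneous G G' (fun a => φ a - ψ a) s :=
  fun a e hae => sub_mem (h a e hae) (h' a e hae)

theorem ins {φ : List M → V} {s : ℤ} (h : IsHomogeneous G G' φ s) {β : List M → M}
    (hβ : IsHomogeneous G G β (-2)) :
    IsHomogeneous G G' (AInf.ins (fun b => -G.parity b) φ β) (s - 1) := by
  intro a
  induction a generalizing φ s with
  | nil => intro e _; exact zero_mem _
  | cons x l ih =>
    intro e hae
    rcases hae with _ | ⟨hx, hl⟩
    rename_i i e
    rw [ins_cons]
    refine add_mem (splitSum_mem _ fun p q hpq => ?_) ?_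
    · rw [← hpq] at hl
      obtain ⟨e₁, e₂, rfl, h1, h2⟩ := HasDegrees.append_inv hl
      have := h.cons (hβ (x :: p) (i :: e₁) (.cons hx h1)) q e₂ h2
      convert this using 2
      rw [← hpq]; simp; ring
    · have := ih (h.cons (G.neg_parity_mem hx)) e hl
      convert this using 2
      simp; ring

/-- With shift `-1` the coalgebra map induced by `γ` has degree zero, so the shift of `φ` is
unchanged. -/
theorem sub' {φ : List N → V} {s : ℤ} (h : IsHomogeneous G'' G' φ s) {γ : List M → N}
    (hγ : IsHomogeneous G G'' γ (-1)) : IsHomogeneous G G' (AInf.sub φ γ) s := by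
  intro a
  induction hn : a.length using Nat.strong_induction_on generalizing a φ s with
  | _ n ih =>
  intro e hae
  rcases hae with _ | ⟨hx, hl⟩
  · rw [sub_nil, ← hn]; exact h [] [] .nil
  · rename_i x i l e
    rw [sub_cons]
    refine splitSum_mem _ fun p q hpq => ?_
    rw [← hpq] at hl
    obtain ⟨e₁, e₂, rfl, h1, h2⟩ := HasDegrees.append_inv hl
    have := ih q.length (by rw [← hn, ← hpq]; simp)
      (h.cons (hγ (x :: p) (i :: e₁) (.cons hx h1))) q rfl e₂ h2
    convert this using 2
    rw [← hn, ← hpq]; simp; ring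

/-- A map of degree `s` commutes with the parity of the suspension up to sign. -/
theorem neg_parity_apply {φ : Ops R M V} {s : ℤ} (h : IsHomogeneous G G' φ s) (a : List M) :
    -G'.parity (φ a) = ((s + 1).negOnePow : ℤ) • φ (a.map fun b => -G.parity b) := by
  induction a generalizing φ s with
  | nil =>
    have := h [] [] .nil
    rw [G'.neg_parity_of_mem this]
    simp
  | cons x l ih =>
    have : (-G'.parity) ∘ₗ φ.head l =
        ((s + 1).negOnePow : ℤ) • φ.head (l.map fun b => -G.parity b) ∘ₗ (-G.parity) := by
      apply G.hom_ext
      intro i x hx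
      have h2 := ih (φ := φ.cons x) (h.cons hx)
      simp only [LinearMap.comp_apply, LinearMap.neg_apply, LinearMap.smul_apply]
      rw [G.neg_parity_of_mem hx, map_zsmul, smul_smul, ← Units.val_mul, ← Int.negOnePow_add]
      refine h2.trans ?_
      rw [show s + i + 1 + 1 = s + 1 + (i + 1) by ring]
      rfl
    exact LinearMap.congr_fun this x

end IsHomogeneous

theorem twist_hasDegrees {G : Grading R M} {a : List M} {e : List ℤ} (h : HasDegrees G a e) :
    HasDegrees G (Ops.twist G a) e := by
  induction h with
  | nil => exact .nil
  | @cons x i l e hx h ih =>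
    refine .cons ?_ ih
    generalize l.length = n
    induction n with
    | zero => exact hx
    | succ n ihn =>
      rw [pow_succ', Module.End.mul_apply, G.parity_of_mem ihn]
      exact zsmul_mem ihn _

theorem Ops.HasDegree.susp {G : Grading R M} {G' : Grading R V} {f : Ops R M V} {s : ℤ}
    (h : f.HasDegree G G' s) : IsHomogeneous G G' (f.susp G) s := by
  intro a e hae
  have := h _ _ (twist_hasDegrees hae)
  rwa [Ops.length_twist] at this

theorem IsHomogeneous.hasDegree_susp {G : Grading R M} {G' : Grading R V} {f : Ops R M V} {s : ℤ}
    (h : IsHomogeneous G G' f s) : (f.susp G).HasDegree G G' s :=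
  Ops.HasDegree.susp h

end Degrees

/-! ### Bases of homogeneous elements -/

section Basis

open Module

variable {R : Type*} [CommRing R] {M : Type*} [AddCommGroup M] [Module R M]
  {N : Type*} [AddCommGroup N] [Module R N] {V : Type*} [AddCommGroup V] [Module R V]

/-- A basis of a graded module that consists of homogeneous elements. -/
structure GradedBasis (G : Grading R M) (κ : Type*) where
  basis : Basis κ R M
  degree : κ → ℤ
  mem : ∀ k, basis k ∈ G.deg (degree k)
  le_span : ∀ i, G.deg i ≤ Submodule.span R (basis '' {k | degree k = i})

theorem Grading.exists_gradedBasis {R : Type u} [CommRing R] {M : Type v} [AddCommGroup M]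
    [Module R M] (G : Grading R M) (h : ∀ i, Module.Free R (G.deg i)) :
    ∃ κ : Type v, Nonempty (GradedBasis G κ) := by
  classical
  let b := fun i => Module.Free.chooseBasis R (G.deg i)
  refine ⟨_, ⟨⟨G.isInternal.collectedBasis b, Sigma.fst, G.isInternal.collectedBasis_mem b, ?_⟩⟩⟩
  intro i x hx
  have h1 : (⟨x, hx⟩ : G.deg i) ∈ Submodule.span R (Set.range (b i)) := by
    rw [(b i).span_eq]; trivial
  have h2 := Submodule.mem_map_of_mem (f := (G.deg i).subtype) h1
  rw [Submodule.map_span] at h2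
  refine Submodule.span_mono ?_ h2
  rintro _ ⟨_, ⟨k, rfl⟩, rfl⟩
  exact ⟨⟨i, k⟩, rfl, by simp⟩

theorem Ops.eq_of_basis {κ : Type*} (b : Basis κ R M) {φ ψ : Ops R M V} {n : ℕ}
    (h : ∀ w : List κ, w.length = n → φ (w.map b) = ψ (w.map b)) {a : List M}
    (ha : a.length = n) : φ a = ψ a := by
  -- The word is a prefix of basis letters followed by a tail `r` of arbitrary letters; the
  -- induction moves the first letter of the tail into the prefix.
  suffices H : ∀ (r : List M) (w : List κ), w.length + r.length = n →
      φ (w.map b ++ r) = ψ (w.map b ++ r) from H a [] (by simpa using ha)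
  intro r
  induction r with
  | nil => intro w hw; simpa using h w (by simpa using hw)
  | cons x r ih =>
    intro w hw
    have : (φ.linear (w.map b) r).mk' _ = (ψ.linear (w.map b) r).mk' _ := by
      apply b.ext
      intro k
      have := ih (w ++ [k]) (by rw [← hw]; simp; lia)
      simpa using this
    exact LinearMap.congr_fun this x

theorem GradedBasis.isHomogeneous {κ : Type*} {G : Grading R M} (b : GradedBasis G κ)
    {G' : Grading R V} {φ : Ops R M V} {s : ℤ}
    (h : ∀ w : List κ, φ (w.map b.basis) ∈ G'.deg ((w.map b.degree).sum + w.length + s)) :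
    IsHomogeneous G G' φ s := by
  suffices H : ∀ (r : List M) (w : List κ) (e : List ℤ), HasDegrees G r e →
      φ (w.map b.basis ++ r) ∈
        G'.deg ((w.map b.degree).sum + w.length + (e.sum + r.length) + s) by
    intro a e hae
    simpa using H a [] e hae
  intro r
  induction r with
  | nil =>
    rintro w e ⟨⟩
    simpa using h w
  | cons x r ih =>
    rintro w e (_ | ⟨hx, hr⟩)
    rename_i i e
    refine Submodule.span_induction (p := fun x _ => φ (w.map b.basis ++ x :: r) ∈ G'.deg _)
      ?_ ?_ ?_ ?_ (b.le_span i hx)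
    · rintro _ ⟨k, rfl, rfl⟩
      have := ih (w ++ [k]) e hr
      simp only [List.map_append, List.map_cons, List.map_nil, List.append_assoc,
        List.cons_append, List.nil_append] at this
      convert this using 2
      simp; ring
    · rw [φ.map_zero_at]; exact zero_mem _
    · intro x y _ _ hx hy
      rw [(φ.linear _ _).map_add]; exact add_mem hx hy
    · intro c x _ hx
      rw [(φ.linear _ _).map_smul]; exact Submodule.smul_mem _ _ hx

/-- Multilinear maps may be prescribed on the words in a basis. -/
theorem Ops.exists_of_basis {κ : Type*} (b : Basis κ R M) (F : List κ → V) :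
    ∃ φ : Ops R M V, ∀ w, φ (w.map b) = F w := by
  -- The words in the basis form a basis of the tensor algebra, where a linear map may be
  -- prescribed.
  refine ⟨(Ops.word R M).postcomp (b.tensorAlgebra.constr R fun w => F (FreeMonoid.toList w)), ?_⟩
  intro w
  have : Ops.word R M (w.map b) = b.tensorAlgebra (FreeMonoid.ofList w) := by
    change (List.map _ _).prod = _
    simp [Module.Basis.tensorAlgebra, FreeAlgebra.basisFreeMonoid,
      FreeAlgebra.equivMonoidAlgebraFreeMonoid, MonoidAlgebra.lift_apply, map_list_prod,
      Function.comp_def]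
  change Basis.constr _ _ _ (Ops.word R M (w.map b)) = _
  rw [this, Basis.constr_basis]
  rfl

end Basis

/-! ### The convolution algebra of functions on words. -/

section Convolution

variable {R : Type*} [CommRing R] {M : Type*} [AddCommGroup M] [Module R M]
  {A : Type*} [AddCommGroup A] [Module R A] {A' : Type*} [AddCommGroup A'] [Module R A']

/-- `φ ↦ φ ∘ D`, where `D` is the coderivation with components `β`. -/
noncomputable def insHom {V : Type*} [AddCommGroup V] (G : Grading R M) (β : List M → M) :
    (List M → V) →+ (List M → V) where
  toFun φ := ins (fun b => -G.parity b) φ β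
  map_zero' := funext fun l => ins_zero _ β l
  map_add' φ ψ := funext fun l => ins_add _ φ ψ β l

/-- Composition with the sign automorphism of the tensor coalgebra of the suspension. -/
noncomputable def signHom (V : Type*) [AddCommGroup V] (G : Grading R M) : (List M → V) →+ (List M → V) where
  toFun φ l := φ (l.map fun b => -G.parity b)
  map_zero' := rfl
  map_add' _ _ := rfl

/-- Composition with a linear map on the left. -/
def postHom (M : Type*) (f : A →ₗ[R] A') : (List M → A) →+ (List M → A') where
  toFun φ l := f (φ l)
  map_zero' := funext fun _ => map_zero f
  map_add' _ _ := funext fun _ => map_add f _ _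

/-- The convolution product of functions on words with values in the suspension of a differential
graded algebra. -/
noncomputable def conv (M : Type*) (D : DGAlgebra R A) :
    (List M → A) →+ (List M → A) →+ (List M → A) :=
  AddMonoidHom.mk' (fun φ => AddMonoidHom.mk' (fun ψ l =>
      splitSum (fun p s => D.mul (D.parity (φ p)) (ψ s)) l)
      (fun _ _ => by funext l; simp [splitSum_add]))
    (fun _ _ => by ext ψ l; simp [splitSum_add])

variable (G : Grading R M) (D : DGAlgebra R A)

theorem conv_apply (φ ψ : List M → A) (l : List M) :
    conv M D φ ψ l = splitSum (fun p s => D.mul (D.parity (φ p)) (ψ s)) l := rfl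

theorem signHom_signHom {V : Type*} [AddCommGroup V] (φ : List M → V) :
    signHom V G (signHom V G φ) = φ := by
  funext l
  simp [signHom, Function.comp_def, G.parity_parity]

/-- The product is odd on the suspension, so associativity holds only up to moving it past `φ`,
which is recorded by the parity. -/
theorem conv_assoc (φ ψ χ : List M → A) : conv M D (conv M D φ ψ) χ =
    conv M D (postHom M D.parity φ) (conv M D ψ χ) := by
  funext l
  have e : ∀ (p : List M) x, D.mul (D.parity (conv M D φ ψ p)) x =
      splitSum (fun q r => D.mul (D.parity (D.mul (D.parity (φ q)) (ψ r))) x) p := fun p x =>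
    map_splitSum ((D.mul.flip x) ∘ₗ D.parity) _ p
  rw [conv_apply, conv_apply]
  simp only [e]
  rw [splitSum_assoc fun q r s => D.mul (D.parity (D.mul (D.parity (φ q)) (ψ r))) (χ s)]
  simp only [conv_apply, map_splitSum, D.parity_mul, D.mul_assoc]
  rfl

theorem d_conv (φ ψ : List M → A) : postHom M D.d (conv M D φ ψ) =
    - conv M D (postHom M D.d φ) ψ + conv M D (postHom M D.parity φ) (postHom M D.d ψ) := by
  funext l
  change D.d (conv M D φ ψ l) = - conv M D _ _ l + conv M D _ _ l
  simp only [conv_apply, map_splitSum, ← splitSum_neg, ← splitSum_add, D.d_mul]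
  refine splitSum_congr fun p s _ => ?_
  simp [postHom, D.parity_d]

/-- A Leibniz rule, dual to `ins_splitSum`: the operation falls on letters of the left or of the
right piece, and in the second case it passes the whole left piece. -/
theorem ins_conv (β : List M → M) (φ ψ : List M → A) : insHom G β (conv M D φ ψ) =
    conv M D (insHom G β φ) ψ + conv M D (signHom A G φ) (insHom G β ψ) := by
  funext l
  change ins _ (splitSum (fun p s => D.mul (D.parity (φ p)) (ψ s))) β l =
    conv M D _ _ l + conv M D _ _ l
  simp only [ins_splitSum, conv_apply, ← splitSum_add]
  refine splitSum_congr fun p s _ => ?_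
  congr 1
  · exact (map_ins _ ((D.mul.flip (ψ s)) ∘ₗ D.parity) φ β p).symm
  · exact (map_ins _ _ ψ β s).symm

theorem sign_conv (φ ψ : List M → A) : signHom A G (conv M D φ ψ) =
    conv M D (signHom A G φ) (signHom A G ψ) := by
  funext l
  exact splitSum_map _ _ l

theorem d_d_hom (φ : List M → A) : postHom M D.d (postHom M D.d φ) = 0 :=
  funext fun _ => D.d_d _

theorem post_ins {V W : Type*} [AddCommGroup V] [Module R V] [AddCommGroup W] [Module R W]
    (f : V →ₗ[R] W) (β : List M → M) (φ : List M → V) :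
    postHom M f (insHom G β φ) = insHom G β (postHom M f φ) :=
  funext fun l => map_ins _ f φ β l

theorem ins_ins_hom {V : Type*} [AddCommGroup V] [Module R V] (φ : Ops R M V) (β : Ops R M M)
    (hβ : IsHomogeneous G G β (-2)) (a : List M) :
    insHom G β (insHom G β φ) a = ins id φ (insHom G β β) a :=
  ins_ins _ G.neg_parity_neg_parity φ β (fun a => by
    rw [hβ.neg_parity_apply]; simp [Int.negOnePow_neg]) a

theorem ins_sign {V : Type*} [AddCommGroup V] [Module R V] (φ : Ops R M V) (β : Ops R M M)
    (hβ : IsHomogeneous G G β (-2)) :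
    insHom G β (signHom V G φ) = - signHom V G (insHom G β φ) :=
  funext fun a => ins_comp_map _ φ β (fun a => by
    rw [hβ.neg_parity_apply]; simp [Int.negOnePow_neg]) a

/-- On the suspension `φ` is even and commutes with the signs `-parity`; the minus sign is that of
the one suspended value. -/
theorem parity_of_degree_neg_one {G' : Grading R A} {φ : Ops R M A}
    (h : IsHomogeneous G G' φ (-1)) : postHom M G'.parity φ = - signHom A G φ := by
  funext a
  rw [Pi.neg_apply, eq_neg_iff_add_eq_zero, add_comm, ← eq_neg_iff_add_eq_zero]
  have := h.neg_parity_apply a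
  simp only [neg_add_cancel, Int.negOnePow_zero, Units.val_one, one_smul] at this
  exact this.symm

theorem parity_of_degree_zero {G' : Grading R A} {φ : Ops R M A}
    (h : IsHomogeneous G G' φ 0) : postHom M G'.parity φ = signHom A G φ := by
  funext a
  have := h.neg_parity_apply a
  simp only [zero_add, Int.negOnePow_one, Units.val_neg, Units.val_one, neg_smul, one_smul,
    neg_inj] at this
  exact this

theorem IsHomogeneous.conv {G : Grading R M} {D : DGAlgebra R A} {φ ψ : List M → A} {s t : ℤ}
    (hφ : IsHomogeneous G D.toGrading φ s) (hψ : IsHomogeneous G D.toGrading ψ t) :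
    IsHomogeneous G D.toGrading (AInf.conv M D φ ψ) (s + t) := by
  intro a e hae
  refine splitSum_mem _ fun p q hpq => ?_
  rw [← hpq] at hae
  obtain ⟨e₁, e₂, rfl, h1, h2⟩ := HasDegrees.append_inv hae
  have h3 := hφ p e₁ h1
  rw [D.parity_of_mem h3, map_zsmul]
  have := D.mul_mem _ _ _ h3 _ (hψ q e₂ h2)
  rw [LinearMap.smul_apply]
  refine zsmul_mem ?_ _
  convert this using 2
  rw [← hpq]; simp; ring

theorem IsHomogeneous.d {G : Grading R M} {D : DGAlgebra R A} {φ : List M → A} {s : ℤ}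
    (hφ : IsHomogeneous G D.toGrading φ s) :
    IsHomogeneous G D.toGrading (postHom M D.d φ) (s - 1) := by
  intro a e hae
  have := D.d_mem _ _ (hφ a e hae)
  rw [add_sub_assoc] at this
  exact this

theorem susp_ops_eq_zero {a : List A} (h : 3 ≤ a.length) : D.ops.susp D.toGrading a = 0 :=
  D.ops_eq_zero (by rwa [Ops.length_twist])

theorem susp_ops_one (x : A) : D.ops.susp D.toGrading [x] = D.d x := by
  simp [Ops.susp, Ops.twist, DGAlgebra.ops]

theorem susp_ops_two (x y : A) : D.ops.susp D.toGrading [x, y] = D.mul (D.parity x) y := by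
  simp [Ops.susp, Ops.twist, DGAlgebra.ops]

/-- A dg algebra has no operations with three or more arguments, so only decompositions into one or
two blocks survive. This turns the morphism relation into the equation of a twisting function. -/
theorem sub_ops {φ : List M → A} (hφ : φ [] = 0) :
    sub (D.ops.susp D.toGrading) φ = postHom M D.d φ + conv M D φ φ := by
  funext a
  rw [Pi.add_apply, conv_apply]
  cases a with
  | nil => simp [sub_nil, splitSum_nil, hφ, postHom, Ops.susp, Ops.twist, DGAlgebra.ops]
  | cons x l =>
    have h3 : ∀ (x y z : A) (r : List A), D.ops.susp D.toGrading (x :: y :: z :: r) = 0 :=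
      fun x y z r => susp_ops_eq_zero D (by simp)
    have k2 : ∀ (x y : A) (s : List M),
        sub (fun r => D.ops.susp D.toGrading (x :: y :: r)) φ s =
          if s = [] then D.mul (D.parity x) y else 0 := by
      intro x y s
      cases s with
      | nil => simp [sub_nil, susp_ops_two]
      | cons z s => simp [sub_cons, h3, sub_zero_fun, splitSum_zero]
    have k1 : ∀ (x : A) (s : List M), sub (fun r => D.ops.susp D.toGrading (x :: r)) φ s =
        if s = [] then D.d x else D.mul (D.parity x) (φ s) := by
      intro x s
      cases s with
      | nil => simp [sub_nil, susp_ops_one]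
      | cons z s =>
        simp only [sub_cons, k2]
        rw [splitSum_eq_last]
        · simp
        · intro p s _ hs; simp [hs]
    simp only [sub_cons, k1, splitSum_cons, hφ, map_zero, LinearMap.zero_apply, zero_add]
    -- Since `φ [] = 0`, the product term may be included for empty `s` as well, and so the whole
    -- convolution appears.
    have e : ∀ p s : List M, (if s = [] then D.d (φ (x :: p))
          else D.mul (D.parity (φ (x :: p))) (φ s)) =
        (if s = [] then D.d (φ (x :: p)) else 0) +
          D.mul (D.parity (φ (x :: p))) (φ s) := by
      intro p s
      split_ifs with h
      · simp [h, hφ]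
      · simp
    simp only [e, splitSum_add]
    rw [splitSum_eq_last (Ψ := fun p s => if s = [] then D.d (φ (x :: p)) else 0)]
    · rfl
    · intro p s _ hs; simp [hs]

/-- One block gives the differential of `h`; with two blocks `h` sits in the second, behind `F`, or
in the first, in front of `g`. More blocks do not contribute. -/
theorem mixed_ops {F h g : Ops R M A} (hF : F [] = 0) (hh : h [] = 0) (hg : g [] = 0)
    (a : List M) : Ops.mixed G (D.ops.susp D.toGrading) F h g a =
      (postHom M D.d h + conv M D (signHom A G F) h + conv M D h g) a := by
  let Φ : List (List M) → A := fun b => ∑ i ∈ Finset.range b.length,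
    D.ops.susp D.toGrading (((b.take i).map fun l => F (Ops.sgn G l)) ++
      h (b.getD i []) :: ((b.drop (i + 1)).map fun l => g l))
  have h0 : Ops.mixed G (D.ops.susp D.toGrading) F h g a = compSum Φ a := by
    simp only [Ops.mixed, compSum, Φ, List.length_splitWrtComposition]
  have h3 : ∀ p q r b, Φ (p :: q :: r :: b) = 0 := fun p q r b =>
    Finset.sum_eq_zero fun i hi => susp_ops_eq_zero D (by
      simp at hi ⊢; lia)
  have h1 : ∀ p, Φ [p] = D.d (h p) := fun p => by simp [Φ, susp_ops_one]
  have h2 : ∀ p q, Φ [p, q] = D.mul (D.parity (h p)) (g q) +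
      D.mul (D.parity (F (Ops.sgn G p))) (h q) := fun p q => by
    simp [Φ, susp_ops_two, Finset.sum_range_succ]
  have k2 : ∀ (p q s : List M), compSum (fun t => Φ (p :: q :: t)) s =
      if s = [] then Φ [p, q] else 0 := by
    intro p q s
    cases s with
    | nil => simp [compSum_nil]
    | cons z s =>
      have hz : ∀ s : List M, compSum (fun _ => (0 : A)) s = 0 := fun s => Finset.sum_const_zero
      simp [compSum_cons, h3, hz, splitSum_zero]
  have k1 : ∀ p s : List M, compSum (fun t => Φ (p :: t)) s =
      if s = [] then Φ [p] else Φ [p, s] := by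
    intro p s
    cases s with
    | nil => simp [compSum_nil]
    | cons z s =>
      simp only [compSum_cons, k2]
      rw [splitSum_eq_last]
      · simp
      · intro q t _ ht; simp [ht]
  rw [h0]
  simp only [Pi.add_apply, conv_apply]
  cases a with
  | nil => simp [compSum_nil, splitSum_nil, Φ, hh, hg, postHom]
  | cons x l =>
    have hF' : signHom A G F [] = 0 := hF
    have e : ∀ p s : List M, (if s = [] then Φ [x :: p] else Φ [x :: p, s]) =
        (if s = [] then D.d (h (x :: p)) else 0) +
          (D.mul (D.parity (F (Ops.sgn G (x :: p)))) (h s) +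
          D.mul (D.parity (h (x :: p))) (g s)) := by
      intro p s
      split_ifs with hs
      · simp [hs, hh, hg, h1]
      · rw [h2]; abel
    simp only [compSum_cons, k1, splitSum_cons, hF', hh, map_zero, LinearMap.zero_apply,
      zero_add, e, splitSum_add]
    rw [splitSum_eq_last (Ψ := fun p s => if s = [] then D.d (h (x :: p)) else 0), if_pos rfl,
      ← add_assoc]
    · rfl
    · intro p s _ hs; simp [hs]

end Convolution

/-! ### Bianchi identities for the defects. -/

section Obstruction

variable {R : Type*} [CommRing R] {M : Type*} [AddCommGroup M] [Module R M]
  {A : Type*} [AddCommGroup A] [Module R A]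

variable (G : Grading R M) (D : DGAlgebra R A)

/-- The failure of `φ` to be a twisting function. -/
noncomputable def twistDefect (β : List M → M) (φ : List M → A) : List M → A :=
  insHom G β φ - postHom M D.d φ - conv M D φ φ

/-- The failure of `η` to be a homotopy from `F` to `X`. -/
noncomputable def homotopyDefect (β : List M → M) (F X η : List M → A) : List M → A :=
  F - X - insHom G β η - postHom M D.d η - conv M D (signHom A G F) η - conv M D η X

/-- Apply `d` and replace each `d φ` by means of the defect. The quadratic terms cancel by the
Leibniz rule `ins_conv`, the cubic ones by `conv_assoc`, and the square of the coderivation remains.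
-/
theorem d_twistDefect {β : Ops R M M} {φ : Ops R M A} (hβ : IsHomogeneous G G β (-2))
    (hφ : IsHomogeneous G D.toGrading φ (-1)) :
    postHom M D.d (twistDefect G D β φ) = ins id φ (insHom G β β) -
      insHom G β (twistDefect G D β φ) - conv M D (twistDefect G D β φ) φ -
      conv M D (signHom A G φ) (twistDefect G D β φ) := by
  have h1 : insHom G β (insHom G β φ.toFun) = ins id φ (insHom G β β) :=
    funext fun a => ins_ins_hom G φ β hβ a
  have h2 : postHom M D.parity φ = - signHom A G φ := parity_of_degree_neg_one G hφ
  simp only [twistDefect, map_sub, AddMonoidHom.sub_apply, d_conv, h1, h2, ins_conv, d_d_hom,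
    post_ins, conv_assoc, map_neg, AddMonoidHom.neg_apply]
  abel

/-- The same computation relative to a twisting function `X`. It is not assumed that `F` is
twisting: `F` is still under construction, and its defect enters as the obstruction. -/
theorem d_homotopyDefect {β : Ops R M M} {F X η : Ops R M A} (hβ : IsHomogeneous G G β (-2))
    (hE : ∀ a, insHom G β β a = 0)
    (hF : IsHomogeneous G D.toGrading F (-1)) (hη : IsHomogeneous G D.toGrading η 0)
    (hX : insHom G β X = postHom M D.d X + conv M D X X) :
    postHom M D.d (homotopyDefect G D β F X η) = - twistDefect G D β F +
      insHom G β (homotopyDefect G D β F X η) - conv M D F (homotopyDefect G D β F X η) -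
      conv M D (homotopyDefect G D β F X η) X -
      conv M D (signHom A G (twistDefect G D β F)) η := by
  have h1 : insHom G β (insHom G β η.toFun) = 0 := by
    funext a
    rw [ins_ins_hom G η β hβ a]
    refine ins_eq_zero _ fun p q r _ _ => ?_
    rw [hE, η.map_zero_at]
  have h2 : postHom M D.parity F = - signHom A G F := parity_of_degree_neg_one G hF
  have h3 : postHom M D.parity (signHom A G F) = - F := by
    have : postHom M D.parity (signHom A G F) = signHom A G (postHom M D.parity F) := rfl
    rw [this, h2, map_neg, signHom_signHom]
  have h4 : postHom M D.parity η = signHom A G η := parity_of_degree_zero G hη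
  have h5 : insHom G β (signHom A G F) = - signHom A G (insHom G β F) := ins_sign G F β hβ
  have h6 : postHom M D.d (signHom A G F) = signHom A G (postHom M D.d F) := rfl
  simp only [twistDefect, homotopyDefect, map_sub, AddMonoidHom.sub_apply, d_conv, h1, h3, h4,
    h5, h6, ins_conv, d_d_hom, post_ins, conv_assoc, map_neg, AddMonoidHom.neg_apply, map_add,
    hX, signHom_signHom, sign_conv, AddMonoidHom.add_apply]
  abel

end Obstruction

/-! ### Choice of classes and primitives, and passage to the limit. -/

section Lifting

variable {R : Type*} [CommRing R] {M : Type*} [AddCommGroup M] [Module R M]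
  {A : Type*} [AddCommGroup A] [Module R A]

/-- The component with `n` arguments. -/
def Ops.component (n : ℕ) (φ : Ops R M A) : Ops R M A where
  toFun a := if a.length = n then φ a else 0
  linear l r := by
    by_cases h : l.length + 1 + r.length = n
    · have : ∀ a, (l ++ a :: r).length = n := fun a => by simp; lia
      simpa only [this, if_true] using φ.linear l r
    · have : ∀ a, (l ++ a :: r).length ≠ n := fun a => by simp; lia
      simp only [this, if_false]
      exact (0 : M →ₗ[R] A).isLinear

theorem Ops.component_of_eq {n : ℕ} (φ : Ops R M A) {a : List M} (h : a.length = n) :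
    φ.component n a = φ a := if_pos h

theorem Ops.component_of_ne {n : ℕ} (φ : Ops R M A) {a : List M} (h : a.length ≠ n) :
    φ.component n a = 0 := if_neg h

/-- A choice of representing cycles for the homology classes. -/
structure CycleSection (D : DGAlgebra R A) (ι : D.Homology →ₗ[R] A) : Prop where
  mem_deg : ∀ i, ∀ x ∈ D.homologyDeg i, ι x ∈ D.deg i
  cls_eq : ∀ x, ∃ h : ι x ∈ D.cycles, D.cls ⟨ι x, h⟩ = x

theorem CycleSection.d_apply {D : DGAlgebra R A} {ι : D.Homology →ₗ[R] A}
    (h : CycleSection D ι) (x : D.Homology) : D.d (ι x) = 0 :=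
  D.mem_cycles.1 (h.cls_eq x).1

/-- If a cycle of the chosen form is a boundary, then its class is zero. -/
theorem CycleSection.eq_zero {D : DGAlgebra R A} {ι : D.Homology →ₗ[R] A}
    (h : CycleSection D ι) {x : D.Homology} {y : A} (hy : D.d y = ι x) : x = 0 := by
  obtain ⟨hx, e⟩ := h.cls_eq x
  rw [← e, D.cls_eq_zero]
  exact ⟨y, hy⟩

/-- Cycles are chosen freely on a homogeneous basis, in the right degrees, and extended linearly. -/
theorem exists_cycleSection (D : DGAlgebra R A) {κ : Type*} (b : GradedBasis D.homologyGrading κ) :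
    ∃ ι : D.Homology →ₗ[R] A, CycleSection D ι := by
  have h : ∀ k, ∃ z : D.cycles, (z : A) ∈ D.deg (b.degree k) ∧ D.cls z = b.basis k := by
    intro k
    obtain ⟨z, hz, e⟩ := b.mem k
    exact ⟨z, hz, e⟩
  choose z hz e using h
  let f : D.Homology →ₗ[R] D.cycles := b.basis.constr R z
  have hf : ∀ k, f (b.basis k) = z k := fun k => b.basis.constr_basis R z k
  refine ⟨D.cycles.subtype ∘ₗ f, ⟨fun i x hx => ?_, fun x => ⟨(f x).2, ?_⟩⟩⟩
  · have h1 := b.le_span i hx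
    refine (Submodule.span_le (p := (D.deg i).comap (D.cycles.subtype ∘ₗ f))).2 ?_ h1
    rintro _ ⟨k, rfl, rfl⟩
    simpa [hf] using hz k
  · have : D.cls ∘ₗ f = LinearMap.id := b.basis.ext fun k => by simp [hf, e]
    exact LinearMap.congr_fun this x

theorem GradedBasis.hasDegrees {G : Grading R M} {κ : Type*} (b : GradedBasis G κ) (w : List κ) :
    HasDegrees G (w.map b.basis) (w.map b.degree) := by
  induction w with
  | nil => exact .nil
  | cons k w ih => exact .cons (b.mem k) ih

/-- A collection of multilinear maps with values in the cycles, defined on a free module, splits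
into representatives of its classes and boundaries. -/
theorem exists_class_and_primitive {G : Grading R M} {κ : Type*} (b : GradedBasis G κ)
    (D : DGAlgebra R A) {ι : D.Homology →ₗ[R] A} (hι : CycleSection D ι) {U : Ops R M A} {s : ℤ}
    {n : ℕ} (hU : IsHomogeneous G D.toGrading U s) (hd : ∀ a, a.length = n → D.d (U a) = 0) :
    ∃ (u : Ops R M D.Homology) (v : Ops R M A), IsHomogeneous G D.homologyGrading u s ∧
      IsHomogeneous G D.toGrading v (s + 1) ∧
      (∀ a, a.length ≠ n → u a = 0) ∧ (∀ a, a.length ≠ n → v a = 0) ∧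
      ∀ a, a.length = n → U a = ι (u a) - D.d (v a) := by
  classical
  -- Cutting down to the component with `n` arguments makes all values cycles, so that classes can
  -- be taken without a condition on the length.
  have hz : ∀ a, U.component n a ∈ D.cycles := by
    intro a
    rw [D.mem_cycles]
    by_cases h : a.length = n
    · rw [U.component_of_eq h, hd a h]
    · rw [U.component_of_ne h, map_zero]
  have hh : IsHomogeneous G D.toGrading (U.component n) s := by
    intro a e hae
    by_cases h : a.length = n
    · rw [U.component_of_eq h]; exact hU a e hae
    · rw [U.component_of_ne h]; exact zero_mem _
  let u : Ops R M D.Homology :=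
    { toFun := fun a => D.cls ⟨U.component n a, hz a⟩
      linear := fun l r =>
        { map_add := fun x y => by
            rw [← map_add]; congr 1; exact Subtype.ext (((U.component n).linear l r).map_add x y)
          map_smul := fun c x => by
            rw [← map_smul]; congr 1
            exact Subtype.ext (((U.component n).linear l r).map_smul c x) } }
  have hu : ∀ a, u a = D.cls ⟨U.component n a, hz a⟩ := fun _ => rfl
  have hu0 : ∀ a, a.length ≠ n → u a = 0 := by
    intro a h
    rw [hu, D.cls_eq_zero]
    exact ⟨0, by rw [map_zero]; exact (U.component_of_ne h).symm⟩
  have hudeg : IsHomogeneous G D.homologyGrading u s := fun a e hae =>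
    ⟨⟨U.component n a, hz a⟩, hh a e hae, rfl⟩
  have hprim : ∀ a, ∃ y, D.d y = ι (u a) - U.component n a := by
    intro a
    obtain ⟨h, e⟩ := hι.cls_eq (u a)
    have e' : D.cls ⟨ι (u a), h⟩ - D.cls ⟨U.component n a, hz a⟩ = 0 := sub_eq_zero.2 e
    rw [← map_sub, D.cls_eq_zero] at e'
    exact e'
  -- On a basis word the boundary is homogeneous, so the component of a primitive in the next higher
  -- degree is again a primitive.
  have hw : ∀ w : List κ, ∃ y, y ∈ D.deg ((w.map b.degree).sum + w.length + (s + 1)) ∧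
      D.d y = ι (u (w.map b.basis)) - U.component n (w.map b.basis) ∧ (w.length ≠ n → y = 0) := by
    intro w
    by_cases h : w.length = n
    · obtain ⟨y, hy⟩ := hprim (w.map b.basis)
      have hwd := b.hasDegrees w
      refine ⟨D.proj _ y, D.proj_mem _ _, ?_, fun h' => absurd h h'⟩
      rw [D.d_proj, hy]
      apply D.proj_of_mem
      have h1 := hι.mem_deg _ _ (hudeg _ _ hwd)
      have h2 := hh _ _ hwd
      have := sub_mem h1 h2
      convert this using 2
      simp; ring
    · have h' : (w.map b.basis).length ≠ n := by simpa using h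
      exact ⟨0, zero_mem _, by rw [hu0 _ h', U.component_of_ne h']; simp, fun _ => rfl⟩
  choose F hF1 hF2 hF3 using hw
  -- Freeness of `M` is essential here: primitives chosen word by word extend to a multilinear map.
  obtain ⟨v, hv⟩ := Ops.exists_of_basis b.basis F
  refine ⟨u, v, hudeg, b.isHomogeneous fun w => by rw [hv]; exact hF1 w, hu0, ?_, ?_⟩
  · intro a h
    have h0 : ∀ w : List κ, w.length = a.length → v (w.map b.basis) = (v - v) (w.map b.basis) := by
      intro w hwl
      rw [hv, hF3 w (by rwa [hwl]), Ops.sub_apply, sub_self]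
    rw [Ops.eq_of_basis b.basis h0 rfl, Ops.sub_apply, sub_self]
  · intro a h
    have h0 : ∀ w : List κ, w.length = n → (v.postcomp D.d) (w.map b.basis) =
        (u.postcomp ι - U.component n) (w.map b.basis) := by
      intro w _
      change D.d (v _) = ι (u _) - _
      rw [hv, hF2]
    have h1 : D.d (v a) = ι (u a) - U.component n a := Ops.eq_of_basis b.basis h0 h
    rw [h1, U.component_of_eq h]
    abel

/-- The limit of a sequence of pairs of collections of multilinear maps whose components become
stationary. -/
theorem exists_limit {N₁ N₂ : Type*} [AddCommGroup N₁] [Module R N₁] [AddCommGroup N₂]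
    [Module R N₂] (S : ℕ → Ops R M N₁ × Ops R M N₂ → Prop) (start : ℕ)
    (h0 : ∃ p, S start p)
    (step : ∀ n, start ≤ n → ∀ p, S n p → ∃ q, S (n + 1) q ∧
      ∀ a, a.length ≤ n → q.1 a = p.1 a ∧ q.2 a = p.2 a) :
    ∃ p : Ops R M N₁ × Ops R M N₂, ∀ n, start ≤ n → ∃ q, S n q ∧
      ∀ a, a.length ≤ n → p.1 a = q.1 a ∧ p.2 a = q.2 a := by
  obtain ⟨p0, hp0⟩ := h0
  choose! next hnext1 hnext2 using step
  let s : ℕ → Ops R M N₁ × Ops R M N₂ := fun k => Nat.rec p0 (fun k p => next (start + k) p) k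
  have hs : ∀ k, S (start + k) (s k) := by
    intro k
    induction k with
    | zero => exact hp0
    | succ k ih => exact hnext1 (start + k) (by lia) _ ih
  have hstep : ∀ k a, a.length ≤ start + k → (s (k + 1)).1 a = (s k).1 a ∧
      (s (k + 1)).2 a = (s k).2 a := fun k a ha => hnext2 (start + k) (by lia) _ (hs k) a ha
  have hst : ∀ j k a, a.length ≤ start + k → (s (k + j)).1 a = (s k).1 a ∧
      (s (k + j)).2 a = (s k).2 a := by
    intro j
    induction j with
    | zero => intro k a _; exact ⟨rfl, rfl⟩
    | succ j ih =>
      intro k a ha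
      have h1 := hstep (k + j) a (by lia)
      have h2 := ih k a ha
      exact ⟨h1.1.trans h2.1, h1.2.trans h2.2⟩
  -- The limit takes its value at `a` from approximation number `a.length`, which is stationary
  -- there because it belongs to stage `start + a.length`.
  have key : ∀ k a, a.length ≤ start + k → (s a.length).1 a = (s k).1 a ∧
      (s a.length).2 a = (s k).2 a := by
    intro k a ha
    rcases le_total k a.length with h | h
    · obtain ⟨j, hj⟩ := Nat.exists_eq_add_of_le h
      rw [hj]; exact hst j k a ha
    · obtain ⟨j, hj⟩ := Nat.exists_eq_add_of_le h
      have := hst j a.length a (by lia)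
      rw [hj]; exact ⟨this.1.symm, this.2.symm⟩
  have e : ∀ (l r : List M) x, (l ++ x :: r).length = l.length + 1 + r.length := by
    intro l r x; simp; lia
  refine ⟨⟨⟨fun a => (s a.length).1 a, fun l r => ?_⟩, ⟨fun a => (s a.length).2 a, fun l r => ?_⟩⟩,
    fun n hn => ⟨s (n - start), ?_, fun a ha => key _ a (by lia)⟩⟩
  · simp only [e]; exact (s _).1.linear l r
  · simp only [e]; exact (s _).2.linear l r
  · have := hs (n - start)
    rwa [Nat.add_sub_cancel' hn] at this

end Lifting

/-! ### Dependence of the operations on words of bounded length. -/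

section Congruence

variable {R : Type*} [CommRing R] {M : Type*} [AddCommGroup M] [Module R M]
  {N : Type*} [AddCommGroup N] [Module R N] {V : Type*} [AddCommGroup V] [Module R V]
  {A : Type*} [AddCommGroup A] [Module R A]

theorem length_pos_of_ne_nil {P : Type*} {q : List P} (h : q ≠ []) : 0 < q.length :=
  List.length_pos_of_ne_nil h

theorem insHom_congr (G : Grading R M) {φ ψ : List M → V} {β β' : List M → M} {a : List M}
    (hφ : ∀ b, b.length ≤ a.length → φ b = ψ b) (hβ : ∀ b, b.length ≤ a.length → β b = β' b) :
    insHom G β φ a = insHom G β' ψ a := by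
  refine ins_congr fun p q r h hq => ?_
  have := length_pos_of_ne_nil hq
  have h' := congrArg List.length h
  simp only [List.length_append] at h'
  rw [hβ q (by lia)]
  exact hφ _ (by simp; lia)

theorem conv_congr (D : DGAlgebra R A) {φ φ' ψ ψ' : List M → A} {a : List M}
    (hφ : ∀ b, b.length ≤ a.length → φ b = φ' b) (hψ : ∀ b, b.length ≤ a.length → ψ b = ψ' b) :
    conv M D φ ψ a = conv M D φ' ψ' a := by
  refine splitSum_congr fun p s h => ?_
  have h' := congrArg List.length h
  simp only [List.length_append] at h'
  rw [hφ p (by lia), hψ s (by lia)]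

theorem sub_congr_right {φ : List N → V} {γ δ : List M → N} {a : List M}
    (h : ∀ b, b.length ≤ a.length → γ b = δ b) : sub φ γ a = sub φ δ a := by
  refine sub_congr fun b hb _ => ?_
  congr 1
  refine List.map_congr_left fun q hq => h q ?_
  rw [← hb]
  exact (List.sublist_flatten_of_mem hq).length_le

/-- An operation that vanishes on shorter words is only inserted at the whole word. -/
theorem ins_eq_top {σ : M → M} (φ : Ops R M V) {β : List M → M} {a : List M} (h0 : β [] = 0)
    (h : ∀ b, b.length < a.length → β b = 0) : ins σ φ β a = φ [β a] := by
  cases a with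
  | nil => rw [ins_nil, h0]; exact (φ.map_zero_at [] []).symm
  | cons x l =>
    rw [ins_cons, splitSum_eq_last, ins_eq_zero, add_zero]
    · intro p q r e _
      have h' := congrArg List.length e
      simp only [List.length_append] at h'
      rw [h q (by simp; lia)]
      exact φ.map_zero_at (σ x :: p.map σ) r
    · intro p s e hs
      have h' := congrArg List.length e
      simp only [List.length_append] at h'
      have := length_pos_of_ne_nil hs
      rw [h (x :: p) (by simp; lia)]
      exact φ.map_zero_at [] s

theorem ins_add_right {σ : M → M} (φ : Ops R M V) (β β' : List M → M) (a : List M) :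
    ins σ φ (fun b => β b + β' b) a = ins σ φ β a + ins σ φ β' a := by
  induction a generalizing φ with
  | nil => simp [ins_nil]
  | cons x l ih =>
    have := ih (φ.cons (σ x))
    simp only [Ops.cons] at this
    simp only [ins_cons, φ.head_apply _ (_ : List M), map_add, splitSum_add]
    simp only [← φ.head_apply, this]
    abel

/-- The coderivation given by operations without a linear part shortens words. -/
theorem ins_eq_zero_of_first {σ : M → M} (φ : Ops R M V) {β : List M → M} {a : List M}
    (h1 : ∀ x, β [x] = 0) (h : ∀ b, b.length < a.length → φ b = 0) : ins σ φ β a = 0 := by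
  refine ins_eq_zero σ fun p q r e hq => ?_
  rcases q with _ | ⟨x, _ | ⟨y, q⟩⟩
  · exact absurd rfl hq
  · rw [h1, φ.map_zero_at]
  · have h' := congrArg List.length e
    simp only [List.length_append, List.length_cons] at h'
    exact h _ (by simp; lia)

/-- As `ψ` vanishes on the empty word, `φ` is only seen on proper prefixes. -/
theorem conv_eq_zero_left (D : DGAlgebra R A) {φ ψ : List M → A} {a : List M} (hψ : ψ [] = 0)
    (h : ∀ b, b.length < a.length → φ b = 0) : conv M D φ ψ a = 0 := by
  refine splitSum_eq_zero fun p s e => ?_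
  rcases eq_or_ne s [] with rfl | hs
  · rw [hψ, map_zero]
  · have h' := congrArg List.length e
    simp only [List.length_append] at h'
    have := length_pos_of_ne_nil hs
    rw [h p (by lia), map_zero, map_zero, LinearMap.zero_apply]

theorem conv_eq_zero_right (D : DGAlgebra R A) {φ ψ : List M → A} {a : List M} (hφ : φ [] = 0)
    (h : ∀ b, b.length < a.length → ψ b = 0) : conv M D φ ψ a = 0 := by
  refine splitSum_eq_zero fun p s e => ?_
  rcases eq_or_ne p [] with rfl | hs
  · rw [hφ, map_zero, map_zero, LinearMap.zero_apply]
  · have h' := congrArg List.length e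
    simp only [List.length_append] at h'
    have := length_pos_of_ne_nil hs
    rw [h s (by lia), map_zero]

/-- The full word is evaluated only in the decomposition with a single block. -/
theorem sub_eq_add_of_agree (φ : Ops R N V) {γ δ : List M → N} {a : List M} (ha : a ≠ [])
    (h : ∀ b, b.length < a.length → δ b = γ b) :
    sub φ δ a = sub φ γ a + φ [δ a - γ a] := by
  cases a with
  | nil => exact absurd rfl ha
  | cons x l =>
    rw [sub_cons, sub_cons, ← sub_eq_iff_eq_add', ← splitSum_sub, splitSum_eq_last]
    · rw [sub_nil, sub_nil]
      exact ((φ.linear [] []).map_sub _ _).symm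
    · intro p s e hs
      have h' := congrArg List.length e
      simp only [List.length_append] at h'
      have := length_pos_of_ne_nil hs
      rw [h (x :: p) (by simp; lia), sub_eq_zero]
      exact sub_congr_right fun b hb => h b (by simp; lia)

theorem sub_eq_first {φ : List N → V} (γ : List M → N) (h0 : φ [] = 0)
    (h : ∀ x y r, φ (x :: y :: r) = 0) {a : List M} (ha : a ≠ []) :
    sub φ γ a = φ [γ a] := by
  cases a with
  | nil => exact absurd rfl ha
  | cons x l =>
    rw [sub_cons, splitSum_eq_last, sub_nil]
    intro p s _ hs
    cases s with
    | nil => exact absurd rfl hs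
    | cons y s => simp [sub_cons, h, sub_zero_fun, splitSum_zero]

theorem sub_ofLinear_susp (G : Grading R N) (f : N →ₗ[R] V) {φ : List M → N} (hφ : φ [] = 0)
    (a : List M) : sub ((Ops.ofLinear f).susp G) φ a = f (φ a) := by
  rcases eq_or_ne a [] with rfl | ha
  · rw [sub_nil, hφ, map_zero]; rfl
  · rw [sub_eq_first _ rfl (fun _ _ _ => rfl) ha]
    simp [Ops.susp, Ops.twist, Ops.ofLinear]

end Congruence

/-! ### Multilinearity and degrees of the defects. -/

section OpsConstructions

variable {R : Type*} [CommRing R] {M : Type*} [AddCommGroup M] [Module R M]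
  {N : Type*} [AddCommGroup N] [Module R N] {V : Type*} [AddCommGroup V] [Module R V]
  {A : Type*} [AddCommGroup A] [Module R A]

namespace Ops

instance : Zero (Ops R M V) := ⟨⟨fun _ => 0, fun _ _ => (0 : M →ₗ[R] V).isLinear⟩⟩

theorem zero_apply (a : List M) : (0 : Ops R M V) a = 0 := rfl

/-- Composition with the sign automorphism of the tensor coalgebra of the suspension. -/
noncomputable def sign (G : Grading R M) (φ : Ops R M V) : Ops R M V where
  toFun := signHom V G φ
  linear l r := by
    simp only [signHom, AddMonoidHom.coe_mk, ZeroHom.coe_mk, List.map_append, List.map_cons]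
    exact φ.linear_comp _ _ (-G.parity).isLinear

/-- The convolution product. -/
noncomputable def conv (D : DGAlgebra R A) (φ ψ : Ops R M A) : Ops R M A where
  toFun := AInf.conv M D φ ψ
  linear l r := by
    simp only [conv_apply, splitSum_eq_sum, List.length_append, List.length_cons]
    refine isLinearMap_sum _ _ fun k _ => ?_
    rcases lt_or_ge l.length k with h1 | h1
    · obtain ⟨k, rfl⟩ : ∃ k', k = l.length + 1 + k' := ⟨k - (l.length + 1), by lia⟩
      have e1 : ∀ a, (l ++ a :: r).take (l.length + 1 + k) = l ++ a :: r.take k := fun a => by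
        rw [List.take_append, List.take_of_length_le (by lia),
          show l.length + 1 + k - l.length = k + 1 by lia, List.take_succ_cons]
      have e2 : ∀ a, (l ++ a :: r).drop (l.length + 1 + k) = r.drop k := fun a => by
        rw [List.drop_append, List.drop_of_length_le (by lia),
          show l.length + 1 + k - l.length = k + 1 by lia, List.drop_succ_cons, List.nil_append]
      simp only [e1, e2]
      exact (((D.mul.flip (ψ (r.drop k))) ∘ₗ D.parity) ∘ₗ (φ.linear l (r.take k)).mk' _).isLinear
    · have e1 : ∀ a, (l ++ a :: r).take k = l.take k := fun a => by
        rw [List.take_append, show k - l.length = 0 by lia]; simp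
      have e2 : ∀ a, (l ++ a :: r).drop k = l.drop k ++ a :: r := fun a => by
        rw [List.drop_append, show k - l.length = 0 by lia]; simp
      simp only [e1, e2]
      exact (D.mul (D.parity (φ (l.take k))) ∘ₗ (ψ.linear (l.drop k) r).mk' _).isLinear

theorem coe_insert (G : Grading R M) (φ : Ops R M V) (β : Ops R M M) :
    (φ.insert G β).toFun = insHom G β φ := funext fun a => φ.insert_apply G β a

/-- The failure of `φ` to be a twisting function. -/
noncomputable def twistDefect (G : Grading R M) (D : DGAlgebra R A) (β : Ops R M M)
    (φ : Ops R M A) : Ops R M A :=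
  φ.insert G β - φ.postcomp D.d - Ops.conv D φ φ

theorem coe_twistDefect (G : Grading R M) (D : DGAlgebra R A) (β : Ops R M M)
    (φ : Ops R M A) : (twistDefect G D β φ).toFun = AInf.twistDefect G D β φ := by
  funext a
  change φ.insert G β a - _ - _ = _
  rw [coe_insert]
  rfl

/-- The failure of `η` to be a homotopy from `F` to `X`. -/
noncomputable def homotopyDefect (G : Grading R M) (D : DGAlgebra R A) (β : Ops R M M)
    (F X η : Ops R M A) : Ops R M A :=
  F - X - η.insert G β - η.postcomp D.d - Ops.conv D (F.sign G) η - Ops.conv D η X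

theorem coe_homotopyDefect (G : Grading R M) (D : DGAlgebra R A) (β : Ops R M M)
    (F X η : Ops R M A) :
    (homotopyDefect G D β F X η).toFun = AInf.homotopyDefect G D β F X η := by
  funext a
  change F a - X a - η.insert G β a - _ - _ - _ = _
  rw [coe_insert]
  rfl

end Ops

theorem IsHomogeneous.zero {G : Grading R M} {G' : Grading R V} {s : ℤ} :
    IsHomogeneous G G' (0 : Ops R M V) s := fun _ _ _ => zero_mem _

theorem IsHomogeneous.sign {G : Grading R M} {G' : Grading R V} {φ : List M → V} {s : ℤ}
    (h : IsHomogeneous G G' φ s) : IsHomogeneous G G' (signHom V G φ) s := by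
  intro a e hae
  have h1 : HasDegrees G (a.map fun b => -G.parity b) e := by
    induction hae with
    | nil => exact .nil
    | cons hx _ ih => exact .cons (G.neg_parity_mem hx) ih
  have h2 := h _ e h1
  rwa [List.length_map] at h2

theorem IsHomogeneous.ofLinear {G : Grading R M} {G' : Grading R V} {f : M →ₗ[R] V}
    (h : ∀ i, ∀ x ∈ G.deg i, f x ∈ G'.deg i) : IsHomogeneous G G' (Ops.ofLinear f) (-1) := by
  intro a e hae
  rcases hae with _ | ⟨hx, _ | ⟨_, _⟩⟩
  · exact zero_mem _
  · have := h _ _ hx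
    simpa [Ops.ofLinear] using this
  · exact zero_mem _

theorem IsHomogeneous.twistDefect {G : Grading R M} {D : DGAlgebra R A} {β : List M → M}
    {φ : List M → A} (hβ : IsHomogeneous G G β (-2)) (hφ : IsHomogeneous G D.toGrading φ (-1)) :
    IsHomogeneous G D.toGrading (AInf.twistDefect G D β φ) (-2) :=
  ((hφ.ins hβ).sub hφ.d).sub (hφ.conv hφ)

theorem IsHomogeneous.homotopyDefect {G : Grading R M} {D : DGAlgebra R A} {β : List M → M}
    {F X η : List M → A} (hβ : IsHomogeneous G G β (-2))
    (hF : IsHomogeneous G D.toGrading F (-1)) (hX : IsHomogeneous G D.toGrading X (-1))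
    (hη : IsHomogeneous G D.toGrading η 0) :
    IsHomogeneous G D.toGrading (AInf.homotopyDefect G D β F X η) (-1) :=
  ((((hF.sub hX).sub (hη.ins hβ)).sub hη.d).sub (hF.sign.conv hη)).sub (hη.conv hX)

end OpsConstructions

/-! ### The existence of homology structures -/

section Existence

variable {R : Type*} [CommRing R] {M : Type*} [AddCommGroup M] [Module R M]
  {A : Type*} [AddCommGroup A] [Module R A] (G : Grading R M) (D : DGAlgebra R A)

theorem twistDefect_congr {β β' : List M → M} {φ φ' : List M → A} {a : List M}
    (hφ : ∀ b, b.length ≤ a.length → φ b = φ' b) (hβ : ∀ b, b.length ≤ a.length → β b = β' b) :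
    twistDefect G D β φ a = twistDefect G D β' φ' a := by
  change insHom G β φ a - D.d (φ a) - conv M D φ φ a =
    insHom G β' φ' a - D.d (φ' a) - conv M D φ' φ' a
  rw [insHom_congr G hφ hβ, hφ a le_rfl, conv_congr D hφ hφ]

/-- The effect of changing the components with `n ≥ 2` arguments on the defect. -/
theorem twistDefect_add {β u : Ops R M M} {φ v : Ops R M A} {a : List M} (hφ : φ [] = 0)
    (h1 : ∀ x, β [x] = 0) (ha : 2 ≤ a.length) (hu : ∀ b, b.length ≠ a.length → u b = 0)
    (hv : ∀ b, b.length ≠ a.length → v b = 0) :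
    twistDefect G D (β + u : Ops R M M) (φ + v : Ops R M A) a = twistDefect G D β φ a + φ [u a] - D.d (v a) := by
  have e1 : insHom G (β + u : Ops R M M) (φ + v : Ops R M A) a = insHom G β φ a + φ [u a] := by
    -- The coderivation has no linear part, so it shortens words, and `v` is zero on shorter words.
    have h2 : insHom G (β + u : Ops R M M) v a = 0 := by
      refine ins_eq_zero_of_first v ?_ fun b hb => hv b hb.ne
      intro x
      rw [Ops.add_apply, h1, hu [x] (by simp; lia), add_zero]
    have h3 : insHom G (β + u : Ops R M M) φ a = insHom G β φ a + insHom G u φ a := ins_add_right φ β u a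
    have h4 : insHom G u φ a = φ [u a] :=
      ins_eq_top φ (hu [] (by simp; lia)) fun b hb => hu b hb.ne
    have h5 : insHom G (β + u : Ops R M M) (φ + v : Ops R M A) a =
      insHom G (β + u : Ops R M M) φ a + insHom G (β + u : Ops R M M) v a := ins_add _ _ _ _ _
    rw [h5, h2, h3, h4, add_zero]
  -- Both factors vanish on the empty word, so a product involving `v` evaluates it only on shorter
  -- words or meets a zero factor.
  have e2 : conv M D (φ + v : Ops R M A) (φ + v : Ops R M A) a = conv M D φ φ a := by
    have hv0 : v [] = 0 := hv [] (by simp; lia)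
    have h6 : conv M D (φ + v : Ops R M A) (φ + v : Ops R M A) = conv M D (φ.toFun + v.toFun) (φ.toFun + v.toFun) := rfl
    rw [h6]
    simp only [map_add, AddMonoidHom.add_apply, Pi.add_apply]
    rw [conv_eq_zero_left D hφ (fun b hb => hv b hb.ne),
      conv_eq_zero_left D hv0 (fun b hb => hv b hb.ne),
      conv_eq_zero_right D hφ (fun b hb => hv b hb.ne)]
    abel
  change insHom G (β + u : Ops R M M) (φ + v : Ops R M A) a - D.d (φ a + v a) - conv M D (φ + v : Ops R M A) (φ + v : Ops R M A) a =
    insHom G β φ a - D.d (φ a) - conv M D φ φ a + φ [u a] - D.d (v a)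
  rw [e1, e2, map_add]
  abel

/-- If the defect vanishes on shorter words, then its differential is determined by the failure of
the relations of an `A_∞`-algebra. -/
theorem d_twistDefect_eq {β : Ops R M M} {φ : Ops R M A} (hβ : IsHomogeneous G G β (-2))
    (hφ : IsHomogeneous G D.toGrading φ (-1)) (h0 : φ [] = 0) (h1 : ∀ x, β [x] = 0) {a : List M}
    (hQ : ∀ b, b.length < a.length → twistDefect G D β φ b = 0)
    (hE : ∀ b, b.length < a.length → insHom G β β b = 0) :
    D.d (twistDefect G D β φ a) = φ [insHom G β β a] := by
  have h := congrFun (d_twistDefect G D hβ hφ) a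
  change D.d _ = _ at h
  have h2 : insHom G β (twistDefect G D β φ) a = 0 := by
    rw [← Ops.coe_twistDefect]
    refine ins_eq_zero_of_first _ h1 fun b hb => ?_
    rw [Ops.coe_twistDefect]; exact hQ b hb
  simp only [Pi.sub_apply, h2, conv_eq_zero_left D h0 hQ] at h
  rw [conv_eq_zero_right D (φ := signHom A G φ) h0 hQ, ins_eq_top φ rfl hE] at h
  simpa using h

/-- The relations of an `A_∞`-algebra are forced: by `d_twistDefect_eq` the representative `ι` of
the Stasheff expression is a boundary, so the expression is zero. The twisting equation is needed on
strictly shorter words only, hence the relation at `a` is available before the equation at `a` is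
solved. -/
theorem insHom_eq_zero_of_twistDefect {D : DGAlgebra R A} {ι : D.Homology →ₗ[R] A}
    (hι : CycleSection D ι) {β : Ops R D.Homology D.Homology} {φ : Ops R D.Homology A}
    (hβ : IsHomogeneous D.homologyGrading D.homologyGrading β (-2))
    (hφ : IsHomogeneous D.homologyGrading D.toGrading φ (-1)) (h0 : φ [] = 0)
    (h1 : ∀ x, β [x] = 0) (hφι : ∀ x, φ [x] = ι x) (a : List D.Homology)
    (hQ : ∀ b, b.length < a.length → twistDefect D.homologyGrading D β φ b = 0) :
    insHom D.homologyGrading β β a = 0 := by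
  induction hn : a.length using Nat.strong_induction_on generalizing a with
  | _ n ih =>
  have h := d_twistDefect_eq D.homologyGrading D hβ hφ h0 h1 hQ fun b hb =>
    ih b.length (by lia) b (fun c hc => hQ c (by lia)) rfl
  rw [hφι] at h
  exact hι.eq_zero h

theorem exists_twisting {D : DGAlgebra R A} {κ : Type*} (b : GradedBasis D.homologyGrading κ) :
    ∃ (ι : D.Homology →ₗ[R] A) (β : Ops R D.Homology D.Homology) (φ : Ops R D.Homology A),
      CycleSection D ι ∧ IsHomogeneous D.homologyGrading D.homologyGrading β (-2) ∧
      IsHomogeneous D.homologyGrading D.toGrading φ (-1) ∧ β [] = 0 ∧ φ [] = 0 ∧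
      (∀ x, β [x] = 0) ∧ (∀ x, φ [x] = ι x) ∧
      ∀ a, twistDefect D.homologyGrading D β φ a = 0 := by
  obtain ⟨ι, hι⟩ := exists_cycleSection D b
  let S : ℕ → Ops R D.Homology D.Homology × Ops R D.Homology A → Prop := fun n p =>
    IsHomogeneous D.homologyGrading D.homologyGrading p.1 (-2) ∧
      IsHomogeneous D.homologyGrading D.toGrading p.2 (-1) ∧ p.1 [] = 0 ∧ p.2 [] = 0 ∧
      (∀ x, p.1 [x] = 0) ∧ (∀ x, p.2 [x] = ι x) ∧
      ∀ a, a.length ≤ n → twistDefect D.homologyGrading D p.1 p.2 a = 0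
  -- On one letter the equation says that the values of `ι` are cycles.
  have start : ∃ p, S 1 p := by
    refine ⟨⟨0, Ops.ofLinear ι⟩, .zero, .ofLinear hι.mem_deg, rfl, rfl, fun _ => rfl,
      fun _ => rfl, ?_⟩
    intro a ha
    change ins _ _ _ a - D.d _ - conv _ D _ _ a = 0
    rcases a with _ | ⟨x, _ | ⟨y, a⟩⟩
    · simp [ins_nil, conv_apply, splitSum_nil, Ops.ofLinear]
    · simp [ins_cons, ins_nil, conv_apply, splitSum_nil, splitSum_cons, Ops.ofLinear, hι.d_apply,
        Ops.zero_apply]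
    · simp at ha
  have step : ∀ n, 1 ≤ n → ∀ p, S n p → ∃ q, S (n + 1) q ∧
      ∀ a, a.length ≤ n → q.1 a = p.1 a ∧ q.2 a = p.2 a := by
    rintro n hn ⟨β, φ⟩ ⟨hβ, hφ, hβ0, hφ0, hβ1, hφ1, hQ⟩
    -- A correction `(u, v)` in arity `n + 1` adds `ι u - d v` to the defect, so this has to be
    -- minus the defect.
    let U : Ops R D.Homology A := 0 - Ops.twistDefect D.homologyGrading D β φ
    have hU : ∀ a, U a = - twistDefect D.homologyGrading D β φ a := by
      intro a
      rw [← Ops.coe_twistDefect]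
      exact zero_sub _
    have hUdeg : IsHomogeneous D.homologyGrading D.toGrading U (-2) := by
      intro a e hae
      rw [hU]
      exact neg_mem (hβ.twistDefect hφ a e hae)
    obtain ⟨u, v, hu, hv, hu0, hv0, huv⟩ := exists_class_and_primitive b D hι (n := n + 1) hUdeg
      (by
        intro a ha
        have hQ' : ∀ b, b.length < a.length → twistDefect D.homologyGrading D β φ b = 0 :=
          fun b hb => hQ b (by lia)
        rw [hU, map_neg, d_twistDefect_eq D.homologyGrading D hβ hφ hφ0 hβ1 hQ' fun b hb =>
            insHom_eq_zero_of_twistDefect hι hβ hφ hφ0 hβ1 hφ1 b fun c hc => hQ c (by lia),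
          insHom_eq_zero_of_twistDefect hι hβ hφ hφ0 hβ1 hφ1 a hQ', neg_eq_zero]
        exact φ.map_zero_at [] [])
    have hβu : ∀ a, a.length ≤ n → (β + u) a = β a := fun a ha => by
      rw [Ops.add_apply, hu0 a (by lia), add_zero]
    have hφv : ∀ a, a.length ≤ n → (φ + v) a = φ a := fun a ha => by
      rw [Ops.add_apply, hv0 a (by lia), add_zero]
    refine ⟨⟨β + u, φ + v⟩, ⟨hβ.add hu, hφ.add hv, ?_, ?_, ?_, ?_, ?_⟩,
      fun a ha => ⟨hβu a ha, hφv a ha⟩⟩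
    · exact (hβu [] (by simp)).trans hβ0
    · exact (hφv [] (by simp)).trans hφ0
    · exact fun x => (hβu [x] (by simpa using hn)).trans (hβ1 x)
    · exact fun x => (hφv [x] (by simpa using hn)).trans (hφ1 x)
    · intro a ha
      rcases Nat.lt_or_ge n a.length with h | h
      · have ha : a.length = n + 1 := by lia
        change twistDefect _ D (β + u : Ops _ _ _) (φ + v : Ops _ _ _) a = 0
        rw [twistDefect_add _ _ hφ0 hβ1 (by lia) (fun b hb => hu0 b (by lia))
          (fun b hb => hv0 b (by lia)), hφ1]
        have := huv a ha
        rw [hU] at this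
        rw [add_sub_assoc, ← this, add_neg_cancel]
      · rw [← hQ a h]
        exact twistDefect_congr _ _ (fun b hb => hφv b (by lia)) fun b hb => hβu b (by lia)
  obtain ⟨⟨β, φ⟩, h⟩ := exists_limit S 1 start step
  refine ⟨ι, β, φ, hι, ?_, ?_, ?_, ?_, ?_, ?_, ?_⟩
  · intro a e hae
    obtain ⟨q, hq, hqa⟩ := h (a.length + 1) (by lia)
    rw [(hqa a (by lia)).1]; exact hq.1 a e hae
  · intro a e hae
    obtain ⟨q, hq, hqa⟩ := h (a.length + 1) (by lia)
    rw [(hqa a (by lia)).2]; exact hq.2.1 a e hae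
  · obtain ⟨q, hq, hqa⟩ := h 1 le_rfl
    rw [(hqa [] (by simp)).1]; exact hq.2.2.1
  · obtain ⟨q, hq, hqa⟩ := h 1 le_rfl
    rw [(hqa [] (by simp)).2]; exact hq.2.2.2.1
  · intro x
    obtain ⟨q, hq, hqa⟩ := h 1 le_rfl
    rw [(hqa [x] (by simp)).1]; exact hq.2.2.2.2.1 x
  · intro x
    obtain ⟨q, hq, hqa⟩ := h 1 le_rfl
    rw [(hqa [x] (by simp)).2]; exact hq.2.2.2.2.2.1 x
  · intro a
    obtain ⟨q, hq, hqa⟩ := h (a.length + 1) (by lia)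
    rw [← hq.2.2.2.2.2.2 a (by lia)]
    exact twistDefect_congr _ _ (fun b hb => (hqa b (by lia)).2) fun b hb => (hqa b (by lia)).1

theorem CycleSection.isQuasiIso {D : DGAlgebra R A} {ι : D.Homology →ₗ[R] A}
    (hι : CycleSection D ι) {m : Ops R D.Homology D.Homology} {f : Ops R D.Homology A}
    (hm : ∀ x, m [x] = 0) (hf : ∀ x, f [x] = ι x) : IsQuasiIso m D.ops f := by
  have hm' : ∀ x, m.first x = 0 := hm
  have hf' : ∀ x, f.first x = ι x := hf
  have hd : ∀ a, D.ops.first a = D.d a := fun _ => rfl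
  refine ⟨?_, ?_, ?_⟩
  · intro y; rw [hm', map_zero, hf', hd, hι.d_apply]
  · rintro y - ⟨z, hz⟩
    refine ⟨0, ?_⟩
    rw [hf', hd] at hz
    rw [map_zero]
    exact hι.eq_zero hz.symm
  · intro y hy
    have hy' : y ∈ D.cycles := D.mem_cycles.2 hy
    obtain ⟨h, e⟩ := hι.cls_eq (D.cls ⟨y, hy'⟩)
    have e' : D.cls ⟨y, hy'⟩ - D.cls ⟨ι (D.cls ⟨y, hy'⟩), h⟩ = 0 := sub_eq_zero.2 e.symm
    rw [← map_sub, D.cls_eq_zero] at e'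
    obtain ⟨z, hz⟩ := e'
    refine ⟨D.cls ⟨y, hy'⟩, z, hm' _, ?_⟩
    rw [hf', hd, hz]
    simp

theorem exists_isHomologyStructure {D : DGAlgebra R A} {κ : Type*}
    (b : GradedBasis D.homologyGrading κ) :
    ∃ (m : Ops R D.Homology D.Homology) (f : Ops R D.Homology A), D.IsHomologyStructure m f := by
  obtain ⟨ι, β, φ, hι, hβ, hφ, hβ0, hφ0, hβ1, hφ1, hQ⟩ := exists_twisting b
  have hm1 : ∀ x, β.susp D.homologyGrading [x] = 0 := by
    intro x; simpa [Ops.susp, Ops.twist] using hβ1 x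
  have hf1 : ∀ x, φ.susp D.homologyGrading [x] = ι x := by
    intro x; simpa [Ops.susp, Ops.twist] using hφ1 x
  -- Since `susp` is an involution, these are the collections whose suspensions are `β` and `φ`.
  refine ⟨β.susp D.homologyGrading, φ.susp D.homologyGrading,
    ⟨⟨hβ0, hβ.hasDegree_susp, ?_⟩, hm1, ?_, ⟨hφ0, hφ.hasDegree_susp, ?_⟩,
      hι.isQuasiIso hm1 hf1, ?_⟩⟩
  · intro a
    rw [Ops.susp_susp, Ops.coe_insert]
    exact insHom_eq_zero_of_twistDefect hι hβ hφ hφ0 hβ1 hφ1 a fun b _ => hQ b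
  · intro x y
    -- On two letters the twisting equation says that `ι` of the binary operation and the product of
    -- representatives differ by `d (φ [..])`. The parity on `x` undoes the suspension sign.
    have h := hQ [D.homologyGrading.parity x, y]
    change ins _ _ _ _ - D.d _ - conv _ D _ _ _ = 0 at h
    simp only [ins_cons, ins_nil, conv_apply, splitSum_cons, splitSum_nil, hβ1, hφ0, hφ1, map_zero,
      LinearMap.zero_apply, add_zero, zero_add] at h
    rw [show ∀ x, φ [0, x] = 0 from fun x => φ.map_zero_at [] [x],
      show ∀ x, φ [x, 0] = 0 from fun x => φ.map_zero_at [x] [], zero_add, add_zero] at h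
    have hpar : ∀ x, D.parity (ι (D.homologyGrading.parity x)) = ι x := by
      have : D.parity ∘ₗ ι ∘ₗ D.homologyGrading.parity = ι := by
        apply D.homologyGrading.hom_ext
        intro i x hx
        simp only [LinearMap.comp_apply, D.homologyGrading.parity_of_mem hx, map_zsmul,
          D.parity_of_mem (hι.mem_deg i x hx), smul_smul]
        rw [← Units.val_mul]
        simp
      exact LinearMap.congr_fun this
    rw [hpar] at h
    have h2 : β.susp D.homologyGrading [x, y] = β [D.homologyGrading.parity x, y] := by
      simp [Ops.susp, Ops.twist]
    rw [h2]
    obtain ⟨hx, ex⟩ := hι.cls_eq x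
    obtain ⟨hy, ey⟩ := hι.cls_eq y
    obtain ⟨hz, ez⟩ := hι.cls_eq (β [D.homologyGrading.parity x, y])
    conv_rhs => rw [← ex, ← ey, D.homologyMul_cls]
    rw [← sub_eq_zero]
    conv_lhs => rw [← ez]
    rw [← map_sub, D.cls_eq_zero]
    refine ⟨φ [D.homologyGrading.parity x, y], ?_⟩
    rw [sub_right_comm, sub_eq_zero] at h
    exact h.symm
  · intro a
    rw [Ops.susp_susp, Ops.susp_susp, Ops.coe_insert, Ops.substitute_apply, sub_ops D hφ0]
    have h := hQ a
    change insHom _ _ _ a - D.d _ - conv _ D _ _ _ = 0 at h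
    rw [sub_sub, sub_eq_zero] at h
    exact h
  · intro x
    rw [show φ.susp D.homologyGrading [x] = ι x from hf1 x]
    exact hι.cls_eq x

end Existence

/-! ### Functoriality of homology structures up to homotopy -/

section Functoriality

variable {R : Type*} [CommRing R] {M : Type*} [AddCommGroup M] [Module R M]
  {N : Type*} [AddCommGroup N] [Module R N] {V : Type*} [AddCommGroup V] [Module R V]
  {A : Type*} [AddCommGroup A] [Module R A] (G : Grading R M) (D : DGAlgebra R A)

theorem Ops.substitute_nil (φ : Ops R N V) (γ : Ops R M N) : φ.substitute γ [] = φ [] :=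
  sub_nil φ γ

theorem homotopyDefect_congr {β : List M → M} {F F' X η η' : List M → A} {a : List M}
    (hF : ∀ b, b.length ≤ a.length → F b = F' b) (hη : ∀ b, b.length ≤ a.length → η b = η' b) :
    homotopyDefect G D β F X η a = homotopyDefect G D β F' X η' a := by
  change F a - X a - insHom G β η a - D.d (η a) - conv M D (signHom A G F) η a - conv M D η X a =
    F' a - X a - insHom G β η' a - D.d (η' a) - conv M D (signHom A G F') η' a - conv M D η' X a
  rw [hF a le_rfl, hη a le_rfl, insHom_congr G hη fun _ _ => rfl, conv_congr D hη fun _ _ => rfl,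
    conv_congr D (φ := signHom A G F) (fun b hb => hF _ (by simpa using hb)) hη]
  rfl

/-- The effect on the defect of a change in the components with `n` arguments. -/
theorem homotopyDefect_add {β : List M → M} {F F' X η v : Ops R M A} {a : List M}
    (hF0 : F [] = 0) (hη0 : η [] = 0) (hX0 : X [] = 0) (h1 : ∀ x, β [x] = 0) (ha : a ≠ [])
    (hF : ∀ b, b.length < a.length → F' b = F b) (hv : ∀ b, b.length ≠ a.length → v b = 0) :
    homotopyDefect G D β F' X (η + v : Ops R M A) a =
      homotopyDefect G D β F X η a + (F' a - F a) - D.d (v a) := by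
  have hpos := length_pos_of_ne_nil ha
  have hv' : ∀ b, b.length < a.length → v b = 0 := fun b hb => hv b hb.ne
  have e1 : insHom G β (η + v : Ops R M A) a = insHom G β η a := by
    have h2 : insHom G β (η + v : Ops R M A) a = insHom G β η a + insHom G β v a :=
      ins_add _ _ _ _ _
    have h3 : insHom G β v a = 0 := ins_eq_zero_of_first v h1 hv'
    rw [h2, h3, add_zero]
  have e2 : conv M D (signHom A G F') (η + v : Ops R M A) a = conv M D (signHom A G F) η a := by
    have h2 : conv M D (signHom A G F') (η + v : Ops R M A) =
      conv M D (signHom A G F') (η.toFun + v.toFun) := rfl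
    have h3 : conv M D (signHom A G F') η a = conv M D (signHom A G F) η a := by
      rw [← sub_eq_zero]
      have : conv M D (signHom A G (F'.toFun - F.toFun)) η a = 0 :=
        conv_eq_zero_left D hη0 fun b hb => by
          have := hF (b.map fun b => -G.parity b) (by simpa using hb)
          exact sub_eq_zero.2 this
      rw [← this]
      simp only [map_sub, AddMonoidHom.sub_apply, Pi.sub_apply]
    have hF'0 : signHom A G F' [] = 0 := (hF [] hpos).trans hF0
    rw [h2, map_add, Pi.add_apply, h3, conv_eq_zero_right D hF'0 hv', add_zero]
  have e3 : conv M D (η + v : Ops R M A) X a = conv M D η X a := by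
    have h2 : conv M D (η + v : Ops R M A) X = conv M D (η.toFun + v.toFun) X := rfl
    rw [h2, map_add, AddMonoidHom.add_apply, Pi.add_apply, conv_eq_zero_left D hX0 hv', add_zero]
  change F' a - X a - insHom G β (η + v : Ops R M A) a - D.d (η a + v a) -
      conv M D (signHom A G F') (η + v : Ops R M A) a - conv M D (η + v : Ops R M A) X a =
    F a - X a - insHom G β η a - D.d (η a) - conv M D (signHom A G F) η a - conv M D η X a +
      (F' a - F a) - D.d (v a)
  rw [e1, e2, e3, map_add]
  abel

/-- If the defect vanishes on shorter words, then its differential is determined by the twisting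
defect. -/
theorem d_homotopyDefect_eq {β : Ops R M M} {F X η : Ops R M A} (hβ : IsHomogeneous G G β (-2))
    (h1 : ∀ x, β [x] = 0) (hE : ∀ a, insHom G β β a = 0)
    (hF : IsHomogeneous G D.toGrading F (-1)) (hη : IsHomogeneous G D.toGrading η 0)
    (hX : insHom G β X = postHom M D.d X + conv M D X X)
    (hF0 : F [] = 0) (hη0 : η [] = 0) (hX0 : X [] = 0) {a : List M}
    (hQ : ∀ b, b.length < a.length → homotopyDefect G D β F X η b = 0)
    (hY : ∀ b, b.length < a.length → twistDefect G D β F b = 0) :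
    D.d (homotopyDefect G D β F X η a) = - twistDefect G D β F a := by
  have h := congrFun (d_homotopyDefect G D hβ hE hF hη hX) a
  change D.d _ = _ at h
  have h2 : insHom G β (homotopyDefect G D β F X η) a = 0 := by
    rw [← Ops.coe_homotopyDefect]
    refine ins_eq_zero_of_first _ h1 fun b hb => ?_
    rw [Ops.coe_homotopyDefect]; exact hQ b hb
  have h3 : conv M D (signHom A G (twistDefect G D β F)) η a = 0 :=
    conv_eq_zero_left D hη0 fun b hb => hY _ (by simpa using hb)
  simp only [Pi.sub_apply, Pi.add_apply, Pi.neg_apply, h2, h3, conv_eq_zero_left D hX0 hQ,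
    conv_eq_zero_right D hF0 hQ, sub_zero, add_zero] at h
  exact h

/-- Composition with a coalgebra map respects deconcatenation (`sub_splitSum`), hence is
multiplicative for convolution. -/
theorem sub_conv {N : Type*} (φ ψ : List N → A) (γ : List M → N) :
    sub (conv N D φ ψ) γ = conv M D (sub φ γ) (sub ψ γ) := by
  funext a
  change sub (splitSum fun p s => D.mul (D.parity (φ p)) (ψ s)) γ a = _
  rw [sub_splitSum, conv_apply]
  refine splitSum_congr fun p s _ => ?_
  have e : ∀ p', sub (fun s' => D.mul (D.parity (φ p')) (ψ s')) γ s =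
      (D.mul.flip (sub ψ γ s) ∘ₗ D.parity) (φ p') := fun p' => by
    rw [← map_sub']; rfl
  simp only [e, ← map_sub']
  rfl

theorem sub_post {W : Type*} [AddCommGroup W] [Module R W] {N : Type*} (f : V →ₗ[R] W)
    (φ : List N → V) (γ : List M → N) : sub (postHom N f φ) γ = postHom M f (sub φ γ) :=
  funext fun _ => (map_sub' f φ γ _).symm

/-- The composite of a twisting function with `γ` has a defect determined by that of `γ`. -/
theorem twistDefect_sub {G' : Grading R N} {β : List M → M} {β' : Ops R N N} {φ : Ops R N A}
    {γ : Ops R M N} (hγ : IsHomogeneous G G' γ (-1)) (hβ' : β' [] = 0)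
    (hφ : ∀ b, insHom G' β' φ b = (postHom N D.d φ + conv N D φ φ) b) {a : List M}
    (h : ∀ b, b.length < a.length → insHom G β γ b = sub β' γ b) :
    twistDefect G D β (sub φ γ) a = φ [insHom G β γ a - sub β' γ a] := by
  have hσ : ∀ a, -G'.parity (γ a) = γ (a.map fun b => -G.parity b) := fun a => by
    rw [hγ.neg_parity_apply]; simp
  have e := ins_sub_sub_sub_ins (fun b => -G.parity b) (fun b => -G'.parity b) φ γ β β' hσ hβ' a h
  have e2 : ins (fun b => -G'.parity b) φ β' = postHom N D.d φ + conv N D φ φ := funext hφ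
  have e3 : sub (postHom N D.d φ + conv N D φ φ) γ a =
      sub (postHom N D.d φ) γ a + sub (conv N D φ φ) γ a := sub_add_fun _ _ _ _
  rw [e2, e3, sub_post, sub_conv, ← sub_sub] at e
  exact e

theorem CycleSection.of_isHomologyStructure {D : DGAlgebra R A}
    {m : Ops R D.Homology D.Homology} {f : Ops R D.Homology A}
    (h : D.IsHomologyStructure m f) : CycleSection D f.first where
  mem_deg i x hx := by
    have := h.isAInfHom.degree [x] [i] (.cons hx .nil)
    change f [x] ∈ D.deg i
    simpa using this
  cls_eq := h.induces_id

theorem susp_one {G : Grading R M} (f : Ops R M V) (x : M) : f.susp G [x] = f [x] := by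
  simp [Ops.susp, Ops.twist]

theorem IsAInfHom.twisting {m : Ops R M M} {f : Ops R M A}
    (h : IsAInfHom G m D.toGrading D.ops f) :
    insHom G (m.susp G) (f.susp G) = postHom M D.d (f.susp G) + conv M D (f.susp G) (f.susp G) := by
  rw [← sub_ops D (φ := f.susp G) h.nil, ← Ops.coe_insert]
  exact funext h.rel

section Transfer

variable {B : Type*} [AddCommGroup B] [Module R B] {D : DGAlgebra R A} {E : DGAlgebra R B}

theorem DGHom.map_parity (g : DGHom D E) (a : A) :
    g.toLinearMap (D.parity a) = E.parity (g.toLinearMap a) := by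
  have : g.toLinearMap ∘ₗ D.parity = E.parity ∘ₗ g.toLinearMap := by
    apply D.hom_ext
    intro i a ha
    simp [D.parity_of_mem ha, E.parity_of_mem (g.map_mem i a ha)]
  exact LinearMap.congr_fun this a

theorem DGHom.twisting (g : DGHom D E) {β : List M → M} {φ : List M → A}
    (h : insHom G β φ = postHom M D.d φ + conv M D φ φ) :
    insHom G β (postHom M g.toLinearMap φ) = postHom M E.d (postHom M g.toLinearMap φ) +
      conv M E (postHom M g.toLinearMap φ) (postHom M g.toLinearMap φ) := by
  rw [← post_ins, h]
  funext a
  change g.toLinearMap (D.d (φ a) + _) = E.d (g.toLinearMap (φ a)) + _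
  rw [map_add, g.map_d, conv_apply, conv_apply, map_splitSum]
  simp only [g.map_mul, g.map_parity]
  rfl

/-- A twisting function on a minimal `A_∞`-algebra with a free underlying module factors, up to
homotopy, through any homology structure. -/
theorem exists_factorization {κ : Type*} (b : GradedBasis G κ) {β : Ops R M M} {X : Ops R M B}
    {β' : Ops R E.Homology E.Homology} {φ' : Ops R E.Homology B}
    {ι : E.Homology →ₗ[R] B} (hι : CycleSection E ι) (hφι : ∀ x, φ' [x] = ι x)
    (hβ : IsHomogeneous G G β (-2)) (h1 : ∀ x, β [x] = 0) (hE : ∀ a, insHom G β β a = 0)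
    (hXdeg : IsHomogeneous G E.toGrading X (-1)) (hX0 : X [] = 0)
    (hX : insHom G β X = postHom M E.d X + conv M E X X)
    (hβ'0 : β' [] = 0) (hφ'0 : φ' [] = 0)
    (hφ'deg : IsHomogeneous E.homologyGrading E.toGrading φ' (-1))
    (hφ' : insHom E.homologyGrading β' φ' = postHom _ E.d φ' + conv _ E φ' φ') :
    ∃ (γ : Ops R M E.Homology) (η : Ops R M B), γ [] = 0 ∧ η [] = 0 ∧
      IsHomogeneous G E.homologyGrading γ (-1) ∧ IsHomogeneous G E.toGrading η 0 ∧
      (∀ a, insHom G β γ a = sub β' γ a) ∧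
      ∀ a, homotopyDefect G E β (sub φ' γ) X η a = 0 := by
  let S : ℕ → Ops R M E.Homology × Ops R M B → Prop := fun n p =>
    IsHomogeneous G E.homologyGrading p.1 (-1) ∧ IsHomogeneous G E.toGrading p.2 0 ∧
      p.1 [] = 0 ∧ p.2 [] = 0 ∧
      ∀ a, a.length ≤ n → homotopyDefect G E β (sub φ' p.1) X p.2 a = 0
  -- The vanishing of the homotopy defect on shorter words yields both the morphism relation for `γ`
  -- at `a` and the cycle condition needed for the next correction. The relation is therefore not
  -- part of `S`.
  have hvan : ∀ (γ : Ops R M E.Homology) (η : Ops R M B),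
      IsHomogeneous G E.homologyGrading γ (-1) → IsHomogeneous G E.toGrading η 0 →
      η [] = 0 → ∀ a,
      (∀ b, b.length < a.length → homotopyDefect G E β (sub φ' γ) X η b = 0) →
      insHom G β γ a = sub β' γ a ∧
        E.d (homotopyDefect G E β (sub φ' γ) X η a) = 0 := by
    intro γ η hγ hη hη0 a
    induction hn : a.length using Nat.strong_induction_on generalizing a with
    | _ n ih =>
    intro hQ
    have hP : ∀ c, c.length < a.length → insHom G β γ c = sub β' γ c := fun c hc =>
      (ih c.length (by lia) c rfl fun e he => hQ e (by lia)).1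
    have hY : ∀ c, c.length ≤ a.length →
        twistDefect G E β (sub φ' γ) c = φ' [insHom G β γ c - sub β' γ c] := fun c hc =>
      twistDefect_sub G E hγ hβ'0 (fun b => congrFun hφ' b) fun e he => hP e (by lia)
    have hY0 : ∀ c, c.length < a.length → twistDefect G E β (sub φ' γ) c = 0 := fun c hc => by
      rw [hY c hc.le, hP c hc, sub_self]; exact φ'.map_zero_at [] []
    have hd := d_homotopyDefect_eq G E (F := φ'.substitute γ) hβ h1 hE (hφ'deg.sub' hγ) hη hX
      ((φ'.substitute_nil γ).trans hφ'0) hη0 hX0 (a := a) (fun c hc => hQ c (by lia)) hY0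
    change E.d (homotopyDefect G E β (sub φ' γ) X η a) = - twistDefect G E β (sub φ' γ) a at hd
    -- Minus the morphism defect of `γ` has a representative that is a boundary, so it vanishes.
    rw [hY a le_rfl, hφι, ← map_neg] at hd
    have h0 := hι.eq_zero hd
    rw [neg_eq_zero] at h0
    refine ⟨sub_eq_zero.1 h0, ?_⟩
    rw [hd, h0, neg_zero, map_zero]
  -- Stage zero concerns the empty word only; the linear part of `γ`, the class of `X`, already
  -- comes out of the first correction.
  have start : ∃ p, S 0 p := by
    refine ⟨⟨0, 0⟩, .zero, .zero, rfl, rfl, ?_⟩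
    intro a ha
    obtain rfl : a = [] := List.eq_nil_of_length_eq_zero (by lia)
    change sub φ' _ [] - X [] - 0 - E.d 0 - conv M E _ _ [] - conv M E _ _ [] = 0
    simp [sub_nil, hφ'0, hX0, conv_apply, splitSum_nil, Ops.zero_apply]
  have step : ∀ n, 0 ≤ n → ∀ p, S n p → ∃ q, S (n + 1) q ∧
      ∀ a, a.length ≤ n → q.1 a = p.1 a ∧ q.2 a = p.2 a := by
    rintro n - ⟨γ, η⟩ ⟨hγ, hη, hγ0, hη0, hQ⟩
    let U : Ops R M B := 0 - Ops.homotopyDefect G E β (φ'.substitute γ) X η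
    have hU : ∀ a, U a = - homotopyDefect G E β (sub φ' γ) X η a := by
      intro a
      exact (zero_sub _).trans (congrArg _ (congrFun
        (Ops.coe_homotopyDefect G E β (φ'.substitute γ) X η) a))
    have hUdeg : IsHomogeneous G E.toGrading U (-1) := by
      intro a e hae
      rw [hU]
      exact neg_mem (hβ.homotopyDefect (hφ'deg.sub' hγ) hXdeg hη a e hae)
    obtain ⟨u, v, hu, hv, hu0, hv0, huv⟩ := exists_class_and_primitive b E hι (n := n + 1) hUdeg
      (by
        intro a ha
        rw [hU, map_neg, (hvan γ η hγ hη hη0 a fun c hc => hQ c (by lia)).2, neg_zero])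
    have hγu : ∀ a, a.length ≤ n → (γ + u) a = γ a := fun a ha => by
      rw [Ops.add_apply, hu0 a (by lia), add_zero]
    have hηv : ∀ a, a.length ≤ n → (η + v) a = η a := fun a ha => by
      rw [Ops.add_apply, hv0 a (by lia), add_zero]
    refine ⟨⟨γ + u, η + v⟩, ⟨hγ.add hu, hη.add hv, ?_, ?_, ?_⟩, fun a ha => ⟨hγu a ha, hηv a ha⟩⟩
    · exact (hγu [] (by simp)).trans hγ0
    · exact (hηv [] (by simp)).trans hη0
    · intro a ha
      rcases Nat.lt_or_ge n a.length with h | h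
      · have ha : a.length = n + 1 := by lia
        have hne : a ≠ [] := by rintro rfl; simp at ha
        -- As `u` vanishes on shorter words, it enters through the one-block term, to which the
        -- linear part `ι` of `φ'` is applied.
        have hF : sub φ' (γ + u : Ops R M E.Homology) a - sub φ' γ a = ι (u a) := by
          rw [sub_eq_add_of_agree φ' hne fun c hc => hγu c (by lia), add_sub_cancel_left,
            Ops.add_apply, add_sub_cancel_left, hφι]
        have hFlow : ∀ c, c.length < a.length →
            φ'.substitute (γ + u) c = φ'.substitute γ c := fun c hc => by
          rw [Ops.substitute_apply, Ops.substitute_apply]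
          exact sub_congr_right fun e he => hγu e (by lia)
        have := homotopyDefect_add G E (β := β) (F := φ'.substitute γ)
          (F' := φ'.substitute (γ + u)) (X := X) (η := η) (v := v) (a := a)
          ((φ'.substitute_nil γ).trans hφ'0) hη0 hX0 h1 hne
          hFlow fun c hc => hv0 c (by lia)
        refine this.trans ?_
        rw [Ops.substitute_apply, Ops.substitute_apply, hF, add_sub_assoc, ← huv a ha, hU]
        exact add_neg_cancel _
      · rw [← hQ a h]
        exact homotopyDefect_congr _ _ (fun c hc => sub_congr_right fun e he => hγu e (by lia))
          fun c hc => hηv c (by lia)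
  obtain ⟨⟨γ, η⟩, h⟩ := exists_limit S 0 start step
  have hγ : IsHomogeneous G E.homologyGrading γ (-1) := by
    intro a e hae
    obtain ⟨q, hq, hqa⟩ := h a.length (by lia)
    rw [(hqa a (by lia)).1]; exact hq.1 a e hae
  have hη : IsHomogeneous G E.toGrading η 0 := by
    intro a e hae
    obtain ⟨q, hq, hqa⟩ := h a.length (by lia)
    rw [(hqa a (by lia)).2]; exact hq.2.1 a e hae
  have hγ0 : γ [] = 0 := by
    obtain ⟨q, hq, hqa⟩ := h 0 le_rfl
    rw [(hqa [] (by simp)).1]; exact hq.2.2.1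
  have hη0 : η [] = 0 := by
    obtain ⟨q, hq, hqa⟩ := h 0 le_rfl
    rw [(hqa [] (by simp)).2]; exact hq.2.2.2.1
  have hQ : ∀ a, homotopyDefect G E β (sub φ' γ) X η a = 0 := by
    intro a
    obtain ⟨q, hq, hqa⟩ := h a.length (by lia)
    rw [← hq.2.2.2.2 a le_rfl]
    exact homotopyDefect_congr _ _
      (fun c hc => sub_congr_right fun e he => (hqa e (by lia)).1) fun c hc => (hqa c (by lia)).2
  exact ⟨γ, η, hγ0, hη0, hγ, hη, fun a => (hvan γ η hγ hη hη0 a fun c _ => hQ c).1, hQ⟩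

theorem exists_ainfHom_homotopic {D : DGAlgebra R A} {E : DGAlgebra R B} {κ : Type*}
    (b : GradedBasis D.homologyGrading κ) (g : DGHom D E)
    {m : Ops R D.Homology D.Homology} {f : Ops R D.Homology A}
    {m' : Ops R E.Homology E.Homology} {f' : Ops R E.Homology B}
    (h : D.IsHomologyStructure m f) (h' : E.IsHomologyStructure m' f') :
    ∃ F : Ops R D.Homology E.Homology,
      IsAInfHom D.homologyGrading m E.homologyGrading m' F ∧
      (∀ x, F [x] = g.homologyMap x) ∧
      AInfHomotopic D.homologyGrading m E.toGrading E.ops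
        (Ops.comp D.homologyGrading E.homologyGrading f' F)
        (Ops.comp D.homologyGrading D.toGrading (Ops.ofLinear g.toLinearMap) f) := by
  have hι := CycleSection.of_isHomologyStructure h'
  let X : Ops R D.Homology B := (f.susp D.homologyGrading).postcomp g.toLinearMap
  have hX0 : X [] = 0 := (congrArg g.toLinearMap h.isAInfHom.nil).trans (map_zero _)
  have hβ1 : ∀ x, m.susp D.homologyGrading [x] = 0 := fun x => by rw [susp_one, h.minimal]
  obtain ⟨γ, η, hγ0, hη0, hγ, hη, hP, hQ⟩ := exists_factorization D.homologyGrading b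
    (β := m.susp D.homologyGrading) (X := X) (β' := m'.susp E.homologyGrading)
    (φ' := f'.susp E.homologyGrading) hι (fun x => susp_one f' x)
    h.isAInfAlgebra.degree.susp hβ1
    (fun a => by rw [← Ops.coe_insert]; exact h.isAInfAlgebra.stasheff a)
    (fun a e hae => g.map_mem _ _ (h.isAInfHom.degree.susp a e hae)) hX0
    (g.twisting D.homologyGrading (h.isAInfHom.twisting D.homologyGrading D))
    h'.isAInfAlgebra.nil h'.isAInfHom.nil h'.isAInfHom.degree.susp
    (h'.isAInfHom.twisting E.homologyGrading E)
  refine ⟨γ.susp D.homologyGrading, ⟨hγ0, hγ.hasDegree_susp, ?_⟩, ?_,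
    η.susp D.homologyGrading, hη0, hη.hasDegree_susp, ?_⟩
  · intro a
    rw [Ops.susp_susp, Ops.coe_insert]
    exact hP a
  · intro x
    rw [susp_one]
    -- On one letter the homotopy equation reads `f' [γ [x]] - g (f [x]) = d (η [x])`, an equality
    -- of homology classes.
    have hx := hQ [x]
    have hB : insHom D.homologyGrading (m.susp D.homologyGrading) η [x] = 0 :=
      ins_eq_zero_of_first η hβ1 fun b hb => by
        obtain rfl : b = [] := List.eq_nil_of_length_eq_zero (by simpa using hb)
        exact hη0
    change sub _ _ _ - X _ - insHom D.homologyGrading (m.susp D.homologyGrading) η [x] - E.d _ -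
      conv _ E _ _ _ - conv _ E _ _ _ = 0 at hx
    rw [hB] at hx
    have hs : signHom B D.homologyGrading (sub (f'.susp E.homologyGrading) γ) [] = 0 :=
      (sub_nil (f'.susp E.homologyGrading).toFun γ.toFun).trans h'.isAInfHom.nil
    simp only [conv_apply, splitSum_cons, splitSum_nil, hη0, hX0, hs, map_zero,
      LinearMap.zero_apply, add_zero, sub_zero, sub_cons, sub_nil] at hx
    rw [susp_one, sub_eq_zero] at hx
    obtain ⟨hy, ey⟩ := h'.induces_id (γ [x])
    obtain ⟨hz, ez⟩ := h.induces_id x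
    have hfx : X [x] = g.toLinearMap (f [x]) := congrArg g.toLinearMap (susp_one f x)
    have hgz : g.toLinearMap (f [x]) ∈ E.cycles := by
      rw [E.mem_cycles, ← g.map_d, D.mem_cycles.1 hz, map_zero]
    have e1 : g.homologyMap x = E.cls ⟨g.toLinearMap (f [x]), hgz⟩ := by
      conv_lhs => rw [← ez]
      rfl
    rw [e1, ← sub_eq_zero]
    conv_lhs => rw [← ey]
    rw [← map_sub, E.cls_eq_zero]
    refine ⟨η [x], ?_⟩
    rw [← hx, hfx]
    rfl
  · intro a
    have e1 : ((Ops.comp D.homologyGrading E.homologyGrading f'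
        (γ.susp D.homologyGrading)).susp D.homologyGrading) =
        (f'.susp E.homologyGrading).substitute γ := by
      rw [Ops.comp, Ops.susp_susp, Ops.susp_susp]
    -- A strict morphism on the left only sees one-block decompositions, so the composite is
    -- pointwise application of `g`.
    have e2 : ((Ops.comp D.homologyGrading D.toGrading (Ops.ofLinear g.toLinearMap) f).susp
        D.homologyGrading) = X := by
      rw [Ops.comp, Ops.susp_susp]
      ext a
      exact sub_ofLinear_susp D.toGrading g.toLinearMap
        (φ := f.susp D.homologyGrading) h.isAInfHom.nil a
    rw [e1, e2, Ops.susp_susp, mixed_ops D.homologyGrading E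
      (((f'.susp E.homologyGrading).substitute_nil γ).trans h'.isAInfHom.nil) hη0 hX0, Ops.coe_insert]
    have hx := hQ a
    change sub _ _ _ - X _ - insHom D.homologyGrading (m.susp D.homologyGrading) η a - E.d _ -
      conv _ E _ _ _ - conv _ E _ _ _ = 0 at hx
    rw [Pi.add_apply, Pi.add_apply, ← sub_eq_zero, ← hx]
    rw [show ((f'.susp E.homologyGrading).substitute γ).toFun =
        sub (f'.susp E.homologyGrading).toFun γ.toFun from rfl,
      show postHom D.Homology E.d η.toFun a = E.d (η a) from rfl]
    abel

end Transfer

end Functoriality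

/-! ### Morphisms with invertible linear part -/

section Inverse

variable {R : Type*} [CommRing R] {M : Type*} [AddCommGroup M] [Module R M]
  {N : Type*} [AddCommGroup N] [Module R N] {V : Type*} [AddCommGroup V] [Module R V]

theorem length_le_of_flatten {P : Type*} {b : List (List P)} (h : ∀ q ∈ b, q ≠ []) :
    b.length ≤ b.flatten.length := by
  induction b with
  | nil => simp
  | cons q b ih =>
    have h1 := length_pos_of_ne_nil (h q (by simp))
    have h2 := ih fun q hq => h q (by simp [hq])
    simp only [List.length_cons, List.flatten_cons, List.length_append]
    lia

theorem sub_eq_zero_of_vanish {φ : List N → V} {γ : List M → N} {a : List M}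
    (h : ∀ b, b.length ≤ a.length → φ b = 0) : sub φ γ a = 0 := by
  rw [← sub_zero_fun (N := N) (V := V) γ a]
  refine sub_congr fun b hb hq => h _ ?_
  rw [List.length_map, ← hb]
  exact length_le_of_flatten hq

/-- If `φ` vanishes on shorter words, then only the linear part of `γ` matters. -/
theorem sub_eq_map (φ : Ops R N V) {γ : List M → N} {a : List M}
    (h : ∀ b, b.length < a.length → φ b = 0) : sub φ γ a = φ (a.map fun x => γ [x]) := by
  induction a generalizing φ with
  | nil => rw [sub_nil]; rfl
  | cons x l ih =>
    rw [sub_cons, splitSum_eq_first]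
    · exact ih (φ.cons (γ [x])) fun b hb => h (γ [x] :: b) (by simpa using hb)
    · intro p s e hp
      have h' := congrArg List.length e
      simp only [List.length_append] at h'
      have := length_pos_of_ne_nil hp
      exact sub_eq_zero_of_vanish fun b hb => h _ (by simp; lia)

theorem ins_id {σ : M → M} {β : List M → M} (h : β [] = 0) (a : List M) :
    ins σ (Ops.ofLinear (LinearMap.id : M →ₗ[R] M)) β a = β a := by
  cases a with
  | nil => rw [h]; rfl
  | cons x l =>
    rw [ins_cons, splitSum_eq_last, ins_eq_zero, add_zero]
    · rfl
    · intro p q r _ _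
      cases p <;> rfl
    · intro p s _ hs
      cases s with
      | nil => exact absurd rfl hs
      | cons y s => rfl

theorem sub_id_right (φ : Ops R M V) (a : List M) :
    sub φ (Ops.ofLinear (LinearMap.id : M →ₗ[R] M)) a = φ a := by
  induction a generalizing φ with
  | nil => exact sub_nil _ _
  | cons x l ih =>
    rw [sub_cons, splitSum_eq_first]
    · exact ih (φ.cons x)
    · intro p s _ hp
      cases p with
      | nil => exact absurd rfl hp
      | cons y p =>
        have : ∀ r, φ (Ops.ofLinear (LinearMap.id : M →ₗ[R] M) (x :: y :: p) :: r) = 0 :=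
          fun r => φ.map_zero_at [] r
        simp only [this, sub_zero_fun]

theorem sub_id_left {γ : List M → N} (h : γ [] = 0) (a : List M) :
    sub (Ops.ofLinear (LinearMap.id : N →ₗ[R] N)) γ a = γ a := by
  rcases eq_or_ne a [] with rfl | ha
  · rw [sub_nil, h]; rfl
  · exact sub_eq_first γ rfl (fun _ _ _ => rfl) ha

/-- Successive approximation: the error `id - κ ∘ γ` is added to `κ`. On the first length where it
is nonzero it sees only the linear part of `γ`, which is the identity, so it cancels itself there.
-/
theorem exists_left_inverse {G : Grading R M} {γ : Ops R M M} (hγ : IsHomogeneous G G γ (-1))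
    (h0 : γ [] = 0) (h1 : ∀ x, γ [x] = x) :
    ∃ κ : Ops R M M, IsHomogeneous G G κ (-1) ∧ κ [] = 0 ∧ (∀ x, κ [x] = x) ∧
      κ.substitute γ = Ops.ofLinear LinearMap.id := by
  have hid : IsHomogeneous G G (Ops.ofLinear (LinearMap.id : M →ₗ[R] M)) (-1) :=
    .ofLinear fun _ _ hx => hx
  -- The second entry of the pair is idle; `exists_limit` is stated for pairs.
  let S : ℕ → Ops R M M × Ops R M M → Prop := fun n p =>
    IsHomogeneous G G p.1 (-1) ∧ p.1 [] = 0 ∧ (∀ x, p.1 [x] = x) ∧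
      ∀ a, a.length ≤ n → sub p.1 γ a = Ops.ofLinear (LinearMap.id : M →ₗ[R] M) a
  have start : ∃ p, S 1 p := by
    refine ⟨⟨Ops.ofLinear LinearMap.id, 0⟩, hid, rfl, fun _ => rfl, ?_⟩
    intro a ha
    rw [sub_id_left h0]
    rcases a with _ | ⟨x, _ | ⟨y, a⟩⟩
    · exact h0
    · exact h1 x
    · simp at ha
  have step : ∀ n, 1 ≤ n → ∀ p, S n p → ∃ q, S (n + 1) q ∧
      ∀ a, a.length ≤ n → q.1 a = p.1 a ∧ q.2 a = p.2 a := by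
    rintro n hn ⟨κ, z⟩ ⟨hκ, hκ0, hκ1, hκS⟩
    have hagree : ∀ a : List M, a.length ≤ n →
        (Ops.ofLinear LinearMap.id - κ.substitute γ : Ops R M M) a = 0 := by
      intro a ha
      rw [Ops.sub_apply, Ops.substitute_apply, hκS a ha, sub_self]
    have hκ' : ∀ a : List M, a.length ≤ n →
        (κ + (Ops.ofLinear LinearMap.id - κ.substitute γ) : Ops R M M) a = κ a := by
      intro a ha
      rw [Ops.add_apply, hagree a ha, add_zero]
    refine ⟨⟨κ + (Ops.ofLinear LinearMap.id - κ.substitute γ), z⟩,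
      ⟨hκ.add (hid.sub (hκ.sub' hγ)), (hκ' [] (by simp)).trans hκ0,
        fun x => (hκ' [x] (by simpa using hn)).trans (hκ1 x), ?_⟩, fun a ha => ⟨hκ' a ha, rfl⟩⟩
    intro a ha
    have e : sub (κ + (Ops.ofLinear LinearMap.id - κ.substitute γ) : Ops R M M) γ a =
      sub κ γ a + sub (Ops.ofLinear LinearMap.id - κ.substitute γ : Ops R M M) γ a :=
      sub_add_fun _ _ _ _
    refine e.trans ?_
    rw [sub_eq_map _ fun b hb => hagree b (by lia)]
    simp only [h1, List.map_id']
    rw [Ops.sub_apply, Ops.substitute_apply]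
    abel
  obtain ⟨⟨κ, z⟩, h⟩ := exists_limit S 1 start step
  refine ⟨κ, ?_, ?_, ?_, ?_⟩
  · intro a e hae
    obtain ⟨q, hq, hqa⟩ := h (a.length + 1) (by lia)
    rw [(hqa a (by lia)).1]; exact hq.1 a e hae
  · obtain ⟨q, hq, hqa⟩ := h 1 le_rfl
    rw [(hqa [] (by simp)).1]; exact hq.2.1
  · intro x
    obtain ⟨q, hq, hqa⟩ := h 1 le_rfl
    rw [(hqa [x] (by simp)).1]; exact hq.2.2.1 x
  · ext a
    obtain ⟨q, hq, hqa⟩ := h (a.length + 1) (by lia)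
    rw [← hq.2.2.2 a (by lia), Ops.substitute_apply]
    refine sub_congr fun b hb hne => (hqa _ ?_).1
    rw [List.length_map]
    have := length_le_of_flatten hne
    rw [hb] at this
    lia

/-- The left inverse `κ` has a left inverse `l` in turn, and associativity gives `l = l ∘ (κ ∘ γ) =
(l ∘ κ) ∘ γ = γ`. -/
theorem exists_inverse {G : Grading R M} {γ : Ops R M M} (hγ : IsHomogeneous G G γ (-1))
    (h0 : γ [] = 0) (h1 : ∀ x, γ [x] = x) :
    ∃ κ : Ops R M M, IsHomogeneous G G κ (-1) ∧ κ [] = 0 ∧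
      κ.substitute γ = Ops.ofLinear LinearMap.id ∧ γ.substitute κ = Ops.ofLinear LinearMap.id := by
  obtain ⟨κ, hκ, hκ0, hκ1, hκγ⟩ := exists_left_inverse hγ h0 h1
  obtain ⟨l, -, hl0, -, hlκ⟩ := exists_left_inverse hκ hκ0 hκ1
  have : l = γ := by
    have e1 : sub (sub l κ) γ = γ := by
      have : sub l κ = (Ops.ofLinear (LinearMap.id : M →ₗ[R] M)).toFun := congrArg Ops.toFun hlκ
      rw [this]; exact funext (sub_id_left h0)
    have e2 : sub l (sub κ γ) = l := by
      have : sub κ γ = (Ops.ofLinear (LinearMap.id : M →ₗ[R] M)).toFun := congrArg Ops.toFun hκγ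
      rw [this]; exact funext (sub_id_right l)
    ext a
    rw [← e2, ← sub_sub_fun, e1]
  exact ⟨κ, hκ, hκ0, hκγ, this ▸ hlκ⟩

theorem Ops.susp_ofLinear_id (G : Grading R M) :
    (Ops.ofLinear (LinearMap.id : M →ₗ[R] M)).susp G = Ops.ofLinear LinearMap.id := by
  ext a
  rcases a with _ | ⟨x, _ | ⟨y, a⟩⟩ <;> simp [Ops.susp, Ops.twist, Ops.ofLinear]

/-- A morphism of `A_∞`-algebras whose linear part is the identity is an isomorphism. -/
theorem IsAInfHom.isAInfIso {G : Grading R M} {m m' : Ops R M M} {f : Ops R M M}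
    (hm : m [] = 0) (hm' : m' [] = 0) (h : IsAInfHom G m G m' f) (h1 : ∀ x, f [x] = x) :
    IsAInfIso G m G m' f := by
  obtain ⟨κ, hκ, hκ0, hκγ, hγκ⟩ := exists_inverse h.degree.susp h.nil
    (fun x => (susp_one f x).trans (h1 x))
  refine ⟨h, κ.susp G, ⟨hκ0, hκ.hasDegree_susp, ?_⟩, ?_, ?_⟩
  · rw [Ops.susp_susp]
    have hσ : ∀ a, -G.parity (f.susp G a) = f.susp G (a.map fun b => -G.parity b) := fun a => by
      rw [IsHomogeneous.neg_parity_apply h.degree.susp]; simp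
    have hrel : ∀ a, ins (fun b => -G.parity b) (f.susp G) (m.susp G) a =
        sub (m'.susp G) (f.susp G) a := fun a => by
      rw [← Ops.insert_apply]; exact h.rel a
    -- The relation for `κ` is tested after composition with `f`: the morphism relation of `f` moves
    -- the coderivation of `m'` to that of `m`, and `κ ∘ f` is the identity.
    have e1 : ∀ a, sub (κ.insert G (m'.susp G)) (f.susp G) a = m.susp G a := by
      intro a
      have e := ins_sub_sub_sub_ins _ (fun b => -G.parity b) κ (f.susp G) (m.susp G) (m'.susp G) hσ hm' a
        fun b _ => hrel b
      have hz : κ [0] = 0 := κ.map_zero_at [] []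
      have h2 : sub κ (f.susp G) = (Ops.ofLinear (LinearMap.id : M →ₗ[R] M)).toFun :=
        congrArg Ops.toFun hκγ
      rw [hrel, sub_self, hz, sub_eq_zero, h2] at e
      rw [Ops.coe_insert]
      refine e.symm.trans ?_
      exact ins_id (R := R) (β := m.susp G) hm a
    have e2 : ∀ a, sub ((m.susp G).substitute κ) (f.susp G) a = m.susp G a := by
      intro a
      change sub (sub (m.susp G) κ) (f.susp G) a = _
      rw [sub_sub_fun]
      have h2 : sub κ (f.susp G) = (Ops.ofLinear (LinearMap.id : M →ₗ[R] M)).toFun :=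
        congrArg Ops.toFun hκγ
      rw [h2, sub_id_right]
    -- Composition with `f` can be cancelled, because `κ` is also a right inverse.
    have e3 : ∀ φ : Ops R M M, sub (sub φ (f.susp G)) κ = φ := by
      intro φ
      funext a
      rw [sub_sub_fun]
      have h2 : sub (f.susp G) κ = (Ops.ofLinear (LinearMap.id : M →ₗ[R] M)).toFun :=
        congrArg Ops.toFun hγκ
      rw [h2, sub_id_right]
    intro a
    rw [← e3 (κ.insert G (m'.susp G)), ← e3 ((m.susp G).substitute κ), funext e1, funext e2]
  · rw [Ops.comp, Ops.susp_susp, hκγ, Ops.susp_ofLinear_id]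
  · rw [Ops.comp, Ops.susp_susp, hγκ, Ops.susp_ofLinear_id]

end Inverse

/-! ### A Künneth formula for pure cycles -/

section Kunneth

open TensorProduct

theorem tmap_tmap {R : Type*} [CommRing R] {M₁ M₂ M₃ N₁ N₂ N₃ : Type*}
    [AddCommGroup M₁] [Module R M₁] [AddCommGroup M₂] [Module R M₂] [AddCommGroup M₃] [Module R M₃]
    [AddCommGroup N₁] [Module R N₁] [AddCommGroup N₂] [Module R N₂] [AddCommGroup N₃] [Module R N₃]
    (f : M₂ →ₗ[R] M₃) (g : N₂ →ₗ[R] N₃) (f' : M₁ →ₗ[R] M₂) (g' : N₁ →ₗ[R] N₂) (x : M₁ ⊗[R] N₁) :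
    map f g (map f' g' x) = map (f ∘ₗ f') (g ∘ₗ g') x := by
  rw [TensorProduct.map_comp]; rfl

theorem tmap_zero_left {R : Type*} [CommRing R] {M₁ M₂ N₁ N₂ : Type*}
    [AddCommGroup M₁] [Module R M₁] [AddCommGroup M₂] [Module R M₂]
    [AddCommGroup N₁] [Module R N₁] [AddCommGroup N₂] [Module R N₂]
    (g : N₁ →ₗ[R] N₂) (x : M₁ ⊗[R] N₁) : map (0 : M₁ →ₗ[R] M₂) g x = 0 := by
  rw [TensorProduct.map_zero_left]; rfl

theorem tmap_zero_right {R : Type*} [CommRing R] {M₁ M₂ N₁ N₂ : Type*}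
    [AddCommGroup M₁] [Module R M₁] [AddCommGroup M₂] [Module R M₂]
    [AddCommGroup N₁] [Module R N₁] [AddCommGroup N₂] [Module R N₂]
    (f : M₁ →ₗ[R] M₂) (x : M₁ ⊗[R] N₁) : map f (0 : N₁ →ₗ[R] N₂) x = 0 := by
  rw [TensorProduct.map_zero_right]; rfl

/-- For a pure exact sequence `Z → A → B`, the kernel of a map `δ` of the second tensor factor is
preserved by `A ⊗ L → B ⊗ L`. -/
theorem exists_lift_of_pure {R : Type*} [CommRing R] {Z A B L : Type*}
    [AddCommGroup Z] [Module R Z] [AddCommGroup A] [Module R A] [AddCommGroup B] [Module R B]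
    [AddCommGroup L] [Module R L] {i : Z →ₗ[R] A} {p : A →ₗ[R] B} (hip : Function.Exact i p)
    (hp : Function.Surjective p) (δ : L →ₗ[R] L)
    (hpure : Function.Injective (i.rTensor (L ⧸ LinearMap.range δ)))
    (u : B ⊗[R] L) (hu : map LinearMap.id δ u = 0) :
    ∃ y : A ⊗[R] L, map p LinearMap.id y = u ∧ map LinearMap.id δ y = 0 := by
  obtain ⟨y, hy⟩ := LinearMap.rTensor_surjective L hp u
  have hy' : map p LinearMap.id y = u := hy
  have h1 : (p.rTensor L) (map LinearMap.id δ y) = 0 := by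
    have : map p LinearMap.id (map LinearMap.id δ y) = map LinearMap.id δ (map p LinearMap.id y) := by
      rw [tmap_tmap, tmap_tmap]; rfl
    rw [hy', hu] at this
    exact this
  obtain ⟨w, hw⟩ := (rTensor_exact L hip hp _).1 h1
  have hw' : map i LinearMap.id w = map LinearMap.id δ y := hw
  -- The error `δ y` comes from `w` in `Z ⊗ L`. Purity for the module `L / im δ` shows that `w`
  -- itself is in the image of `δ`, so `y` can be corrected within `Z ⊗ L`.
  have h2 : ((LinearMap.range δ).mkQ.lTensor Z) w = 0 := by
    apply hpure
    rw [map_zero]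
    have : map i LinearMap.id (map LinearMap.id (LinearMap.range δ).mkQ w) =
        map LinearMap.id (LinearMap.range δ).mkQ (map i LinearMap.id w) := by
      rw [tmap_tmap, tmap_tmap]; rfl
    refine this.trans ?_
    rw [hw', tmap_tmap]
    have hz : (LinearMap.range δ).mkQ ∘ₗ δ = 0 := LinearMap.range_mkQ_comp δ
    rw [hz, tmap_zero_right]
  have hex : Function.Exact δ (LinearMap.range δ).mkQ := by
    rw [LinearMap.exact_iff, Submodule.ker_mkQ]
  obtain ⟨w', hw2⟩ := (lTensor_exact Z hex (Submodule.mkQ_surjective _) _).1 h2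
  have hw2' : map LinearMap.id δ w' = w := hw2
  refine ⟨y - map i LinearMap.id w', ?_, ?_⟩
  · have hz : p ∘ₗ i = 0 := LinearMap.ext fun z => hip.apply_apply_eq_zero z
    rw [map_sub, hy', tmap_tmap, hz, tmap_zero_left, sub_zero]
  · rw [map_sub, sub_eq_zero, ← hw', ← hw2', tmap_tmap, tmap_tmap]; rfl

variable {R : Type u} [CommRing R] {A : Type v} [AddCommGroup A] [Module R A]

/-- The differential of the tensor product of `A` with a module with a differential `δ`. -/
noncomputable def tensorD {L : Type*} [AddCommGroup L] [Module R L] (D : DGAlgebra R A)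
    (δ : L →ₗ[R] L) : A ⊗[R] L →ₗ[R] A ⊗[R] L :=
  map D.d LinearMap.id + map (-D.parity) δ

theorem tensorD_apply {L : Type*} [AddCommGroup L] [Module R L] (D : DGAlgebra R A)
    (δ : L →ₗ[R] L) (y : A ⊗[R] L) :
    tensorD D δ y = map D.d LinearMap.id y + map (-D.parity) δ y := rfl

/-- `N` with zero differential is the homology of `(L, δ)` by means of `j`. -/
structure IsFormalModel {N L : Type*} [AddCommGroup N] [Module R N] [AddCommGroup L] [Module R L]
    (j : N →ₗ[R] L) (δ : L →ₗ[R] L) : Prop where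
  comp_self : δ ∘ₗ δ = 0
  comp : δ ∘ₗ j = 0
  injective : ∀ x z, j x = δ z → x = 0
  surjective : ∀ y, δ y = 0 → ∃ x z, y = j x + δ z

/-- The two homology conditions say that `N → L / im δ` is injective and that `N × L → ker δ` is
onto. Flatness of `H` preserves the former and the exactness that defines `ker δ`; surjectivity is
always preserved. -/
theorem IsFormalModel.lTensor {H N L : Type*} [AddCommGroup H] [Module R H] [Module.Free R H]
    [AddCommGroup N] [Module R N] [AddCommGroup L] [Module R L]
    {j : N →ₗ[R] L} {δ : L →ₗ[R] L} (h : IsFormalModel j δ) :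
    IsFormalModel (map (LinearMap.id : H →ₗ[R] H) j) (map (LinearMap.id : H →ₗ[R] H) δ) where
  comp_self := by rw [← map_comp, h.comp_self, map_zero_right]
  comp := by rw [← map_comp, h.comp, map_zero_right]
  injective x z hxz := by
    let q : N →ₗ[R] L ⧸ LinearMap.range δ := (LinearMap.range δ).mkQ ∘ₗ j
    have hq : Function.Injective q := by
      rw [injective_iff_map_eq_zero]
      intro x hx
      obtain ⟨z, hz⟩ := (Submodule.Quotient.mk_eq_zero _).1 hx
      exact h.injective x z hz.symm
    have h1 := Module.Flat.lTensor_preserves_injective_linearMap (M := H) q hq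
    apply h1
    rw [_root_.map_zero]
    have h2 : map (LinearMap.id : H →ₗ[R] H) (LinearMap.range δ).mkQ (map LinearMap.id j x) = 0 := by
      rw [hxz, tmap_tmap, LinearMap.range_mkQ_comp, tmap_zero_right]
    rw [tmap_tmap] at h2
    exact h2
  surjective y hy := by
    let g : N × L →ₗ[R] LinearMap.ker δ := (j.coprod δ).codRestrict _ (by
      rintro ⟨x, z⟩
      have h1 : δ (j x) = 0 := LinearMap.congr_fun h.comp x
      have h2 : δ (δ z) = 0 := LinearMap.congr_fun h.comp_self z
      simp [h1, h2])
    have hg : Function.Surjective g := by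
      rintro ⟨y, hy⟩
      obtain ⟨x, z, e⟩ := h.surjective y hy
      exact ⟨(x, z), Subtype.ext e.symm⟩
    have hex : Function.Exact (LinearMap.ker δ).subtype δ := by
      rw [LinearMap.exact_iff, Submodule.range_subtype]
    obtain ⟨y', hy'⟩ := (Module.Flat.lTensor_exact H hex y).1 hy
    obtain ⟨t, rfl⟩ := LinearMap.lTensor_surjective H hg y'
    refine ⟨map LinearMap.id (LinearMap.fst R N L) t, map LinearMap.id (LinearMap.snd R N L) t, ?_⟩
    rw [tmap_tmap, tmap_tmap, ← hy', ← LinearMap.add_apply, LinearMap.id_comp, ← map_add_right]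
    have : (LinearMap.ker δ).subtype ∘ₗ g = j ∘ₗ LinearMap.fst R N L + δ ∘ₗ LinearMap.snd R N L := by
      ext <;> simp [g]
    rw [← this]
    change map LinearMap.id _ (map LinearMap.id g t) = _
    rw [tmap_tmap]
    rfl

/-- Tensoring a formal model with the homology of `A`, when the cycles of `A` are pure. -/
theorem IsFormalModel.tensor {D : DGAlgebra R A} (hpure : D.HasPureCycles)
    [Module.Free R D.Homology] {ι : D.Homology →ₗ[R] A} (hι : CycleSection D ι)
    {N L : Type (max u v)} [AddCommGroup N] [Module R N] [AddCommGroup L] [Module R L]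
    {j : N →ₗ[R] L} {δ : L →ₗ[R] L} (h : IsFormalModel j δ) :
    IsFormalModel (map ι j) (tensorD D δ) := by
  set S : A →ₗ[R] A := -D.parity with hS
  have hSS : S ∘ₗ S = LinearMap.id := LinearMap.ext fun a => by simp [hS, D.parity_parity]
  have hdS : D.d ∘ₗ S = -(S ∘ₗ D.d) := LinearMap.ext fun a => by simp [hS, D.parity_d]
  have hdd : D.d ∘ₗ D.d = 0 := LinearMap.ext D.d_d
  have hdι : D.d ∘ₗ ι = 0 := LinearMap.ext hι.d_apply
  have hT : ∀ y, tensorD D δ y = map D.d LinearMap.id y + map S δ y := fun _ => rfl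
  have hTT : ∀ y, tensorD D δ (tensorD D δ y) = 0 := by
    intro y
    simp only [hT, map_add, tmap_tmap, hdd, h.comp_self, tmap_zero_left, tmap_zero_right, hdS]
    have : map (-(S ∘ₗ D.d)) δ y = - map (S ∘ₗ D.d) δ y := by
      rw [← neg_one_smul R, map_smul_left, LinearMap.smul_apply, neg_one_smul]
    simp only [LinearMap.id_comp, LinearMap.comp_id, this]
    abel
  -- the cycles, the boundaries and the splitting of the cycles
  let i : D.cycles →ₗ[R] A := D.cycles.subtype
  let p : A →ₗ[R] LinearMap.range D.d := D.d.rangeRestrict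
  have hB : LinearMap.range D.d ≤ D.cycles := by
    rintro _ ⟨y, rfl⟩; exact D.mem_cycles.2 (D.d_d y)
  let k : LinearMap.range D.d →ₗ[R] D.cycles := Submodule.inclusion hB
  let q : D.Homology →ₗ[R] D.cycles := ι.codRestrict _ fun x => (hι.cls_eq x).1
  have hiq : i ∘ₗ q = ι := rfl
  have hq : ∀ x, D.cls (q x) = x := fun x => (hι.cls_eq x).2
  let r : D.cycles →ₗ[R] LinearMap.range D.d :=
    (i ∘ₗ (LinearMap.id - q ∘ₗ D.cls)).codRestrict _ (by
      intro z
      have : D.cls (z - q (D.cls z)) = 0 := by rw [map_sub, hq, sub_self]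
      exact D.cls_eq_zero.1 this)
  have hsplit : q ∘ₗ D.cls + k ∘ₗ r = LinearMap.id := by
    refine LinearMap.ext fun z => Subtype.ext ?_
    change ι (D.cls z) + ((z : A) - ι (D.cls z)) = z
    abel
  have hclsk : D.cls ∘ₗ k = 0 := by
    ext ⟨_, y, rfl⟩
    exact D.cls_eq_zero.2 ⟨y, rfl⟩
  have hrk : r ∘ₗ k = LinearMap.id := by
    have hk : Function.Injective k := Submodule.inclusion_injective hB
    ext b
    have := LinearMap.congr_fun hsplit (k b)
    simp only [LinearMap.add_apply, LinearMap.comp_apply] at this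
    rw [show D.cls (k b) = 0 from LinearMap.congr_fun hclsk b, map_zero, zero_add] at this
    rw [LinearMap.comp_apply, hk this]
    rfl
  have hikp : i ∘ₗ k ∘ₗ p = D.d := rfl
  have hpd : p ∘ₗ D.d = 0 := by ext a; exact D.d_d a
  have hpSd : p ∘ₗ S ∘ₗ D.d = 0 := by
    ext a
    have := LinearMap.congr_fun hdS (D.d a)
    simp only [LinearMap.comp_apply, LinearMap.neg_apply, D.d_d, map_zero, neg_zero] at this
    exact this
  have hip : Function.Exact i p := by
    intro a
    rw [show (p a = 0) ↔ D.d a = 0 from Subtype.ext_iff]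
    refine ⟨fun ha => ⟨⟨a, D.mem_cycles.2 ha⟩, rfl⟩, ?_⟩
    rintro ⟨z, rfl⟩
    exact D.mem_cycles.1 z.2
  have hp : Function.Surjective p := LinearMap.surjective_rangeRestrict _
  have hinj : ∀ (K : Type (max u v)) [AddCommGroup K] [Module R K],
      Function.Injective (i.rTensor K) := fun K _ _ =>
    (LinearMap.lTensor_inj_iff_rTensor_inj K i).1 (hpure K)
  -- Purity is used twice: for this lifting of `δ`-cycles along `A ⊗ L → im d ⊗ L`, and below for
  -- the injectivity of `Z(A) ⊗ L → A ⊗ L`.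
  have hlift := exists_lift_of_pure hip hp δ (hinj _)
  have hSZ : ∀ z ∈ D.cycles, S z ∈ D.cycles := by
    intro z hz
    have := LinearMap.congr_fun hdS z
    rw [D.mem_cycles] at hz ⊢
    simpa [hz] using this
  let SZ : D.cycles →ₗ[R] D.cycles := S.restrict hSZ
  have hiSZ : i ∘ₗ SZ = S ∘ₗ i := rfl
  have hSZSZ : SZ ∘ₗ SZ = LinearMap.id := by
    ext z; exact LinearMap.congr_fun hSS z
  have hclsSZk : D.cls ∘ₗ SZ ∘ₗ k = 0 := by
    ext ⟨_, y, rfl⟩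
    refine D.cls_eq_zero.2 ⟨- S y, ?_⟩
    have := LinearMap.congr_fun hdS y
    simp only [LinearMap.comp_apply, LinearMap.neg_apply] at this
    rw [map_neg, this, neg_neg]
    rfl
  have hi : ∀ y : D.cycles ⊗[R] L, map i LinearMap.id y = 0 → y = 0 := fun y hy =>
    hinj L (hy.trans (map_zero _).symm)
  have hexact : ∀ y : A ⊗[R] L, map p LinearMap.id y = 0 →
      ∃ v : D.cycles ⊗[R] L, map i LinearMap.id v = y := fun y hy =>
    (rTensor_exact L hip hp y).1 hy
  have hkp : ∀ y : A ⊗[R] L, map D.d (LinearMap.id : L →ₗ[R] L) y =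
      map i LinearMap.id (map k LinearMap.id (map p LinearMap.id y)) := by
    intro y; rw [tmap_tmap, tmap_tmap]; rfl
  refine ⟨LinearMap.ext hTT, ?_, ?_, ?_⟩
  · ext x y
    have h1 : δ (j y) = 0 := LinearMap.congr_fun h.comp y
    simp [hT, hι.d_apply, h1]
  · intro x z hxz
    -- Applying `p ∘ S` to the first factor kills everything of the form `ι` or `d` and leaves only
    -- the `δ`-term, as `S` is an involution.
    have hu : map LinearMap.id δ (map p (LinearMap.id : L →ₗ[R] L) z) = 0 := by
      have h1 := congrArg (map (p ∘ₗ S) (LinearMap.id : L →ₗ[R] L)) hxz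
      have hpSι : p ∘ₗ S ∘ₗ ι = 0 := by
        refine LinearMap.ext fun x => Subtype.ext ?_
        have := LinearMap.congr_fun hdS (ι x)
        simp only [LinearMap.comp_apply, LinearMap.neg_apply, hι.d_apply, map_zero,
          neg_zero] at this
        exact this
      rw [hT, map_add] at h1
      simp only [tmap_tmap, LinearMap.comp_assoc, hpSι, hpSd, hSS, tmap_zero_left, zero_add,
        LinearMap.comp_id, LinearMap.id_comp] at h1 ⊢
      exact h1.symm
    -- Thus `z` is a `δ`-cycle plus an element `v` of cycles tensor `L`, and the equation can be
    -- read in cycles tensor `L`, then projected to homology tensor `L`.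
    obtain ⟨z2, hz2, hz2'⟩ := hlift _ hu
    obtain ⟨v, hv⟩ := hexact (z - z2) (by rw [map_sub, hz2, sub_self])
    have h1 : map S δ z = map i LinearMap.id (map SZ δ v) := by
      have h2 : map S δ z2 = map S LinearMap.id (map LinearMap.id δ z2) := by
        rw [tmap_tmap]; rfl
      rw [tmap_tmap, hiSZ, LinearMap.id_comp,
        show z = z2 + map i LinearMap.id v by rw [hv]; abel, map_add, h2, hz2', map_zero, zero_add,
        tmap_tmap]
      rfl
    have h3 : map q j x = map k LinearMap.id (map p LinearMap.id z) + map SZ δ v := by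
      rw [← sub_eq_zero]
      apply hi
      rw [map_sub, map_add, ← h1, ← hkp, ← hT, ← hxz, tmap_tmap, hiq]
      exact sub_self _
    have h4 := congrArg (map D.cls (LinearMap.id : L →ₗ[R] L)) h3
    have hcq : D.cls ∘ₗ q = LinearMap.id := LinearMap.ext hq
    rw [map_add, tmap_tmap, tmap_tmap, tmap_tmap, hclsk, hcq] at h4
    simp only [tmap_tmap, LinearMap.zero_comp, tmap_zero_left, zero_add, LinearMap.id_comp] at h4
    refine h.lTensor.injective x (map (D.cls ∘ₗ SZ) LinearMap.id v) ?_
    rw [h4, tmap_tmap]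
    rfl
  · intro y hy
    have hu : map LinearMap.id δ (map p (LinearMap.id : L →ₗ[R] L) y) = 0 := by
      have h1 := congrArg (map (p ∘ₗ S) (LinearMap.id : L →ₗ[R] L)) hy
      rw [hT, map_add, map_zero] at h1
      simp only [tmap_tmap, LinearMap.comp_assoc, hpSd, hSS, tmap_zero_left, zero_add,
        LinearMap.comp_id, LinearMap.id_comp] at h1 ⊢
      exact h1
    obtain ⟨y2, hy2, hy2'⟩ := hlift _ hu
    obtain ⟨v, hv⟩ := hexact (y - y2) (by rw [map_sub, hy2, sub_self])
    have h1 : map S δ y = map i LinearMap.id (map SZ δ v) := by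
      have h2 : map S δ y2 = map S LinearMap.id (map LinearMap.id δ y2) := by
        rw [tmap_tmap]; rfl
      rw [tmap_tmap, hiSZ, LinearMap.id_comp,
        show y = y2 + map i LinearMap.id v by rw [hv]; abel, map_add, h2, hy2', map_zero, zero_add,
        tmap_tmap]
      rfl
    have h3 : map k LinearMap.id (map p LinearMap.id y) + map SZ δ v = 0 := by
      apply hi
      rw [map_add, ← h1, ← hkp, ← hT, hy]
    -- Passing to homology classes removes the boundary term of `h3`.
    have h4 : map D.cls δ v = 0 := by
      have := congrArg (map (D.cls ∘ₗ SZ) (LinearMap.id : L →ₗ[R] L)) h3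
      have a1 : ∀ z, map (D.cls ∘ₗ SZ) (LinearMap.id : L →ₗ[R] L) (map k LinearMap.id z) = 0 := by
        intro z; rw [tmap_tmap, LinearMap.comp_assoc, hclsSZk, tmap_zero_left]
      have a2 : map (D.cls ∘ₗ SZ) (LinearMap.id : L →ₗ[R] L) (map SZ δ v) = map D.cls δ v := by
        rw [tmap_tmap, LinearMap.comp_assoc, hSZSZ]; rfl
      rw [map_add, map_zero, a1, a2, zero_add] at this
      exact this
    -- The choice of `w` makes the boundary part of `y` equal to that of `tensorD D δ w`, so the
    -- difference has first factors in the cycles.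
    obtain ⟨w, hw⟩ := LinearMap.rTensor_surjective L hp (map r LinearMap.id v)
    have hw' : map p LinearMap.id w = map r LinearMap.id v := hw
    have h5 : map p LinearMap.id (y - tensorD D δ w) = 0 := by
      have hkinj : ∀ b : LinearMap.range D.d ⊗[R] L, map k LinearMap.id b = 0 → b = 0 := by
        intro b hb
        have := congrArg (map r (LinearMap.id : L →ₗ[R] L)) hb
        rw [tmap_tmap, hrk, map_zero] at this
        simpa using this
      apply hkinj
      apply hi
      rw [← hkp, map_sub, hT, map_add, tmap_tmap, tmap_tmap, hdd, tmap_zero_left, zero_add, hdS]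
      have e1 : map (-(S ∘ₗ D.d)) δ w = - map (S ∘ₗ i ∘ₗ k) δ (map p LinearMap.id w) := by
        rw [tmap_tmap, ← neg_one_smul R (S ∘ₗ D.d), map_smul_left, LinearMap.smul_apply,
          neg_one_smul]
        rfl
      have e2 : map D.d (LinearMap.id : L →ₗ[R] L) y = - map S δ y := by
        rw [eq_neg_iff_add_eq_zero, ← hT, hy]
      have e3 : map S δ y = map (S ∘ₗ i) δ v := by
        rw [h1, tmap_tmap, hiSZ]; rfl
      have e4 : map (S ∘ₗ i) δ v = map (S ∘ₗ i ∘ₗ q) LinearMap.id (map D.cls δ v) +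
          map (S ∘ₗ i ∘ₗ k) δ (map r LinearMap.id v) := by
        rw [tmap_tmap, tmap_tmap, LinearMap.id_comp, LinearMap.comp_id, ← LinearMap.add_apply,
          ← map_add_left, ← LinearMap.comp_assoc, ← LinearMap.comp_assoc, LinearMap.comp_assoc _ q,
          LinearMap.comp_assoc _ k, ← LinearMap.comp_add, hsplit, LinearMap.comp_id]
      rw [LinearMap.id_comp, e1, hw', e2, e3, e4, h4, map_zero, zero_add]
      abel
    obtain ⟨v', hv'⟩ := hexact _ h5
    have h6 : map LinearMap.id δ v' = 0 := by
      have e1 : tensorD D δ (y - tensorD D δ w) = 0 := by rw [map_sub, hy, hTT, sub_zero]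
      rw [← hv', hT, tmap_tmap, tmap_tmap] at e1
      have e2 : D.d ∘ₗ i = 0 := LinearMap.ext fun z => D.mem_cycles.1 z.2
      rw [e2, tmap_zero_left, zero_add, ← hiSZ, LinearMap.comp_id] at e1
      have e3 : map SZ δ v' = 0 := by
        apply hi; rw [tmap_tmap]; exact e1
      have := congrArg (map SZ (LinearMap.id : L →ₗ[R] L)) e3
      rw [tmap_tmap, hSZSZ, map_zero] at this
      exact this
    -- The element `v'` splits into a boundary part, which is `tensorD D δ w'`, and a homology part,
    -- which is handled by the formal model tensored with `H(A)`.
    obtain ⟨w', hw1, hw2⟩ := hlift (map r LinearMap.id v') (by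
      have : map LinearMap.id δ (map r LinearMap.id v') =
          map r LinearMap.id (map LinearMap.id δ v') := by
        rw [tmap_tmap, tmap_tmap]; rfl
      rw [this, h6, map_zero])
    obtain ⟨x, t, hxt⟩ := (h.lTensor (H := D.Homology)).surjective (map D.cls LinearMap.id v') (by
      have : map LinearMap.id δ (map D.cls LinearMap.id v') =
          map D.cls LinearMap.id (map LinearMap.id δ v') := by
        rw [tmap_tmap, tmap_tmap]; rfl
      rw [this, h6, map_zero])
    refine ⟨x, w + w' + map (S ∘ₗ ι) LinearMap.id t, ?_⟩
    have e1 : tensorD D δ w' = map (i ∘ₗ k) LinearMap.id (map r LinearMap.id v') := by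
      have : map S δ w' = map S LinearMap.id (map LinearMap.id δ w') := by rw [tmap_tmap]; rfl
      rw [hT, this, hw2, map_zero, add_zero, hkp, hw1, tmap_tmap, tmap_tmap, tmap_tmap]
      rfl
    have e2 : tensorD D δ (map (S ∘ₗ ι) LinearMap.id t) = map ι δ t := by
      rw [hT, tmap_tmap, tmap_tmap, ← LinearMap.comp_assoc, ← LinearMap.comp_assoc, hSS, hdS,
        LinearMap.neg_comp, LinearMap.comp_assoc, hdι, LinearMap.comp_zero, neg_zero,
        tmap_zero_left, zero_add]
      rfl
    have e3 : map i LinearMap.id v' = map ι LinearMap.id (map D.cls (LinearMap.id : L →ₗ[R] L) v') +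
        map (i ∘ₗ k) LinearMap.id (map r LinearMap.id v') := by
      rw [tmap_tmap, tmap_tmap, ← LinearMap.add_apply, ← map_add_left, ← hiq, LinearMap.comp_assoc,
        LinearMap.comp_assoc, ← LinearMap.comp_add, hsplit]
      rfl
    have e4 : y = tensorD D δ w + map i LinearMap.id v' := by rw [hv']; abel
    rw [map_add, map_add, e1, e2]
    conv_lhs => rw [e4, e3, hxt, map_add, tmap_tmap, tmap_tmap, LinearMap.id_comp, LinearMap.id_comp,
      LinearMap.comp_id]
    abel

end Kunneth

/-! ### The length filtration of the bar construction -/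

section Filtration

/-- A comparison theorem for maps of complexes with exhaustive filtrations that start at zero. -/
theorem isHomologyIso_of_filtration {R : Type*} [CommRing R] {X Y : Type*} [AddCommGroup X]
    [Module R X] [AddCommGroup Y] [Module R Y] {dX : X →ₗ[R] X} {dY : Y →ₗ[R] Y} {Φ : X →ₗ[R] Y}
    (hΦ : ∀ x, Φ (dX x) = dY (Φ x)) (hdX : ∀ x, dX (dX x) = 0) (hdY : ∀ y, dY (dY y) = 0)
    {LX FX : ℕ → Submodule R X} {LY FY : ℕ → Submodule R Y} {D₁ : Y →ₗ[R] Y} {J : X →ₗ[R] Y}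
    (hFX0 : FX 0 = ⊥) (hFY0 : FY 0 = ⊥) (hFX : ∀ n, FX (n + 1) = LX n ⊔ FX n)
    (hFY : ∀ n, FY (n + 1) = LY n ⊔ FY n) (hXtop : ∀ x, ∃ n, x ∈ FX n)
    (hYtop : ∀ y, ∃ n, y ∈ FY n) (hdisj : ∀ n, ∀ y ∈ LY n, y ∈ FY n → y = 0)
    (hdXL : ∀ n, ∀ x ∈ LX n, dX x ∈ FX n) (hdYL : ∀ n, ∀ y ∈ LY n, dY y - D₁ y ∈ FY n)
    (hΦL : ∀ n, ∀ x ∈ LX n, Φ x - J x ∈ FY n) (hD₁L : ∀ n, ∀ y ∈ LY n, D₁ y ∈ LY n)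
    (hJL : ∀ n, ∀ x ∈ LX n, J x ∈ LY n)
    (hinj : ∀ n, ∀ x ∈ LX n, ∀ z ∈ LY n, J x = D₁ z → x = 0)
    (hsurj : ∀ n, ∀ y ∈ LY n, D₁ y = 0 → ∃ x ∈ LX n, ∃ z ∈ LY n, y = J x + D₁ z) :
    IsHomologyIso dX dY Φ := by
  have hFYle : ∀ n, FY n ≤ FY (n + 1) := fun n => by rw [hFY]; exact le_sup_right
  have hFXle : ∀ n, FX n ≤ FX (n + 1) := fun n => by rw [hFX]; exact le_sup_right
  have hLXle : ∀ n, LX n ≤ FX (n + 1) := fun n => by rw [hFX]; exact le_sup_left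
  have hLYle : ∀ n, LY n ≤ FY (n + 1) := fun n => by rw [hFY]; exact le_sup_left
  have hYdec : ∀ n, ∀ y ∈ FY (n + 1), ∃ t ∈ LY n, ∃ s ∈ FY n, t + s = y := fun n y hy => by
    rw [hFY] at hy; exact Submodule.mem_sup.1 hy
  have hXdec : ∀ n, ∀ y ∈ FX (n + 1), ∃ t ∈ LX n, ∃ s ∈ FX n, t + s = y := fun n y hy => by
    rw [hFX] at hy; exact Submodule.mem_sup.1 hy
  have hdYF : ∀ n, ∀ y ∈ FY n, dY y ∈ FY n := by
    intro n
    induction n with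
    | zero =>
      intro y hy; rw [hFY0, Submodule.mem_bot] at hy
      rw [hy, map_zero]; exact zero_mem _
    | succ n ih =>
      intro y hy
      obtain ⟨t, ht, s, hs, rfl⟩ := hYdec n y hy
      rw [map_add]
      refine add_mem ?_ (hFYle n (ih s hs))
      rw [← sub_add_cancel (dY t) (D₁ t)]
      exact add_mem (hFYle n (hdYL n t ht)) (hLYle n (hD₁L n t ht))
  have hΦF : ∀ n, ∀ x ∈ FX n, Φ x ∈ FY n := by
    intro n
    induction n with
    | zero =>
      intro y hy; rw [hFX0, Submodule.mem_bot] at hy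
      rw [hy, map_zero]; exact zero_mem _
    | succ n ih =>
      intro y hy
      obtain ⟨t, ht, s, hs, rfl⟩ := hXdec n y hy
      rw [map_add]
      refine add_mem ?_ (hFYle n (ih s hs))
      rw [← sub_add_cancel (Φ t) (J t)]
      exact add_mem (hFYle n (hΦL n t ht)) (hLYle n (hJL n t ht))
  -- The isomorphism is proved in each filtration step, with all witnesses in the same step, so that
  -- the two halves can feed each other in the induction.
  have key : ∀ n,
      (∀ x ∈ FX n, dX x = 0 → ∀ z ∈ FY n, Φ x = dY z → ∃ w ∈ FX n, x = dX w) ∧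
      (∀ y ∈ FY n, dY y = 0 → ∃ x ∈ FX n, ∃ z ∈ FY n, dX x = 0 ∧ y = Φ x + dY z) := by
    intro n
    induction n with
    | zero =>
      refine ⟨fun x hx _ _ _ _ => ⟨0, zero_mem _, ?_⟩, fun y hy _ =>
        ⟨0, zero_mem _, 0, zero_mem _, map_zero _, ?_⟩⟩
      · rw [hFX0, Submodule.mem_bot] at hx; rw [hx, map_zero]
      · rw [hFY0, Submodule.mem_bot] at hy; simp [hy]
    | succ n ih =>
      obtain ⟨ihi, ihs⟩ := ih
      have hΦt : ∀ t ∈ LX n, ∀ s ∈ FX n, Φ (t + s) - J t ∈ FY n := fun t ht s hs => by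
        rw [map_add, add_sub_right_comm]; exact add_mem (hΦL n t ht) (hΦF n s hs)
      have hdt : ∀ t ∈ LY n, ∀ s ∈ FY n, dY (t + s) - D₁ t ∈ FY n := fun t ht s hs => by
        rw [map_add, add_sub_right_comm]; exact add_mem (hdYL n t ht) (hdYF n s hs)
      constructor
      · intro x hx hdx z hz hxz
        obtain ⟨xn, hxn, x', hx', rfl⟩ := hXdec n x hx
        obtain ⟨zn, hzn, z', hz', rfl⟩ := hYdec n z hz
        -- Comparison of leading terms: the difference lies in `LY n` and in `FY n`.
        have h0 : J xn - D₁ zn = 0 := by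
          refine hdisj n _ (sub_mem (hJL n xn hxn) (hD₁L n zn hzn)) ?_
          have := sub_mem (hdt zn hzn z' hz') (hΦt xn hxn x' hx')
          rw [hxz] at this
          convert this using 1
          abel
        have h1 := hinj n xn hxn zn hzn (sub_eq_zero.1 h0)
        subst h1
        rw [map_zero, zero_sub, neg_eq_zero] at h0
        -- The leading term of `z` is a cycle for `D₁`. Subtracting `Φ s + dY t` from `z` and `dX s`
        -- from `x` lowers the filtration without changing the problem.
        obtain ⟨s, hs, t, ht, hst⟩ := hsurj n zn hzn h0
        have h2 : zn + z' - dY t - Φ s ∈ FY n := by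
          have := sub_mem (sub_mem hz' (hdYL n t ht)) (hΦL n s hs)
          rw [hst]
          convert this using 1
          abel
        obtain ⟨w, hw, e⟩ := ihi (x' - dX s) (sub_mem hx' (hdXL n s hs))
          (by rw [map_sub, hdX, sub_zero]; simpa using hdx) _ h2
          (by
            rw [map_sub, map_sub, map_sub, hdY, sub_zero, ← hxz, hΦ, zero_add])
        refine ⟨s + w, add_mem (hLXle n hs) (hFXle n hw), ?_⟩
        rw [map_add, ← e]
        abel
      · intro y hy hdy
        obtain ⟨yn, hyn, y', hy', rfl⟩ := hYdec n y hy
        have h0 : D₁ yn = 0 := by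
          refine hdisj n _ (hD₁L n yn hyn) ?_
          have := hdt yn hyn y' hy'
          rw [hdy, zero_sub] at this
          simpa using this
        obtain ⟨s, hs, t, ht, hst⟩ := hsurj n yn hyn h0
        have h1 : yn + y' - Φ s - dY t ∈ FY n := by
          have := sub_mem (sub_mem hy' (hdYL n t ht)) (hΦL n s hs)
          rw [hst]
          convert this using 1
          abel
        -- The approximation `s` need not be a cycle, but `Φ (dX s)` bounds in `FY n`, so `dX s = dX
        -- w` with `w` of lower filtration. Then `s - w` is a cycle with the same leading term.
        obtain ⟨w, hw, e⟩ := ihi (dX s) (hdXL n s hs) (hdX s) _ (neg_mem h1)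
          (by rw [map_neg, map_sub, map_sub, hdY, hdy, hΦ]; abel)
        obtain ⟨x₂, hx₂, z₂, hz₂, hdx₂, e₂⟩ := ihs (yn + y' - Φ s - dY t + Φ w)
          (add_mem h1 (hΦF n w hw))
          (by rw [map_add, map_sub, map_sub, hdY, hdy, ← hΦ, ← hΦ, e]; abel)
        refine ⟨s - w + x₂, add_mem (sub_mem (hLXle n hs) (hFXle n hw)) (hFXle n hx₂), t + z₂,
          add_mem (hLYle n ht) (hFYle n hz₂), ?_, ?_⟩
        · rw [map_add, map_sub, e, hdx₂]; abel
        · rw [map_add, map_add, map_sub]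
          have e₃ : yn + y' = Φ x₂ + dY z₂ + (Φ s + dY t) - Φ w := by
            rw [← e₂]; abel
          rw [e₃]; abel
  have hXmono : Monotone FX := monotone_nat_of_le_succ hFXle
  have hYmono : Monotone FY := monotone_nat_of_le_succ hFYle
  refine ⟨hΦ, ?_, ?_⟩
  · rintro x hx ⟨z, hz⟩
    obtain ⟨n, hn⟩ := hXtop x
    obtain ⟨k, hk⟩ := hYtop z
    obtain ⟨w, -, e⟩ := (key (max n k)).1 x (hXmono (le_max_left _ _) hn) hx z
      (hYmono (le_max_right _ _) hk) hz
    exact ⟨w, e⟩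
  · intro y hy
    obtain ⟨n, hn⟩ := hYtop y
    obtain ⟨x, -, z, -, hx, e⟩ := (key n).2 y hn hy
    exact ⟨x, z, hx, e⟩

end Filtration

/-! ### Words in the tensor algebra and their lengths. -/

section Words

variable {R : Type u} [CommRing R] {M : Type v} [AddCommGroup M] [Module R M]
  {N : Type w} [AddCommGroup N] [Module R N]

theorem word_nil : Ops.word R M [] = 1 := rfl

theorem word_cons (x : M) (l : List M) :
    Ops.word R M (x :: l) = TensorAlgebra.ι R x * Ops.word R M l := List.prod_cons

theorem word_append (a b : List M) :
    Ops.word R M (a ++ b) = Ops.word R M a * Ops.word R M b := by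
  simp [Ops.word]

variable (R M) in
/-- The span of the words with `n` letters. -/
def wordSpan (n : ℕ) : Submodule R (TensorAlgebra R M) :=
  Submodule.span R {t | ∃ a : List M, a.length = n ∧ Ops.word R M a = t}

variable (R M) in
/-- The span of the words with fewer than `n` letters. -/
def wordFiltration (n : ℕ) : Submodule R (TensorAlgebra R M) :=
  Submodule.span R {t | ∃ a : List M, a.length < n ∧ Ops.word R M a = t}

theorem word_mem_wordSpan {n : ℕ} {a : List M} (h : a.length = n) :
    Ops.word R M a ∈ wordSpan R M n := Submodule.subset_span ⟨a, h, rfl⟩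

theorem word_mem_wordFiltration {n : ℕ} {a : List M} (h : a.length < n) :
    Ops.word R M a ∈ wordFiltration R M n := Submodule.subset_span ⟨a, h, rfl⟩

theorem wordFiltration_zero : wordFiltration R M 0 = ⊥ := by
  simp [wordFiltration]

theorem wordFiltration_succ (n : ℕ) :
    wordFiltration R M (n + 1) = wordSpan R M n ⊔ wordFiltration R M n := by
  rw [wordFiltration, wordSpan, wordFiltration, ← Submodule.span_union]
  congr 1
  ext t
  simp only [Set.mem_ofPred_eq, Set.mem_union]
  constructor
  · rintro ⟨a, h, rfl⟩
    rcases Nat.lt_succ_iff_lt_or_eq.1 h with h | h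
    · exact .inr ⟨a, h, rfl⟩
    · exact .inl ⟨a, h, rfl⟩
  · rintro (⟨a, h, rfl⟩ | ⟨a, h, rfl⟩)
    · exact ⟨a, by lia, rfl⟩
    · exact ⟨a, by lia, rfl⟩

theorem span_word : Submodule.span R (Set.range (Ops.word R M)) = ⊤ := by
  rw [eq_top_iff]
  rintro t -
  induction t using TensorAlgebra.induction with
  | algebraMap r =>
    rw [Algebra.algebraMap_eq_smul_one]
    exact Submodule.smul_mem _ _ (Submodule.subset_span ⟨[], rfl⟩)
  | ι x => exact Submodule.subset_span ⟨[x], by simp [Ops.word]⟩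
  | add a b ha hb => exact add_mem ha hb
  | mul a b ha hb =>
    have h := Submodule.mul_mem_mul ha hb
    rw [Submodule.span_mul_span] at h
    refine Submodule.span_mono ?_ h
    rintro _ ⟨_, ⟨p, rfl⟩, _, ⟨q, rfl⟩, rfl⟩
    exact ⟨p ++ q, word_append p q⟩

theorem exists_mem_wordFiltration (t : TensorAlgebra R M) : ∃ n, t ∈ wordFiltration R M n := by
  have ht : t ∈ Submodule.span R (Set.range (Ops.word R M)) := by rw [span_word]; trivial
  have hmono : Monotone (wordFiltration R M) := monotone_nat_of_le_succ fun n => by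
    rw [wordFiltration_succ]; exact le_sup_right
  induction ht using Submodule.span_induction with
  | mem t h =>
    obtain ⟨a, rfl⟩ := h
    exact ⟨a.length + 1, word_mem_wordFiltration (Nat.lt_succ_self _)⟩
  | zero => exact ⟨0, zero_mem _⟩
  | add a b _ _ ha hb =>
    obtain ⟨n, hn⟩ := ha
    obtain ⟨k, hk⟩ := hb
    exact ⟨max n k, add_mem (hmono (le_max_left _ _) hn) (hmono (le_max_right _ _) hk)⟩
  | smul c a _ ha =>
    obtain ⟨n, hn⟩ := ha
    exact ⟨n, Submodule.smul_mem _ _ hn⟩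

theorem linearMap_ext_word {f g : TensorAlgebra R M →ₗ[R] N}
    (h : ∀ a, f (Ops.word R M a) = g (Ops.word R M a)) : f = g := by
  refine LinearMap.ext_on span_word ?_
  rintro _ ⟨a, rfl⟩
  exact h a

theorem mem_of_mem_wordSpan {n : ℕ} (S : Submodule R N) {f : TensorAlgebra R M →ₗ[R] N}
    (h : ∀ a : List M, a.length = n → f (Ops.word R M a) ∈ S) {t : TensorAlgebra R M}
    (ht : t ∈ wordSpan R M n) : f t ∈ S := by
  have : wordSpan R M n ≤ S.comap f := by
    refine Submodule.span_le.2 ?_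
    rintro _ ⟨a, ha, rfl⟩
    exact h a ha
  exact this ht

variable (R M) in
/-- The projection to the span of the words with `n` letters. -/
noncomputable def wordProj (n : ℕ) : TensorAlgebra R M →ₗ[R] TensorAlgebra R M :=
  ((Ops.word R M).component n).toLinear

theorem wordProj_word (n : ℕ) (a : List M) :
    wordProj R M n (Ops.word R M a) = if a.length = n then Ops.word R M a else 0 :=
  Ops.toLinear_word _ a

theorem wordProj_mem (n : ℕ) (t : TensorAlgebra R M) : wordProj R M n t ∈ wordSpan R M n := by
  have ht : t ∈ Submodule.span R (Set.range (Ops.word R M)) := by rw [span_word]; trivial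
  have : Submodule.span R (Set.range (Ops.word R M)) ≤ (wordSpan R M n).comap (wordProj R M n) := by
    refine Submodule.span_le.2 ?_
    rintro _ ⟨a, rfl⟩
    change wordProj R M n _ ∈ wordSpan R M n
    rw [wordProj_word]
    split_ifs with h
    · exact word_mem_wordSpan h
    · exact zero_mem _
  exact this ht

theorem wordProj_of_mem {n : ℕ} {t : TensorAlgebra R M} (ht : t ∈ wordSpan R M n) :
    wordProj R M n t = t := by
  have := mem_of_mem_wordSpan (n := n) ⊥ (f := wordProj R M n - LinearMap.id)
    (fun a ha => by simp [wordProj_word, ha]) ht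
  rw [Submodule.mem_bot, LinearMap.sub_apply, sub_eq_zero] at this
  exact this

theorem wordProj_of_mem_wordFiltration {n : ℕ} {t : TensorAlgebra R M}
    (ht : t ∈ wordFiltration R M n) : wordProj R M n t = 0 := by
  have : wordFiltration R M n ≤ LinearMap.ker (wordProj R M n) := by
    refine Submodule.span_le.2 ?_
    rintro _ ⟨a, ha, rfl⟩
    change wordProj R M n _ = 0
    rw [wordProj_word, if_neg ha.ne]
  exact this ht

theorem wordSpan_ext {n : ℕ} {f g : wordSpan R M n →ₗ[R] N}
    (h : ∀ (a : List M) (ha : a.length = n), f ⟨_, word_mem_wordSpan ha⟩ =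
      g ⟨_, word_mem_wordSpan ha⟩) : f = g := by
  let π : TensorAlgebra R M →ₗ[R] wordSpan R M n := (wordProj R M n).codRestrict _ (wordProj_mem n)
  have hπ : ∀ t : wordSpan R M n, π t = t := fun t => Subtype.ext (wordProj_of_mem t.2)
  ext t
  have := mem_of_mem_wordSpan (n := n) ⊥ (f := (f - g) ∘ₗ π) (fun a ha => by
    have e : π (Ops.word R M a) = ⟨_, word_mem_wordSpan ha⟩ := hπ ⟨_, word_mem_wordSpan ha⟩
    rw [LinearMap.comp_apply, e, LinearMap.sub_apply, h a ha, sub_self]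
    exact zero_mem _) t.2
  rw [Submodule.mem_bot, LinearMap.comp_apply, hπ, LinearMap.sub_apply, sub_eq_zero] at this
  exact this

open TensorProduct

variable (R M) in
/-- Adding a letter at the beginning. -/
noncomputable def wordCons (n : ℕ) : M ⊗[R] wordSpan R M n →ₗ[R] wordSpan R M (n + 1) :=
  LinearMap.codRestrict _ (TensorProduct.lift
    ((LinearMap.mul R (TensorAlgebra R M) ∘ₗ TensorAlgebra.ι R).compl₂ (wordSpan R M n).subtype))
    (by
      intro t
      induction t using TensorProduct.induction_on with
      | zero => rw [map_zero]; exact zero_mem _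
      | add a b ha hb => rw [map_add]; exact add_mem ha hb
      | tmul x t =>
        refine mem_of_mem_wordSpan (n := n) _ (f := LinearMap.mulLeft R (TensorAlgebra.ι R x)) ?_ t.2
        intro a ha
        exact word_mem_wordSpan (a := x :: a) (by simp [ha]))

/-- Removing the first letter gives a left inverse; surjectivity holds because words span. -/
theorem wordCons_bijective (n : ℕ) : Function.Bijective (wordCons R M n) := by
  let π : TensorAlgebra R M →ₗ[R] wordSpan R M n := (wordProj R M n).codRestrict _ (wordProj_mem n)
  have hπ : ∀ t : wordSpan R M n, π t = t := fun t => Subtype.ext (wordProj_of_mem t.2)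
  -- The value on the empty word is arbitrary, since `ν` is applied to words with `n + 1` letters.
  let ν : Ops R M (M ⊗[R] wordSpan R M n) :=
    { toFun := fun a => match a with
        | [] => 0
        | x :: l => x ⊗ₜ π (Ops.word R M l)
      linear := fun l r => by
        rcases l with _ | ⟨y, l⟩
        · exact ((TensorProduct.mk R M _).flip (π (Ops.word R M r))).isLinear
        · exact ((TensorProduct.mk R M _ y) ∘ₗ π ∘ₗ ((Ops.word R M).linear l r).mk' _).isLinear }
  have hν : ∀ x l, ν.toLinear (Ops.word R M (x :: l)) = x ⊗ₜ π (Ops.word R M l) := fun x l =>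
    Ops.toLinear_word ν (x :: l)
  constructor
  · have : (ν.toLinear ∘ₗ (wordSpan R M (n + 1)).subtype) ∘ₗ wordCons R M n = LinearMap.id := by
      apply TensorProduct.ext
      ext x : 1
      apply wordSpan_ext
      intro a ha
      have := hν x a
      rw [hπ ⟨_, word_mem_wordSpan ha⟩] at this
      exact this
    exact Function.LeftInverse.injective
      (g := ν.toLinear ∘ₗ (wordSpan R M (n + 1)).subtype) fun t => LinearMap.congr_fun this t
  · rintro ⟨t, ht⟩
    have : wordSpan R M (n + 1) ≤
        LinearMap.range ((wordSpan R M (n + 1)).subtype ∘ₗ wordCons R M n) := by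
      refine Submodule.span_le.2 ?_
      rintro _ ⟨a, ha, rfl⟩
      rcases a with _ | ⟨x, l⟩
      · simp at ha
      · exact ⟨x ⊗ₜ ⟨_, word_mem_wordSpan (a := l) (by simpa using ha)⟩, rfl⟩
    obtain ⟨s, hs⟩ := this ht
    exact ⟨s, Subtype.ext hs⟩

end Words

/-! ### The map of bar constructions -/

section Bar

open TensorProduct

theorem IsFormalModel.of_equiv {R : Type*} [CommRing R] {N L N' L' : Type*} [AddCommGroup N]
    [Module R N] [AddCommGroup L] [Module R L] [AddCommGroup N'] [Module R N'] [AddCommGroup L']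
    [Module R L'] {j : N →ₗ[R] L} {δ : L →ₗ[R] L} {j' : N' →ₗ[R] L'} {δ' : L' →ₗ[R] L'}
    (h : IsFormalModel j δ) (e : N ≃ₗ[R] N') (e' : L ≃ₗ[R] L') (hj : ∀ x, j' (e x) = e' (j x))
    (hδ : ∀ y, δ' (e' y) = e' (δ y)) : IsFormalModel j' δ' where
  comp_self := by
    ext y
    obtain ⟨y, rfl⟩ := e'.surjective y
    simpa [hδ] using LinearMap.congr_fun h.comp_self y
  comp := by
    ext x
    obtain ⟨x, rfl⟩ := e.surjective x
    simpa [hδ, hj] using LinearMap.congr_fun h.comp x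
  injective x z hxz := by
    obtain ⟨x, rfl⟩ := e.surjective x
    obtain ⟨z, rfl⟩ := e'.surjective z
    rw [hj, hδ] at hxz
    rw [h.injective x z (e'.injective hxz), map_zero]
  surjective y hy := by
    obtain ⟨y, rfl⟩ := e'.surjective y
    rw [hδ] at hy
    obtain ⟨x, z, rfl⟩ := h.surjective y (e'.injective (hy.trans (map_zero _).symm))
    exact ⟨e x, e' z, by rw [hj, hδ, map_add]⟩

section General

variable {R : Type u} [CommRing R] {M : Type v} [AddCommGroup M] [Module R M]
  {N : Type w} [AddCommGroup N] [Module R N]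

theorem barD_word (G : Grading R M) (m : Ops R M M) (a : List M) :
    barD G m (Ops.word R M a) = ins (fun b => -G.parity b) (Ops.word R M) (m.susp G) a := by
  rw [barD, Ops.toLinear_word, Ops.insert_apply]

theorem barMap_word (G : Grading R M) (f : Ops R M N) (a : List M) :
    barMap G f (Ops.word R M a) = sub (Ops.word R N) (f.susp G) a := by
  rw [barMap, Ops.toLinear_word, Ops.substitute_apply]

/-- By `ins_ins` the square is the coderivation whose components are the Stasheff expressions. -/
theorem IsAInfAlgebra.barD_barD {G : Grading R M} {m : Ops R M M} (h : IsAInfAlgebra G m)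
    (t : TensorAlgebra R M) : barD G m (barD G m t) = 0 := by
  suffices e : barD G m ∘ₗ barD G m = 0 from LinearMap.congr_fun e t
  refine linearMap_ext_word fun a => ?_
  have h0 : ins (fun b => -G.parity b) (m.susp G) (m.susp G) = fun _ => 0 := by
    funext b
    rw [← Ops.insert_apply, h.stasheff]
  rw [LinearMap.comp_apply, barD_word, map_ins]
  simp only [barD_word]
  rw [ins_ins _ G.neg_parity_neg_parity _ _ (fun a => by
    rw [IsHomogeneous.neg_parity_apply h.degree.susp]; simp [Int.negOnePow_neg]), h0]
  exact ins_eq_zero _ fun p q r _ _ => Ops.map_zero_at _ _ _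

theorem IsAInfHom.barMap_barD {G : Grading R M} {m : Ops R M M} {G' : Grading R N} {m' : Ops R N N}
    {f : Ops R M N} (hm' : m' [] = 0) (h : IsAInfHom G m G' m' f) (t : TensorAlgebra R M) :
    barMap G f (barD G m t) = barD G' m' (barMap G f t) := by
  suffices e : barMap G f ∘ₗ barD G m = barD G' m' ∘ₗ barMap G f from LinearMap.congr_fun e t
  refine linearMap_ext_word fun a => ?_
  have hσ : ∀ a, -G'.parity (f.susp G a) = f.susp G (a.map fun b => -G.parity b) := fun a => by
    rw [IsHomogeneous.neg_parity_apply h.degree.susp]; simp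
  have hrel : ∀ a, ins (fun b => -G.parity b) (f.susp G) (m.susp G) a =
      sub (m'.susp G') (f.susp G) a := fun a => by
    rw [← Ops.insert_apply, h.rel, Ops.substitute_apply]
  rw [LinearMap.comp_apply, LinearMap.comp_apply, barD_word, barMap_word, map_ins, map_sub']
  simp only [barD_word, barMap_word]
  have e := ins_sub_sub_sub_ins (fun b => -G.parity b) (fun b => -G'.parity b) (Ops.word R N)
    (f.susp G) (m.susp G) (m'.susp G') hσ hm' a fun b _ => hrel b
  rw [hrel, sub_self, show Ops.word R N [0] = 0 from Ops.map_zero_at _ [] []] at e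
  exact sub_eq_zero.1 e

/-- An operation with at least two arguments shortens the word, so the leading part of the
coderivation depends on the linear component alone. -/
theorem ins_word_sub_mem {σ : M → M} {β β' : List M → M} (h : ∀ x, β [x] = β' [x]) (a : List M) :
    ins σ (Ops.word R M) β a - ins σ (Ops.word R M) β' a ∈ wordFiltration R M a.length := by
  rw [← Submodule.ker_mkQ (wordFiltration R M a.length), LinearMap.mem_ker, map_sub, map_ins,
    map_ins, sub_eq_zero]
  refine ins_congr fun p q r e hq => ?_
  rcases q with _ | ⟨x, _ | ⟨y, q⟩⟩
  · exact absurd rfl hq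
  · rw [h]
  · have hl : p.length + r.length + 1 < a.length := by
      rw [← e]; simp; lia
    have hz : ∀ z, (wordFiltration R M a.length).mkQ (Ops.word R M (p.map σ ++ z :: r)) = 0 := by
      intro z
      rw [Submodule.mkQ_apply, Submodule.Quotient.mk_eq_zero]
      exact word_mem_wordFiltration (by simp; lia)
    rw [hz, hz]

/-- Only the decomposition into single letters keeps the length of the word. -/
theorem sub_word_sub_mem (γ : List M → N) (a : List M) :
    sub (Ops.word R N) γ a - Ops.word R N (a.map fun x => γ [x]) ∈
      wordFiltration R N a.length := by
  rw [← Submodule.ker_mkQ (wordFiltration R N a.length), LinearMap.mem_ker, map_sub, map_sub',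
    sub_eq_zero]
  refine sub_eq_map ((Ops.word R N).postcomp (wordFiltration R N a.length).mkQ) fun b hb => ?_
  change (wordFiltration R N a.length).mkQ (Ops.word R N b) = 0
  rw [Submodule.mkQ_apply, Submodule.Quotient.mk_eq_zero]
  exact word_mem_wordFiltration hb

theorem ins_word_ofLinear_cons (σ : M → M) (d : M →ₗ[R] M) (x : M) (l : List M) :
    ins σ (Ops.word R M) (Ops.ofLinear d) (x :: l) = TensorAlgebra.ι R (d x) * Ops.word R M l +
      TensorAlgebra.ι R (σ x) * ins σ (Ops.word R M) (Ops.ofLinear d) l := by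
  have e : ins σ (fun p => Ops.word R M (σ x :: p)) (Ops.ofLinear d) l =
      TensorAlgebra.ι R (σ x) * ins σ (Ops.word R M) (Ops.ofLinear d) l := by
    rw [← LinearMap.mulLeft_apply (R := R), map_ins]
    simp only [word_cons, LinearMap.mulLeft_apply]
  rw [ins_cons, e]
  congr 1
  rw [splitSum_eq_first]
  · exact word_cons _ _
  · intro p s _ hp
    cases p with
    | nil => exact absurd rfl hp
    | cons y p => exact Ops.map_zero_at _ [] s

/-- The map of tensor algebras induced by a linear map. -/
noncomputable def wordMap (f : M →ₗ[R] N) : TensorAlgebra R M →ₗ[R] TensorAlgebra R N :=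
  (TensorAlgebra.lift R (TensorAlgebra.ι R ∘ₗ f)).toLinearMap

theorem wordMap_ι_mul (f : M →ₗ[R] N) (x : M) (t : TensorAlgebra R M) :
    wordMap f (TensorAlgebra.ι R x * t) = TensorAlgebra.ι R (f x) * wordMap f t := by
  simp [wordMap]

theorem wordMap_word (f : M →ₗ[R] N) (a : List M) :
    wordMap f (Ops.word R M a) = Ops.word R N (a.map f) := by
  induction a with
  | nil => simp [wordMap, word_nil]
  | cons x l ih => rw [word_cons, wordMap_ι_mul, ih, List.map_cons, word_cons]

theorem wordMap_mem (f : M →ₗ[R] N) {n : ℕ} {t : TensorAlgebra R M} (ht : t ∈ wordSpan R M n) :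
    wordMap f t ∈ wordSpan R N n :=
  mem_of_mem_wordSpan _ (fun a ha => by
    rw [wordMap_word]; exact word_mem_wordSpan (by simpa using ha)) ht

end General

variable {R : Type u} [CommRing R] {A : Type v} [AddCommGroup A] [Module R A]

/-- The differential of the tensor powers of a complex. -/
noncomputable def wordD (D : DGAlgebra R A) : TensorAlgebra R A →ₗ[R] TensorAlgebra R A :=
  ((Ops.word R A).insert D.toGrading (Ops.ofLinear D.d)).toLinear

theorem wordD_word (D : DGAlgebra R A) (a : List A) :
    wordD D (Ops.word R A a) =
      ins (fun b => -D.parity b) (Ops.word R A) (Ops.ofLinear D.d) a := by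
  rw [wordD, Ops.toLinear_word, Ops.insert_apply]

theorem wordD_ι_mul (D : DGAlgebra R A) (x : A) (t : TensorAlgebra R A) :
    wordD D (TensorAlgebra.ι R x * t) =
      TensorAlgebra.ι R (D.d x) * t + TensorAlgebra.ι R (-D.parity x) * wordD D t := by
  suffices e : wordD D ∘ₗ LinearMap.mulLeft R (TensorAlgebra.ι R x) =
      LinearMap.mulLeft R (TensorAlgebra.ι R (D.d x)) +
        LinearMap.mulLeft R (TensorAlgebra.ι R (-D.parity x)) ∘ₗ wordD D from
    LinearMap.congr_fun e t
  refine linearMap_ext_word fun a => ?_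
  simp only [LinearMap.comp_apply, LinearMap.add_apply, LinearMap.mulLeft_apply]
  rw [← word_cons, wordD_word, ins_word_ofLinear_cons, wordD_word]

theorem wordD_one (D : DGAlgebra R A) : wordD D 1 = 0 := by
  rw [← word_nil (M := A), wordD_word, ins_nil]

theorem wordD_mem (D : DGAlgebra R A) {n : ℕ} {t : TensorAlgebra R A} (ht : t ∈ wordSpan R A n) :
    wordD D t ∈ wordSpan R A n := by
  refine mem_of_mem_wordSpan _ (fun a ha => ?_) ht
  clear ht
  induction a generalizing n with
  | nil => rw [word_nil, wordD_one]; exact zero_mem _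
  | cons x l ih =>
    obtain ⟨k, rfl⟩ : ∃ k, n = k + 1 := ⟨l.length, by simpa using ha.symm⟩
    have hl : l.length = k := by simpa using ha
    rw [word_cons, wordD_ι_mul]
    exact add_mem (wordCons R A k (D.d x ⊗ₜ ⟨_, word_mem_wordSpan hl⟩)).2
      (wordCons R A k ((-D.parity x) ⊗ₜ ⟨_, ih hl⟩)).2

/-- Induction on the length: by `wordCons_bijective` the words with one more letter are `A` tensor
the shorter ones, with the tensor product differential, and `IsFormalModel.tensor` applies. -/
theorem isFormalModel_wordMap {D : DGAlgebra R A} (hpure : D.HasPureCycles)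
    [Module.Free R D.Homology] {ι : D.Homology →ₗ[R] A} (hι : CycleSection D ι) (n : ℕ) :
    IsFormalModel
      ((wordMap ι).restrict (p := wordSpan R D.Homology n) (q := wordSpan R A n)
        fun _ => wordMap_mem ι)
      ((wordD D).restrict (p := wordSpan R A n) (q := wordSpan R A n) fun _ => wordD_mem D) := by
  induction n with
  | zero =>
    -- The span of the empty word is a copy of the ground ring, with zero differential, on both
    -- sides.
    have hspan : ∀ {M : Type v} [AddCommGroup M] [Module R M] (t : wordSpan R M 0),
        ∃ r : R, (t : TensorAlgebra R M) = algebraMap R _ r := by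
      intro M _ _ t
      have ht : (t : TensorAlgebra R M) ∈ Submodule.span R {(1 : TensorAlgebra R M)} := by
        refine Submodule.span_mono ?_ t.2
        rintro _ ⟨a, ha, rfl⟩
        rw [List.length_eq_zero_iff.1 ha]
        rfl
      obtain ⟨r, hr⟩ := Submodule.mem_span_singleton.1 ht
      exact ⟨r, by rw [← hr, Algebra.algebraMap_eq_smul_one]⟩
    have hδ : ∀ t : wordSpan R A 0, wordD D t = 0 := fun t => by
      obtain ⟨r, hr⟩ := hspan t
      rw [hr, Algebra.algebraMap_eq_smul_one, map_smul, wordD_one, smul_zero]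
    have hJ : ∀ r : R, wordMap ι (algebraMap R _ r) = algebraMap R _ r := fun r =>
      (TensorAlgebra.lift R (TensorAlgebra.ι R ∘ₗ ι)).commutes r
    refine ⟨LinearMap.ext fun t => Subtype.ext (hδ _), LinearMap.ext fun t => Subtype.ext (hδ _),
      fun x z h => ?_, fun y _ => ?_⟩
    · have h' : wordMap ι x = 0 := (congrArg Subtype.val h).trans (hδ z)
      obtain ⟨r, hr⟩ := hspan x
      rw [hr, hJ, ← map_zero (algebraMap R _)] at h'
      have := TensorAlgebra.algebraMap_leftInverse (R := R) A |>.injective h'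
      exact Subtype.ext (by rw [hr, this, map_zero]; rfl)
    · obtain ⟨r, hr⟩ := hspan y
      refine ⟨⟨algebraMap R _ r, ?_⟩, 0, Subtype.ext ?_⟩
      · rw [Algebra.algebraMap_eq_smul_one]
        exact Submodule.smul_mem _ _ (word_mem_wordSpan (a := []) rfl)
      · rw [map_zero, add_zero, hr]
        exact (hJ r).symm
  | succ n ih =>
    refine (ih.tensor hpure hι).of_equiv (LinearEquiv.ofBijective _ (wordCons_bijective n))
      (LinearEquiv.ofBijective _ (wordCons_bijective n)) (fun x => ?_) (fun y => ?_)
    · induction x using TensorProduct.induction_on with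
      | zero => simp only [map_zero]
      | add x y hx hy => simp only [map_add, hx, hy]
      | tmul x t => exact Subtype.ext (wordMap_ι_mul ι x t)
    · induction y using TensorProduct.induction_on with
      | zero => simp only [map_zero]
      | add x y hx hy => simp only [map_add, hx, hy]
      | tmul x t =>
        rw [tensorD_apply, map_add]
        exact Subtype.ext (wordD_ι_mul D x t)

/-- A homology structure induces a homology isomorphism of bar constructions if the cycles are
pure. -/
theorem isBarQuasiIso {D : DGAlgebra R A} (hpure : D.HasPureCycles) [Module.Free R D.Homology]
    {m : Ops R D.Homology D.Homology} {f : Ops R D.Homology A} (h : D.IsHomologyStructure m f) :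
    IsBarQuasiIso D.homologyGrading m D.toGrading D.ops f := by
  have hι := CycleSection.of_isHomologyStructure h
  have hmodel := isFormalModel_wordMap hpure hι
  -- The filtration is by word length. By minimality the differential on the left has no leading
  -- part; on the right it is `wordD D`, and that of the map is the tensor power of `f_1`.
  refine isHomologyIso_of_filtration (LX := wordSpan R D.Homology) (FX := wordFiltration R D.Homology)
    (LY := wordSpan R A) (FY := wordFiltration R A) (D₁ := wordD D) (J := wordMap f.first)
    (h.isAInfHom.barMap_barD rfl) h.isAInfAlgebra.barD_barD D.isAInfAlgebra_ops.barD_barD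
    wordFiltration_zero wordFiltration_zero wordFiltration_succ wordFiltration_succ
    exists_mem_wordFiltration exists_mem_wordFiltration
    (fun n y h1 h2 => (wordProj_of_mem h1).symm.trans (wordProj_of_mem_wordFiltration h2))
    (fun n x hx => ?_) (fun n y hy => ?_) (fun n x hx => ?_) (fun n y => wordD_mem D)
    (fun n x => wordMap_mem _) (fun n x hx z hz e => ?_) (fun n y hy e => ?_)
  · refine mem_of_mem_wordSpan _ (fun a ha => ?_) hx
    have := ins_word_sub_mem (R := R) (σ := fun b => -D.homologyGrading.parity b)
      (β := m.susp D.homologyGrading) (β' := fun _ => 0)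
      (fun x => (susp_one m x).trans (h.minimal x)) a
    rw [ins_eq_zero (β := fun _ => 0) _ fun p q r _ _ => Ops.map_zero_at _ _ _, sub_zero, ha] at this
    rwa [barD_word]
  · refine mem_of_mem_wordSpan (f := barD D.toGrading D.ops - wordD D) _ (fun a ha => ?_) hy
    rw [LinearMap.sub_apply, barD_word, wordD_word, ← ha]
    exact ins_word_sub_mem (R := R) (β := D.ops.susp D.toGrading) (β' := Ops.ofLinear D.d)
      (fun x => susp_one D.ops x) a
  · refine mem_of_mem_wordSpan (f := barMap D.homologyGrading f - wordMap f.first) _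
      (fun a ha => ?_) hx
    rw [LinearMap.sub_apply, barMap_word, wordMap_word, ← ha]
    have := sub_word_sub_mem (R := R) (f.susp D.homologyGrading) a
    simp only [susp_one] at this
    exact this
  · exact congrArg Subtype.val ((hmodel n).injective ⟨x, hx⟩ ⟨z, hz⟩ (Subtype.ext e))
  · obtain ⟨x, z, e'⟩ := (hmodel n).surjective ⟨y, hy⟩ (Subtype.ext e)
    exact ⟨x, x.2, z, z.2, congrArg Subtype.val e'⟩

end Bar

end AInf

open AInf in
theorem mainTheorem1 {R : Type*} [CommRing R] {A : Type*} [AddCommGroup A] [Module R A]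
    (D : DGAlgebra R A) (hfree : ∀ i : ℤ, Module.Free R (D.homologyDeg i)) :
    -- (a)
    ((∃ (m : Ops R D.Homology D.Homology) (f : Ops R D.Homology A), D.IsHomologyStructure m f) ∧
      (D.HasPureCycles → ∀ (m : Ops R D.Homology D.Homology) (f : Ops R D.Homology A),
        D.IsHomologyStructure m f → IsBarQuasiIso D.homologyGrading m D.toGrading D.ops f)) ∧
    -- (b)
    (∀ (A' : Type*) [AddCommGroup A'] [Module R A'] (D' : DGAlgebra R A') (g : DGHom D D')
      (m : Ops R D.Homology D.Homology) (f : Ops R D.Homology A)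
      (m' : Ops R D'.Homology D'.Homology) (f' : Ops R D'.Homology A'),
      D.IsHomologyStructure m f → D'.IsHomologyStructure m' f' →
      ∃ G : Ops R D.Homology D'.Homology,
        IsAInfHom D.homologyGrading m D'.homologyGrading m' G ∧
        (∀ x, G [x] = g.homologyMap x) ∧
        AInfHomotopic D.homologyGrading m D'.toGrading D'.ops
          (Ops.comp D.homologyGrading D'.homologyGrading f' G)
          (Ops.comp D.homologyGrading D.toGrading (Ops.ofLinear g.toLinearMap) f)) ∧
    -- (c)
    (∀ (m : Ops R D.Homology D.Homology) (f : Ops R D.Homology A)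
      (m' : Ops R D.Homology D.Homology) (f' : Ops R D.Homology A),
      D.IsHomologyStructure m f → D.IsHomologyStructure m' f' →
      ∃ G : Ops R D.Homology D.Homology,
        IsAInfIso D.homologyGrading m D.homologyGrading m' G ∧ ∀ x, G [x] = x) := by
  obtain ⟨κ, ⟨b⟩⟩ := D.homologyGrading.exists_gradedBasis hfree
  have : Module.Free R D.Homology := Module.Free.of_basis b.basis
  refine ⟨⟨exists_isHomologyStructure b, fun hpure m f h => isBarQuasiIso hpure h⟩,
    fun A' _ _ D' g m f m' f' h h' => exists_ainfHom_homotopic b g h h',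
    fun m f m' f' h h' => ?_⟩
  -- Part (c) is part (b) for the identity map of `A`: the resulting morphism has identity linear
  -- part and is therefore invertible.
  let g : DGHom D D :=
    { toLinearMap := LinearMap.id
      map_mem := fun _ _ ha => ha
      map_d := fun _ => rfl
      map_mul := fun _ _ => rfl }
  have hg : ∀ x, g.homologyMap x = x := fun x => by
    obtain ⟨z, rfl⟩ := D.cls_surjective x
    rfl
  obtain ⟨G, hG, hG1, -⟩ := exists_ainfHom_homotopic b g h h'
  exact ⟨G, hG.isAInfIso h.isAInfAlgebra.nil h'.isAInfAlgebra.nil fun x => (hG1 x).trans (hg x),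
    fun x => (hG1 x).trans (hg x)⟩
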